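/- Let $m\in\mathbb R$. For a continuous $\zeta:\mathbb R\to\mathbb R$ with $1+\zeta>0$ put $\mathcal D=\mathcal D_\zeta=\{(x,y): x\in\mathbb R,\ 0\le y\le 1+\zeta(x)\}$. Let $\mathcal K$ be the set of pairs $(\psi,\zeta)$, $\zeta\not\equiv0$, such that (i) $\zeta\in L^1(\mathbb R)$, $\int_{-\infty}^{\infty}\zeta\,dx=m$ and $\int_{-\infty}^{\infty}\zeta^2\,dx<\infty$; (ii) $\psi(x,0)=0$ and $\psi(x,1+\zeta(x))=1$, in the sense that $\psi$, continued by $0$ to $\{y\le 0\}$ and by $1$ to $\{y\ge 1+\zeta(x)\}$, is weakly differentiable on $\mathbb R^2$; (iii) $\iint_{\mathcal D}[\psi_x^2+(\psi_y-1)^2]\,dx\,dy<\infty$. On $\mathcal K$ consider the quotient $$R(\psi,\zeta)=\frac{\iint_{\mathcal D}[(\nabla\psi)^2-1]\,dx\,dy}{\int_{-\infty}^{\infty}\zeta^2\,dx},$$ where the double integral is taken first in $y$ and then in $x$ (it then converges absolutely, and it is the Lebesgue integral whenever the latter exists). Let $(\psi,\zeta)\in\mathcal K$ be a minimizer of $R$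 over $\mathcal K$ or, more generally, a local one: for some $\delta\in(0,\infty]$ it attains the infimum $\lambda$ of $R$ over all $(\psi',\zeta')\in\mathcal K$ with $$\sup_{x}|\zeta'-\zeta|+\|\psi'_x-\psi_x\|_{L^2(\mathbb R^2)}+\|\psi'_y-\psi_y\|_{L^2(\mathbb R^2)}\le\delta$$ (stream functions continued as in (ii); for $\delta=\infty$ there is no restriction and $\lambda=\inf_{\mathcal K}R$). Then $\psi$ is harmonic in the interior of $\mathcal D$ (after modification on a null set). If moreover $\zeta\in C^1(\mathbb R)$ and $\psi\in H^2(\mathcal D)$, in the sense that the second weak derivatives of $\psi$ are in $L^2(\mathcal D)$, then $\nabla\psi(x,y)$ has a limit as $y\uparrow 1+\zeta(x)$ for almost every $x$, and these boundary values satisfy the Bernoulli equation $$(\nabla\psi)^2+2\lambda\zeta=1\qquad\text{on the free surface } y=1+\zeta(x)\text{ (where } \psi=1)$$ for almost every $x$. Hence $\psi$ is then the stream function of an irrotational gravity wave: there is a harmonic velocity potential $\varphi$ in the interior of $\mathcal D$ with $\varphi_x=\psi_y$, $\varphi_y=-\psi_x$ and $\iint_{\mathcal D}[(\varphi_x-1)^2+\varphi_y^2]\,dx\,dy<\infty$,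 such that $\varphi_y=\varphi_x\zeta_x$ and $\tfrac12(\nabla\varphi)^2+\lambda\zeta=\tfrac12$ on the free surface and $\varphi_y=0$ on the bottom $y=0$, as vertical limits at almost every $x$. -/

import Mathlib

open MeasureTheory Filter Topology Set
open scoped ENNReal ContDiff

noncomputable section

namespace WaterWave

/-- The interior `{0 < y < 1 + ζ(x)}` of the fluid region `D = {0 ≤ y ≤ 1 + ζ(x)}`. -/
def fluidDomain (ζ : ℝ → ℝ) : Set (ℝ × ℝ) :=
  {z | 0 < z.2 ∧ z.2 < 1 + ζ z.1}

/-- `g` is the weak derivative of `f` in the direction `v` on the open set `U`. -/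
structure HasWeakDeriv (U : Set (ℝ × ℝ)) (v : ℝ × ℝ) (f g : ℝ × ℝ → ℝ) : Prop where
  locallyIntegrableOn : LocallyIntegrableOn f U
  locallyIntegrableOn_deriv : LocallyIntegrableOn g U
  integral_eq : ∀ φ : ℝ × ℝ → ℝ, ContDiff ℝ ∞ φ → HasCompactSupport φ → tsupport φ ⊆ U →
    ∫ z, f z * fderiv ℝ φ z v = - ∫ z, g z * φ z

open Classical in
/-- The weak derivative on the whole plane of `f` in the direction `v`. It is determined up to
a null set when it exists (and is `0` by convention when it does not). -/
def weakDeriv (v : ℝ × ℝ) (f : ℝ × ℝ → ℝ) : ℝ × ℝ → ℝ :=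
  if h : ∃ g, HasWeakDeriv univ v f g then h.choose else 0

/-- The weak partial derivative `f_x`. -/
def wdx (f : ℝ × ℝ → ℝ) : ℝ × ℝ → ℝ := weakDeriv (1, 0) f

/-- The weak partial derivative `f_y`. -/
def wdy (f : ℝ × ℝ → ℝ) : ℝ × ℝ → ℝ := weakDeriv (0, 1) f

/-- The admissible pairs `(ψ, ζ)` of mass `m`. The function `ψ` is defined on the whole plane:
it is continued by its boundary values, `0` below the bottom and `1` above the free surface.
Weak differentiability of this continuation across the two boundary curves is the Sobolev
(trace) meaning of the conditions `ψ = 0` on `y = 0` and `ψ = 1` on `y = 1 + ζ(x)`. -/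
structure Admissible (m : ℝ) (ψ : ℝ × ℝ → ℝ) (ζ : ℝ → ℝ) : Prop where
  continuous_surface : Continuous ζ
  depth_pos : ∀ x, 0 < 1 + ζ x
  integrable_surface : Integrable ζ
  mass_eq : ∫ x, ζ x = m
  integrable_surface_sq : Integrable fun x => ζ x ^ 2
  /-- the quotient to be minimized is defined -/
  surface_sq_ne_zero : ∫ x, ζ x ^ 2 ≠ 0
  bottom : ∀ x y : ℝ, y ≤ 0 → ψ (x, y) = 0
  surface : ∀ x y : ℝ, 1 + ζ x ≤ y → ψ (x, y) = 1
  weakDeriv_x : ∃ g, HasWeakDeriv univ (1, 0) ψ g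
  weakDeriv_y : ∃ g, HasWeakDeriv univ (0, 1) ψ g
  finite_energy : IntegrableOn (fun z => wdx ψ z ^ 2 + (wdy ψ z - 1) ^ 2) (fluidDomain ζ)

/-- The renormalized energy `∬_D [(∇ψ)² - 1]`, integrated first in `y` and then in `x`.
For admissible pairs this converges absolutely, because
`∫_0^{1+ζ} [(∇ψ)² - 1] dy = ∫_0^{1+ζ} [ψ_x² + (ψ_y - 1)²] dy - 2 ζ` for almost every `x`;
finiteness of `∬_D [ψ_x² + (ψ_y - 1)²]` alone does not make `(∇ψ)² - 1` Lebesgue integrable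
on `D`, but whenever it is, this is its Lebesgue integral. -/
def renormalizedEnergy (ψ : ℝ × ℝ → ℝ) (ζ : ℝ → ℝ) : ℝ :=
  ∫ x, ∫ y in (0 : ℝ)..(1 + ζ x), (wdx ψ (x, y) ^ 2 + wdy ψ (x, y) ^ 2 - 1)

/-- The quotient `∬_D [(∇ψ)² - 1] / ∫ ζ²`. -/
def quotient (ψ : ℝ × ℝ → ℝ) (ζ : ℝ → ℝ) : ℝ :=
  renormalizedEnergy ψ ζ / ∫ x, ζ x ^ 2

/-- The distance of two pairs, possibly infinite: uniform distance of the surfaces, plus the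
`L²` distance over the plane of the gradients of the (continued) stream functions. -/
def pairDist (ψ : ℝ × ℝ → ℝ) (ζ : ℝ → ℝ) (ψ' : ℝ × ℝ → ℝ) (ζ' : ℝ → ℝ) : ℝ≥0∞ :=
  (⨆ x, ENNReal.ofReal |ζ' x - ζ x|)
    + eLpNorm (fun z => wdx ψ' z - wdx ψ z) 2 volume
    + eLpNorm (fun z => wdy ψ' z - wdy ψ z) 2 volume

/-- The values of the quotient on the admissible pairs at distance at most `δ` from `(ψ, ζ)`;
for `δ = ∞` these are all admissible pairs. -/
def quotientValues (m : ℝ) (δ : ℝ≥0∞) (ψ : ℝ × ℝ → ℝ) (ζ : ℝ → ℝ) : Set ℝ :=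
  {r | ∃ ψ' ζ', Admissible m ψ' ζ' ∧ pairDist ψ ζ ψ' ζ' ≤ δ ∧ r = quotient ψ' ζ'}

/-- `(ψ, ζ)` is an admissible pair at which the infimum `lam` of the quotient, over the
admissible pairs at distance at most `δ`, is attained. For `δ = ∞` this is a minimizer of the
variational problem, and `lam` is the infimum over all admissible pairs; for finite `δ` it is a
local minimizer. -/
structure IsMinimizer (m : ℝ) (δ : ℝ≥0∞) (lam : ℝ) (ψ : ℝ × ℝ → ℝ) (ζ : ℝ → ℝ) : Prop where
  admissible : Admissible m ψ ζ
  isGLB : IsGLB (quotientValues m δ ψ ζ) lam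
  attained : quotient ψ ζ = lam

/-- `ψ ∈ H²(D)`: all second weak derivatives on the interior of `D` are square integrable.
(For an admissible pair the first derivatives of `ψ - y` are square integrable already; `ψ`
itself cannot be in `L²(D)`, since `D` has infinite area.) -/
def IsH2 (ψ : ℝ × ℝ → ℝ) (ζ : ℝ → ℝ) : Prop :=
  ∀ f ∈ ({wdx ψ, wdy ψ} : Set (ℝ × ℝ → ℝ)), ∀ v ∈ ({(1, 0), (0, 1)} : Set (ℝ × ℝ)),
    ∃ h, HasWeakDeriv (fluidDomain ζ) v f h ∧ MemLp h 2 (volume.restrict (fluidDomain ζ))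

/-- Harmonicity on an open subset of the plane, identified with `ℂ` for its Euclidean
structure. -/
def IsHarmonicOn (u : ℝ × ℝ → ℝ) (U : Set (ℝ × ℝ)) : Prop :=
  InnerProductSpace.HarmonicOnNhd (fun w : ℂ => u (w.re, w.im)) {w : ℂ | (w.re, w.im) ∈ U}

/-- The classical partial derivative in `x`. -/
def dx (u : ℝ × ℝ → ℝ) (z : ℝ × ℝ) : ℝ := fderiv ℝ u z (1, 0)

/-- The classical partial derivative in `y`. -/
def dy (u : ℝ × ℝ → ℝ) (z : ℝ × ℝ) : ℝ := fderiv ℝ u z (0, 1)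

/-- The function `f` on the interior of `D` has boundary values `a(x)` at the point
`(x, 1 + ζ(x))` of the free surface, as vertical limits, for almost every `x`. -/
def HasSurfaceValues (ζ : ℝ → ℝ) (f : ℝ × ℝ → ℝ) (a : ℝ → ℝ) : Prop :=
  ∀ᵐ x, Tendsto (fun y => f (x, y)) (𝓝[<] (1 + ζ x)) (𝓝 (a x))

/-- The function `f` on the interior of `D` has boundary values `a(x)` at the point `(x, 0)` of
the bottom, as vertical limits, for almost every `x`. -/
def HasBottomValues (f : ℝ × ℝ → ℝ) (a : ℝ → ℝ) : Prop :=
  ∀ᵐ x, Tendsto (fun y => f (x, y)) (𝓝[>] 0) (𝓝 (a x))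

/-- `φ` is the velocity potential of an irrotational gravity wave with free surface
`y = 1 + ζ(x)`, stationary in the frame moving with the wave (dimensionless, with unit speed at
infinity): `φ` is harmonic in the fluid, the kinematic condition `φ_y = φ_x ζ_x` and the
Bernoulli condition `(φ_x² + φ_y²) / 2 + lam ζ = 1 / 2` hold on the free surface, `φ_y = 0` on
the bottom, and `∇φ - (1, 0)` is square integrable. -/
structure IsStationaryGravityWave (lam : ℝ) (φ : ℝ × ℝ → ℝ) (ζ : ℝ → ℝ) : Prop where
  harmonic : IsHarmonicOn φ (fluidDomain ζ)
  surface : ∃ a b : ℝ → ℝ, HasSurfaceValues ζ (dx φ) a ∧ HasSurfaceValues ζ (dy φ) b ∧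
    ∀ᵐ x, b x = a x * deriv ζ x ∧ (a x ^ 2 + b x ^ 2) / 2 + lam * ζ x = 1 / 2
  bottom : HasBottomValues (dy φ) fun _ => 0
  finite_energy : IntegrableOn (fun z => (dx φ z - 1) ^ 2 + dy φ z ^ 2) (fluidDomain ζ)

end WaterWave

end

open WaterWave

namespace WaterWave

/-! On almost every vertical line the continued stream function climbs from `0` to `1`, so `ψ_y`
integrates to `1` there. Hence the renormalized energy equals the Dirichlet energy `E` of `ψ - y`
minus `2m` (`Admissible.renormalizedEnergy_eq`). Multiplying the quotient out, `E - 2m - lam * ∫ ζ²`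
is nonnegative at all admissible pairs within distance `δ` and zero at the minimizer. Two families
of competitors, both at a distance that tends to zero with `t`, then give everything.

Interior variation: `ψ + t φ` with `φ` a test function in the open fluid domain and `ζ` unchanged.
Vanishing of the first variation says that `ψ` is weakly harmonic (`IsMinimizer.weakly_harmonic`),
and Weyl's lemma (`exists_harmonic_ae_eq`) provides a harmonic representative `u`.

Domain variation: each vertical line is stretched by the factor `1 + t w(x)`, where `w` is a test
function with `∫ w (1 + ζ) = 0`, so that the mass is kept. The boundary values of `ψ` are
transported exactly, and no smoothness of `ζ` is needed. The energy expands in `t` and yields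
`IsMinimizer.integral_stretchingVariation`: an integral over the domain, quadratic in `∇ψ`, equals
`2 lam ∫ ζ w (1 + ζ)`.

Under the regularity hypotheses the vertical derivatives of `u_x` and `u_y` are square integrable,
so both functions have limits at the ends of almost every vertical line, with majorants from the
one-dimensional Sobolev inequality. The divergence theorem with such boundary values
(`setIntegral_divergence`) is proved by comparing the fluxes through the curves `y = s (1 + ζ)` and
letting `s` tend to `0` and `1`. Applied to the rotated gradient it shows that the gradient is
normal to the surface and to the bottom (`Admissible.ae_kinematic`). Applied to the divergence-free
stress field `(-2 u_x u_y, u_x² - u_y²)` tested with `w(x) y`, it turns the domain variation into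
the vanishing of `∫ w (1 + ζ) (|∇u|² + 2 lam ζ)` for all permitted `w`. So `|∇u|² + 2 lam ζ` is a
constant, the Lagrange multiplier of the mass constraint. It equals `1` because `u_x`, `u_y - 1` and
`ζ` are small at infinity in an integrated sense (`IsMinimizer.ae_bernoulli`).

The velocity potential is the harmonic conjugate of `u`, which exists by a Poincaré lemma
(`exists_potential`), and the boundary conditions carry over to it. -/

/-! ### Weak derivatives and admissible pairs. -/

theorem integrable_mul_test {U : Set (ℝ × ℝ)} {g φ : ℝ × ℝ → ℝ}
    (hg : LocallyIntegrableOn g U) (hφ : Continuous φ) (hc : HasCompactSupport φ)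
    (hs : tsupport φ ⊆ U) : Integrable fun z => g z * φ z := by
  have h1 : IntegrableOn g (tsupport φ) := hg.integrableOn_compact_subset hs hc
  have h2 : IntegrableOn (fun z => g z * φ z) (tsupport φ) :=
    h1.mul_continuousOn hφ.continuousOn hc
  refine (integrableOn_iff_integrable_of_support_subset ?_).1 h2
  intro z hz
  apply subset_tsupport
  intro h0
  exact hz (by simp [h0])

theorem hasCompactSupport_fderiv_apply {φ : ℝ × ℝ → ℝ} (hc : HasCompactSupport φ) (v : ℝ × ℝ) :
    HasCompactSupport fun z => fderiv ℝ φ z v := hc.fderiv_apply (𝕜 := ℝ) v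

theorem tsupport_fderiv_apply_subset' (φ : ℝ × ℝ → ℝ) (v : ℝ × ℝ) :
    tsupport (fun z => fderiv ℝ φ z v) ⊆ tsupport φ := tsupport_fderiv_apply_subset ℝ v

theorem HasWeakDeriv.ae_eq {U : Set (ℝ × ℝ)} {v : ℝ × ℝ} {f g₁ g₂ : ℝ × ℝ → ℝ} (hU : IsOpen U)
    (h₁ : HasWeakDeriv U v f g₁) (h₂ : HasWeakDeriv U v f g₂) : ∀ᵐ z, z ∈ U → g₁ z = g₂ z := by
  have := hU.ae_eq_zero_of_integral_contDiff_smul_eq_zero (μ := volume)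
    (h₁.locallyIntegrableOn_deriv.sub h₂.locallyIntegrableOn_deriv) ?_
  · filter_upwards [this] with z hz hzU
    exact sub_eq_zero.1 (hz hzU)
  · intro φ hφ hc hs
    have i1 := integrable_mul_test h₁.locallyIntegrableOn_deriv hφ.continuous hc hs
    have i2 := integrable_mul_test h₂.locallyIntegrableOn_deriv hφ.continuous hc hs
    have e1 := h₁.integral_eq φ hφ hc hs
    have e2 := h₂.integral_eq φ hφ hc hs
    have : ∫ z, φ z • (g₁ - g₂) z = ∫ z, g₁ z * φ z - g₂ z * φ z := by
      congr 1; ext z; simp; ring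
    rw [this, integral_sub i1 i2]
    linarith

theorem HasWeakDeriv.mono {U V : Set (ℝ × ℝ)} {v : ℝ × ℝ} {f g : ℝ × ℝ → ℝ}
    (h : HasWeakDeriv U v f g) (hV : V ⊆ U) : HasWeakDeriv V v f g :=
  ⟨h.1.mono_set hV, h.2.mono_set hV, fun φ h1 h2 h3 => h.3 φ h1 h2 (h3.trans hV)⟩

theorem locallyIntegrableOn_congr_ae {U : Set (ℝ × ℝ)} {f f' : ℝ × ℝ → ℝ}
    (h : LocallyIntegrableOn f U) (hf : ∀ᵐ z, z ∈ U → f z = f' z) (hU : IsOpen U) :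
    LocallyIntegrableOn f' U := by
  rw [locallyIntegrableOn_iff hU.isLocallyClosed] at h ⊢
  intro k hk hkc
  refine (h k hk hkc).congr ?_
  rw [EventuallyEq, ae_restrict_iff' hkc.measurableSet]
  filter_upwards [hf] with z hz hzk using hz (hk hzk)

theorem HasWeakDeriv.congr {U : Set (ℝ × ℝ)} {v : ℝ × ℝ} {f g f' g' : ℝ × ℝ → ℝ}
    (h : HasWeakDeriv U v f g) (hU : IsOpen U) (hf : ∀ᵐ z, z ∈ U → f z = f' z)
    (hg : ∀ᵐ z, z ∈ U → g z = g' z) : HasWeakDeriv U v f' g' := by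
  refine ⟨locallyIntegrableOn_congr_ae h.1 hf hU, locallyIntegrableOn_congr_ae h.2 hg hU, ?_⟩
  intro φ h1 h2 h3
  have e := h.3 φ h1 h2 h3
  have e1 : ∫ z, f z * fderiv ℝ φ z v = ∫ z, f' z * fderiv ℝ φ z v := by
    apply integral_congr_ae
    filter_upwards [hf] with z hz
    by_cases hzU : z ∈ U
    · simp only [hz hzU]
    · have : fderiv ℝ φ z v = 0 := by
        apply image_eq_zero_of_notMem_tsupport (f := fun z => fderiv ℝ φ z v)
        exact fun h => hzU (h3 (tsupport_fderiv_apply_subset' φ v h))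
      simp [this]
  have e2 : ∫ z, g z * φ z = ∫ z, g' z * φ z := by
    apply integral_congr_ae
    filter_upwards [hg] with z hz
    by_cases hzU : z ∈ U
    · simp only [hz hzU]
    · have : φ z = 0 := image_eq_zero_of_notMem_tsupport fun h => hzU (h3 h)
      simp [this]
  rw [← e1, ← e2, e]

theorem hasWeakDeriv_of_contDiffOn {U : Set (ℝ × ℝ)} {f : ℝ × ℝ → ℝ} (hU : IsOpen U)
    (hf : ContDiffOn ℝ 1 f U) (v : ℝ × ℝ) : HasWeakDeriv U v f fun z => fderiv ℝ f z v := by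
  have hg : ContinuousOn (fun z => fderiv ℝ f z v) U :=
    (hf.continuousOn_fderiv_of_isOpen hU le_rfl).clm_apply continuousOn_const
  have l1 : LocallyIntegrableOn f U := hf.continuousOn.locallyIntegrableOn hU.measurableSet
  have l2 : LocallyIntegrableOn (fun z => fderiv ℝ f z v) U :=
    hg.locallyIntegrableOn hU.measurableSet
  refine ⟨l1, l2, ?_⟩
  intro φ hφ hc hs
  have hφ1 : ContDiff ℝ 1 φ := hφ.of_le (by exact_mod_cast le_top)
  refine integral_mul_fderiv_eq_neg_fderiv_mul_of_integrable
    (integrable_mul_test l2 hφ.continuous hc hs)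
    (integrable_mul_test l1 ((hφ1.continuous_fderiv (by norm_num)).clm_apply continuous_const)
      (hasCompactSupport_fderiv_apply hc v) ((tsupport_fderiv_apply_subset' φ v).trans hs))
    (integrable_mul_test l1 hφ.continuous hc hs)
    (fun z hz => (hf.differentiableOn (by norm_num)).differentiableAt (hU.mem_nhds (hs hz)))
    fun z _ => hφ1.differentiable (by norm_num) z

theorem HasWeakDeriv.add {U : Set (ℝ × ℝ)} {v : ℝ × ℝ} {f g f' g' : ℝ × ℝ → ℝ}
    (h : HasWeakDeriv U v f g) (h' : HasWeakDeriv U v f' g') :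
    HasWeakDeriv U v (fun z => f z + f' z) fun z => g z + g' z := by
  refine ⟨h.1.add h'.1, h.2.add h'.2, ?_⟩
  intro φ hφ hc hs
  have hφ1 : ContDiff ℝ 1 φ := hφ.of_le (by exact_mod_cast le_top)
  have hφ' : Continuous fun z => fderiv ℝ φ z v :=
    (hφ1.continuous_fderiv (by norm_num)).clm_apply continuous_const
  have hc' := hasCompactSupport_fderiv_apply hc v
  have hs' := (tsupport_fderiv_apply_subset' φ v).trans hs
  simp_rw [add_mul]
  rw [integral_add (integrable_mul_test h.1 hφ' hc' hs') (integrable_mul_test h'.1 hφ' hc' hs'),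
    integral_add (integrable_mul_test h.2 hφ.continuous hc hs)
      (integrable_mul_test h'.2 hφ.continuous hc hs), h.3 φ hφ hc hs, h'.3 φ hφ hc hs]
  ring

theorem weakDeriv_spec {v : ℝ × ℝ} {f : ℝ × ℝ → ℝ} (h : ∃ g, HasWeakDeriv univ v f g) :
    HasWeakDeriv univ v f (weakDeriv v f) := by
  unfold weakDeriv
  rw [dif_pos h]
  exact h.choose_spec

theorem HasWeakDeriv.weakDeriv_ae_eq {v : ℝ × ℝ} {f g : ℝ × ℝ → ℝ} (h : HasWeakDeriv univ v f g) :
    weakDeriv v f =ᵐ[volume] g := by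
  filter_upwards [(weakDeriv_spec ⟨g, h⟩).ae_eq isOpen_univ h] with z hz using hz trivial

theorem isOpen_fluidDomain {ζ : ℝ → ℝ} (hζ : Continuous ζ) : IsOpen (fluidDomain ζ) :=
  (isOpen_lt continuous_const continuous_snd).inter
    (isOpen_lt continuous_snd (by fun_prop))

theorem volume_graph_eq_zero {f : ℝ → ℝ} (hf : Continuous f) :
    volume {z : ℝ × ℝ | z.2 = f z.1} = 0 := by
  have hm : MeasurableSet {z : ℝ × ℝ | z.2 = f z.1} :=
    (isClosed_eq continuous_snd (by fun_prop)).measurableSet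
  rw [Measure.volume_eq_prod, Measure.measure_prod_null hm]
  refine Eventually.of_forall fun x => ?_
  have : Prod.mk x ⁻¹' {z : ℝ × ℝ | z.2 = f z.1} = {f x} := by ext y; simp
  simp [this]

theorem HasWeakDeriv.ae_eq_zero_of_const {U : Set (ℝ × ℝ)} {v : ℝ × ℝ} {f g : ℝ × ℝ → ℝ} {c : ℝ}
    (h : HasWeakDeriv U v f g) (hU : IsOpen U) (hf : ∀ z ∈ U, f z = c) :
    ∀ᵐ z, z ∈ U → g z = 0 := by
  have h' : HasWeakDeriv U v (fun _ => c) g :=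
    h.congr hU (Eventually.of_forall hf) (Eventually.of_forall fun _ _ => rfl)
  have h2 := hasWeakDeriv_of_contDiffOn (f := fun _ => c) hU contDiffOn_const v
  filter_upwards [h'.ae_eq hU h2] with z hz hzU
  rw [hz hzU]; simp

section Admissible

variable {m : ℝ} {ψ : ℝ × ℝ → ℝ} {ζ : ℝ → ℝ}

theorem Admissible.hasWeakDeriv_wdx (h : Admissible m ψ ζ) :
    HasWeakDeriv univ (1, 0) ψ (wdx ψ) := weakDeriv_spec h.weakDeriv_x

theorem Admissible.hasWeakDeriv_wdy (h : Admissible m ψ ζ) :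
    HasWeakDeriv univ (0, 1) ψ (wdy ψ) := weakDeriv_spec h.weakDeriv_y

/-- The continued stream function is constant on the open sets below the bottom and above the
surface, and the two boundary curves are graphs, hence null sets. Integrals over the plane and over
the fluid domain may thus be exchanged. -/
theorem ae_eq_zero_off_fluidDomain {v : ℝ × ℝ} {g : ℝ × ℝ → ℝ} (hζ : Continuous ζ)
    (hb : ∀ x y : ℝ, y ≤ 0 → ψ (x, y) = 0) (hs : ∀ x y : ℝ, 1 + ζ x ≤ y → ψ (x, y) = 1)
    (h : HasWeakDeriv univ v ψ g) :
    ∀ᵐ z, z ∉ fluidDomain ζ → g z = 0 := by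
  have o1 : IsOpen {z : ℝ × ℝ | z.2 < 0} := isOpen_lt continuous_snd continuous_const
  have o2 : IsOpen {z : ℝ × ℝ | 1 + ζ z.1 < z.2} := isOpen_lt (by fun_prop) continuous_snd
  have h1 := (h.mono (subset_univ _)).ae_eq_zero_of_const o1 (c := 0)
    fun z hz => hb z.1 z.2 (le_of_lt hz)
  have h2 := (h.mono (subset_univ _)).ae_eq_zero_of_const o2 (c := 1)
    fun z hz => hs z.1 z.2 (le_of_lt hz)
  have h3 : ∀ᵐ z : ℝ × ℝ, ¬ z.2 = 0 := by
    rw [ae_iff]; simpa using volume_graph_eq_zero (f := fun _ => 0) continuous_const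
  have h4 : ∀ᵐ z : ℝ × ℝ, ¬ z.2 = 1 + ζ z.1 := by
    rw [ae_iff]; simpa using volume_graph_eq_zero (f := fun x => 1 + ζ x) (by fun_prop)
  filter_upwards [h1, h2, h3, h4] with z z1 z2 z3 z4 hz
  rcases lt_or_gt_of_ne z3 with h | h
  · exact z1 h
  rcases lt_or_gt_of_ne z4 with h' | h'
  · exact absurd ⟨h, h'⟩ hz
  · exact z2 h'

theorem Admissible.wdx_off (h : Admissible m ψ ζ) : ∀ᵐ z, z ∉ fluidDomain ζ → wdx ψ z = 0 :=
  ae_eq_zero_off_fluidDomain h.continuous_surface h.bottom h.surface h.hasWeakDeriv_wdx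

theorem Admissible.wdy_off (h : Admissible m ψ ζ) : ∀ᵐ z, z ∉ fluidDomain ζ → wdy ψ z = 0 :=
  ae_eq_zero_off_fluidDomain h.continuous_surface h.bottom h.surface h.hasWeakDeriv_wdy

theorem Admissible.aestronglyMeasurable_wdx (h : Admissible m ψ ζ) :
    AEStronglyMeasurable (wdx ψ) volume :=
  (locallyIntegrableOn_univ.1 h.hasWeakDeriv_wdx.2).aestronglyMeasurable

theorem Admissible.aestronglyMeasurable_wdy (h : Admissible m ψ ζ) :
    AEStronglyMeasurable (wdy ψ) volume :=
  (locallyIntegrableOn_univ.1 h.hasWeakDeriv_wdy.2).aestronglyMeasurable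

theorem memLp_two_of_integrable_add_sq {μ : Measure (ℝ × ℝ)} {f g : ℝ × ℝ → ℝ}
    (hf : AEStronglyMeasurable f μ) (h : Integrable (fun z => f z ^ 2 + g z ^ 2) μ) :
    MemLp f 2 μ := by
  rw [memLp_two_iff_integrable_sq hf]
  refine h.mono (hf.pow 2) (Eventually.of_forall fun z => ?_)
  rw [Real.norm_of_nonneg (by positivity), Real.norm_of_nonneg (by positivity)]
  nlinarith [sq_nonneg (g z)]

theorem Admissible.memLp_wdx (h : Admissible m ψ ζ) :
    MemLp (wdx ψ) 2 (volume.restrict (fluidDomain ζ)) :=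
  memLp_two_of_integrable_add_sq h.aestronglyMeasurable_wdx.restrict h.finite_energy

theorem Admissible.memLp_wdy_sub_one (h : Admissible m ψ ζ) :
    MemLp (fun z => wdy ψ z - 1) 2 (volume.restrict (fluidDomain ζ)) := by
  refine memLp_two_of_integrable_add_sq (g := wdx ψ)
    (h.aestronglyMeasurable_wdy.restrict.sub aestronglyMeasurable_const) ?_
  exact h.finite_energy.congr (Eventually.of_forall fun z => add_comm _ _)

end Admissible

/-! ### Vertical sections and the renormalized energy. -/

theorem indicator_fluidDomain_section {ζ : ℝ → ℝ} (f : ℝ × ℝ → ℝ) (x : ℝ) :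
    (fun y => (fluidDomain ζ).indicator f (x, y)) =
      (Ioo 0 (1 + ζ x)).indicator fun y => f (x, y) := by
  ext y
  simp only [indicator, fluidDomain, mem_ofPred_eq, mem_Ioo]
  congr

section Sections

variable {ζ : ℝ → ℝ} {f : ℝ × ℝ → ℝ}

theorem ae_integrableOn_section (hζ : Continuous ζ) (hf : IntegrableOn f (fluidDomain ζ)) :
    ∀ᵐ x, IntegrableOn (fun y => f (x, y)) (Ioo 0 (1 + ζ x)) := by
  rw [← integrable_indicator_iff (isOpen_fluidDomain hζ).measurableSet,
    Measure.volume_eq_prod] at hf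
  filter_upwards [hf.prod_right_ae] with x hx
  rw [indicator_fluidDomain_section] at hx
  exact (integrable_indicator_iff measurableSet_Ioo).1 hx

theorem integrable_section_integral (hζ : Continuous ζ) (hf : IntegrableOn f (fluidDomain ζ)) :
    Integrable fun x => ∫ y in Ioo 0 (1 + ζ x), f (x, y) := by
  rw [← integrable_indicator_iff (isOpen_fluidDomain hζ).measurableSet,
    Measure.volume_eq_prod] at hf
  refine hf.integral_prod_left.congr (Eventually.of_forall fun x => ?_)
  simp only [indicator_fluidDomain_section]
  rw [integral_indicator measurableSet_Ioo]

theorem setIntegral_fluidDomain (hζ : Continuous ζ) (hf : IntegrableOn f (fluidDomain ζ)) :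
    ∫ z in fluidDomain ζ, f z = ∫ x, ∫ y in Ioo 0 (1 + ζ x), f (x, y) := by
  rw [← integrable_indicator_iff (isOpen_fluidDomain hζ).measurableSet,
    Measure.volume_eq_prod] at hf
  rw [← integral_indicator (isOpen_fluidDomain hζ).measurableSet, Measure.volume_eq_prod,
    integral_prod _ hf]
  congr 1; ext x
  simp only [indicator_fluidDomain_section]
  rw [integral_indicator measurableSet_Ioo]

end Sections

theorem fderiv_tensor {ρ χ : ℝ → ℝ} (hρ : Differentiable ℝ ρ) (hχ : Differentiable ℝ χ)
    (z : ℝ × ℝ) (a b : ℝ) :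
    fderiv ℝ (fun z : ℝ × ℝ => ρ z.1 * χ z.2) z (a, b) =
      a * deriv ρ z.1 * χ z.2 + b * ρ z.1 * deriv χ z.2 := by
  have h1 : HasFDerivAt (fun z : ℝ × ℝ => ρ z.1) _ z :=
    (hρ z.1).hasDerivAt.hasFDerivAt.comp z hasFDerivAt_fst
  have h2 : HasFDerivAt (fun z : ℝ × ℝ => χ z.2) _ z :=
    (hχ z.2).hasDerivAt.hasFDerivAt.comp z hasFDerivAt_snd
  have h3 : HasFDerivAt (fun z : ℝ × ℝ => ρ z.1 * χ z.2) _ z := h1.mul h2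
  rw [h3.fderiv]
  simp; ring

theorem hasCompactSupport_tensor {ρ χ : ℝ → ℝ} (hρ : HasCompactSupport ρ)
    (hχ : HasCompactSupport χ) : HasCompactSupport fun z : ℝ × ℝ => ρ z.1 * χ z.2 := by
  refine HasCompactSupport.intro (hρ.isCompact.prod hχ.isCompact) fun z hz => ?_
  by_cases h : z.1 ∈ tsupport ρ
  · have : z.2 ∉ tsupport χ := fun h' => hz ⟨h, h'⟩
    simp [image_eq_zero_of_notMem_tsupport this]
  · simp [image_eq_zero_of_notMem_tsupport h]

theorem integrable_mul_compact_snd {g : ℝ × ℝ → ℝ} {χ : ℝ → ℝ} {K : Set ℝ}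
    (hg : LocallyIntegrable g) (hχ : Continuous χ) (hc : HasCompactSupport χ) (hK : IsCompact K) :
    Integrable (fun z : ℝ × ℝ => g z * χ z.2) ((volume.restrict K).prod volume) := by
  have h1 : IntegrableOn g (K ×ˢ tsupport χ) := hg.integrableOn_isCompact (hK.prod hc)
  have h2 : IntegrableOn (fun z : ℝ × ℝ => g z * χ z.2) (K ×ˢ tsupport χ) :=
    h1.mul_continuousOn (by fun_prop) (hK.prod hc)
  have h3 : IntegrableOn (fun z : ℝ × ℝ => g z * χ z.2) (K ×ˢ univ) := by
    refine h2.of_forall_sdiff_eq_zero (hK.measurableSet.prod MeasurableSet.univ) fun z hz => ?_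
    have : z.2 ∉ tsupport χ := fun h => hz.2 ⟨hz.1.1, h⟩
    rw [image_eq_zero_of_notMem_tsupport this, mul_zero]
  have e : (volume.restrict K).prod (volume : Measure ℝ) =
      (volume : Measure (ℝ × ℝ)).restrict (K ×ˢ univ) := by
    rw [Measure.volume_eq_prod, ← Measure.prod_restrict, Measure.restrict_univ]
  rw [e]; exact h3

theorem locallyIntegrable_integral_mul_snd {g : ℝ × ℝ → ℝ} {χ : ℝ → ℝ}
    (hg : LocallyIntegrable g) (hχ : Continuous χ) (hc : HasCompactSupport χ) :
    LocallyIntegrable fun x => ∫ y, g (x, y) * χ y := by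
  rw [locallyIntegrable_iff]
  intro K hK
  exact (integrable_mul_compact_snd hg hχ hc hK).integral_prod_left

/-- A weak derivative in the vertical direction is a weak derivative on almost every vertical
line. -/
theorem HasWeakDeriv.ae_vertical {f g : ℝ × ℝ → ℝ} (h : HasWeakDeriv univ (0, 1) f g) {χ : ℝ → ℝ}
    (hχ : ContDiff ℝ ∞ χ) (hc : HasCompactSupport χ) :
    ∀ᵐ x, ∫ y, g (x, y) * χ y = - ∫ y, f (x, y) * deriv χ y := by
  have hf := locallyIntegrableOn_univ.1 h.1
  have hg := locallyIntegrableOn_univ.1 h.2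
  have hχ1 : ContDiff ℝ 1 χ := hχ.of_le (by exact_mod_cast le_top)
  have hχ' : Continuous (deriv χ) := hχ1.continuous_deriv le_rfl
  have l1 := locallyIntegrable_integral_mul_snd hg hχ.continuous hc
  have l2 := locallyIntegrable_integral_mul_snd hf hχ' hc.deriv
  have := ae_eq_of_integral_contDiff_smul_eq l1 l2.neg ?_
  · filter_upwards [this] with x hx using hx
  intro ρ hρ hρc
  have hρ1 : ContDiff ℝ 1 ρ := hρ.of_le (by exact_mod_cast le_top)
  have ht : ContDiff ℝ ∞ fun z : ℝ × ℝ => ρ z.1 * χ z.2 :=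
    (hρ.comp contDiff_fst).mul (hχ.comp contDiff_snd)
  have key := h.3 _ ht (hasCompactSupport_tensor hρc hc) (subset_univ _)
  have e1 : ∀ z : ℝ × ℝ, fderiv ℝ (fun z : ℝ × ℝ => ρ z.1 * χ z.2) z (0, 1) =
      ρ z.1 * deriv χ z.2 := fun z => by
    rw [fderiv_tensor (hρ1.differentiable (by norm_num)) (hχ1.differentiable (by norm_num))]; ring
  simp_rw [e1] at key
  have i1 : Integrable fun z : ℝ × ℝ => f z * (ρ z.1 * deriv χ z.2) :=
    integrable_mul_test h.1 (by fun_prop) (hasCompactSupport_tensor hρc hc.deriv) (subset_univ _)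
  have i2 : Integrable fun z : ℝ × ℝ => g z * (ρ z.1 * χ z.2) :=
    integrable_mul_test h.2 ht.continuous (hasCompactSupport_tensor hρc hc) (subset_univ _)
  rw [Measure.volume_eq_prod] at key i1 i2
  rw [integral_prod _ i1, integral_prod _ i2] at key
  have c1 : ∀ x, ∫ y, f (x, y) * (ρ x * deriv χ y) = ρ x * ∫ y, f (x, y) * deriv χ y := fun x => by
    rw [← integral_const_mul]; congr 1; ext y; ring
  have c2 : ∀ x, ∫ y, g (x, y) * (ρ x * χ y) = ρ x * ∫ y, g (x, y) * χ y := fun x => by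
    rw [← integral_const_mul]; congr 1; ext y; ring
  simp_rw [c1, c2] at key
  simp only [smul_eq_mul, Pi.neg_apply, mul_neg, integral_neg]
  linarith

section Admissible

variable {m : ℝ} {ψ : ℝ × ℝ → ℝ} {ζ : ℝ → ℝ}

/-- Test the vertical weak derivative on a line with a cut-off `χ` equal to `1` between bottom and
surface. In `∫ ψ χ'` only the part above the surface survives, where `ψ = 1`, and it contributes `-χ
(1 + ζ x) = -1`. -/
theorem Admissible.ae_integral_wdy (h : Admissible m ψ ζ) :
    ∀ᵐ x, ∫ y in Ioo 0 (1 + ζ x), wdy ψ (x, y) = 1 := by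
  -- The exceptional null set depends on the cut-off, so a countable family is fixed beforehand; the
  -- `n`-th member serves every line of depth at most `n`.
  let χ : ℕ → ContDiffBump (0 : ℝ) := fun n => ⟨n + 1, n + 2, by positivity, by linarith⟩
  have hχ : ∀ n, ContDiff ℝ ∞ (χ n) := fun n => (χ n).contDiff
  have h1 : ∀ᵐ x, ∀ n, ∫ y, wdy ψ (x, y) * χ n y = - ∫ y, ψ (x, y) * deriv (χ n) y :=
    ae_all_iff.2 fun n => h.hasWeakDeriv_wdy.ae_vertical (hχ n) (χ n).hasCompactSupport
  have h2 := h.wdy_off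
  rw [Measure.volume_eq_prod] at h2
  filter_upwards [h1, Measure.ae_ae_of_ae_prod h2] with x hx hx0
  have hd := h.depth_pos x
  obtain ⟨n, hn⟩ := exists_nat_ge (1 + ζ x)
  have e1 : ∫ y, wdy ψ (x, y) * χ n y = ∫ y in Ioo 0 (1 + ζ x), wdy ψ (x, y) := by
    rw [← integral_indicator measurableSet_Ioo]
    apply integral_congr_ae
    filter_upwards [hx0] with y hy
    by_cases hyD : y ∈ Ioo 0 (1 + ζ x)
    · rw [indicator_of_mem hyD, (χ n).one_of_mem_closedBall, mul_one]
      rw [Metric.mem_closedBall, dist_zero_right, Real.norm_eq_abs, abs_of_pos hyD.1]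
      show y ≤ (n : ℝ) + 1
      linarith [hyD.2]
    · rw [indicator_of_notMem hyD, hy hyD, zero_mul]
  have e2 : ∫ y, ψ (x, y) * deriv (χ n) y = -1 := by
    have : ∀ y, ψ (x, y) * deriv (χ n) y = (Ioi (1 + ζ x)).indicator (deriv (χ n)) y := by
      intro y
      rcases le_or_gt y 0 with h0 | h0
      · rw [h.bottom x y h0, indicator_of_notMem (by simp; linarith), zero_mul]
      rcases le_or_gt y (1 + ζ x) with h3 | h3
      · rw [indicator_of_notMem (by simpa using h3)]
        have : (χ n : ℝ → ℝ) =ᶠ[𝓝 y] fun _ => 1 := by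
          apply (χ n).eventuallyEq_one_of_mem_ball
          rw [Metric.mem_ball, dist_zero_right, Real.norm_eq_abs, abs_of_pos h0]
          show y < (n : ℝ) + 1
          linarith
        rw [this.deriv_eq]; simp
      · rw [h.surface x y h3.le, indicator_of_mem (show y ∈ Ioi (1 + ζ x) from h3), one_mul]
    simp_rw [this]
    rw [integral_indicator measurableSet_Ioi,
      HasCompactSupport.integral_Ioi_deriv_eq ((hχ n).of_le (by exact_mod_cast le_top))
        (χ n).hasCompactSupport, (χ n).one_of_mem_closedBall]
    rw [Metric.mem_closedBall, dist_zero_right, Real.norm_eq_abs, abs_of_pos hd]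
    show 1 + ζ x ≤ (n : ℝ) + 1
    linarith
  rw [← e1, hx n, e2]; norm_num

/-- Pointwise, `(∇ψ)² - 1` is the excess density plus `2 ψ_y - 2`. Integrated over a line of depth
`1 + ζ`, the last two terms give `2 - 2 (1 + ζ) = -2 ζ`. -/
theorem Admissible.renormalizedEnergy_eq (h : Admissible m ψ ζ) :
    renormalizedEnergy ψ ζ =
      (∫ z in fluidDomain ζ, (wdx ψ z ^ 2 + (wdy ψ z - 1) ^ 2)) - 2 * m := by
  have hζ := h.continuous_surface
  rw [setIntegral_fluidDomain hζ h.finite_energy, ← h.mass_eq, ← integral_const_mul,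
    ← integral_sub (integrable_section_integral hζ h.finite_energy)
      (h.integrable_surface.const_mul 2)]
  unfold renormalizedEnergy
  apply integral_congr_ae
  -- Splitting the integral on a line requires `ψ_y` to be integrable there; this follows from local
  -- integrability in the plane, over countably many rectangles.
  have hloc : ∀ᵐ x, ∀ n : ℕ, IntegrableOn (fun y => wdy ψ (x, y)) (Icc (-n) n) := by
    have h0 : ∀ N n : ℕ, ∀ᵐ x, x ∈ Icc (-N : ℝ) N →
        IntegrableOn (fun y => wdy ψ (x, y)) (Icc (-n) n) := by
      intro N n
      have h1 : IntegrableOn (wdy ψ) (Icc (-N : ℝ) N ×ˢ Icc (-n : ℝ) n) :=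
        (locallyIntegrableOn_univ.1 h.hasWeakDeriv_wdy.2).integrableOn_isCompact
          (isCompact_Icc.prod isCompact_Icc)
      rw [IntegrableOn, Measure.volume_eq_prod, ← Measure.prod_restrict] at h1
      exact (ae_restrict_iff' measurableSet_Icc).1 h1.prod_right_ae
    have h1 : ∀ᵐ x, ∀ N n : ℕ, x ∈ Icc (-N : ℝ) N →
        IntegrableOn (fun y => wdy ψ (x, y)) (Icc (-n) n) :=
      ae_all_iff.2 fun N => ae_all_iff.2 fun n => h0 N n
    filter_upwards [h1] with x hx n
    obtain ⟨N, hN⟩ := exists_nat_ge |x|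
    exact hx N n (abs_le.1 hN)
  filter_upwards [h.ae_integral_wdy, ae_integrableOn_section hζ h.finite_energy, hloc]
    with x h1 h2 h3
  have hd := h.depth_pos x
  rw [intervalIntegral.integral_of_le hd.le, integral_Ioc_eq_integral_Ioo]
  obtain ⟨n, hn⟩ := exists_nat_ge (1 + ζ x)
  have i1 : IntegrableOn (fun y => wdy ψ (x, y)) (Ioo 0 (1 + ζ x)) :=
    (h3 n).mono_set fun y hy => ⟨by linarith [hy.1, (Nat.cast_nonneg n : (0 : ℝ) ≤ n)], by linarith [hy.2]⟩
  have i2 : IntegrableOn (fun _ : ℝ => (1 : ℝ)) (Ioo 0 (1 + ζ x)) := by simp [integrableOn_const_iff]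
  have e : ∀ y, wdx ψ (x, y) ^ 2 + wdy ψ (x, y) ^ 2 - 1 =
      (wdx ψ (x, y) ^ 2 + (wdy ψ (x, y) - 1) ^ 2) + (2 * wdy ψ (x, y) - 2 * 1) := fun y => by ring
  simp_rw [e]
  have i3 : IntegrableOn (fun y => 2 * wdy ψ (x, y) - 2 * 1) (Ioo 0 (1 + ζ x)) :=
    (i1.const_mul 2).sub (i2.const_mul 2)
  rw [integral_add h2 i3, integral_sub (i1.const_mul 2) (i2.const_mul 2), integral_const_mul,
    integral_const_mul, h1]
  simp [hd.le]
  ring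

end Admissible

/-! ### The Laplacian and harmonic functions in coordinates. -/

/-- The Laplacian `f_xx + f_yy` in the plane. -/
noncomputable def planeLaplacian (f : ℝ × ℝ → ℝ) (z : ℝ × ℝ) : ℝ :=
  fderiv ℝ (fun w => fderiv ℝ f w (1, 0)) z (1, 0) + fderiv ℝ (fun w => fderiv ℝ f w (0, 1)) z (0, 1)

theorem fderiv_fderiv_apply {f : ℝ × ℝ → ℝ} {z : ℝ × ℝ} (hf : ContDiffAt ℝ 2 f z) (v w : ℝ × ℝ) :
    fderiv ℝ (fun z => fderiv ℝ f z v) z w = fderiv ℝ (fderiv ℝ f) z w v := by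
  have : DifferentiableAt ℝ (fderiv ℝ f) z :=
    (hf.fderiv_right (m := 1) (by norm_num)).differentiableAt (by norm_num)
  rw [fderiv_clm_apply this (differentiableAt_const v)]
  simp

open InnerProductSpace Laplacian in
theorem laplacian_complex_eq {f : ℝ × ℝ → ℝ} {z : ℂ} (hf : ContDiffAt ℝ 2 f (z.re, z.im)) :
    Laplacian.laplacian (fun w : ℂ => f (w.re, w.im)) z = planeLaplacian f (z.re, z.im) := by
  rw [laplacian_eq_iteratedFDeriv_complexPlane]
  have e : (fun w : ℂ => f (w.re, w.im)) = f ∘ Complex.equivRealProdCLM := by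
    rfl
  simp only
  rw [e, iteratedFDeriv_two_apply, iteratedFDeriv_two_apply]
  have hf' : ContDiffAt ℝ 2 f (Complex.equivRealProdCLM z) := by
    exact hf
  have h1 : fderiv ℝ (f ∘ Complex.equivRealProdCLM) = fun w =>
      (fderiv ℝ f (Complex.equivRealProdCLM w)).comp
        (Complex.equivRealProdCLM : ℂ →L[ℝ] ℝ × ℝ) := by
    ext1 w
    exact Complex.equivRealProdCLM.comp_right_fderiv
  have hd : DifferentiableAt ℝ (fderiv ℝ f) (Complex.equivRealProdCLM z) :=
    (hf'.fderiv_right (m := 1) (by norm_num)).differentiableAt (by norm_num)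
  have h2 : ∀ a b : ℂ, fderiv ℝ (fderiv ℝ (f ∘ Complex.equivRealProdCLM)) z a b =
      fderiv ℝ (fderiv ℝ f) (Complex.equivRealProdCLM z) (Complex.equivRealProdCLM a)
        (Complex.equivRealProdCLM b) := by
    intro a b
    rw [h1]
    have h3 : HasFDerivAt (fun w : ℂ => fderiv ℝ f (Complex.equivRealProdCLM w)) _ z :=
      hd.hasFDerivAt.comp z Complex.equivRealProdCLM.hasFDerivAt
    rw [(h3.clm_comp (hasFDerivAt_const _ z)).fderiv]
    simp
  have e1 : Complex.equivRealProdCLM z = (z.re, z.im) := rfl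
  have e2 : Complex.equivRealProdCLM 1 = (1, 0) := Prod.ext Complex.one_re Complex.one_im
  have e3 : Complex.equivRealProdCLM Complex.I = (0, 1) := Prod.ext Complex.I_re Complex.I_im
  simp only [Matrix.cons_val_zero, Matrix.cons_val_one]
  rw [h2, h2]
  unfold planeLaplacian
  rw [fderiv_fderiv_apply hf, fderiv_fderiv_apply hf, e1, e2, e3]

theorem isOpen_complex_preimage {U : Set (ℝ × ℝ)} (hU : IsOpen U) :
    IsOpen {w : ℂ | (w.re, w.im) ∈ U} :=
  hU.preimage (Complex.continuous_re.prodMk Complex.continuous_im)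

theorem isHarmonicOn_of_planeLaplacian {U : Set (ℝ × ℝ)} {f : ℝ × ℝ → ℝ} (hU : IsOpen U)
    (hf : ContDiffOn ℝ 2 f U) (h : ∀ z ∈ U, planeLaplacian f z = 0) : IsHarmonicOn f U := by
  intro w hw
  have hc : ∀ w : ℂ, (w.re, w.im) ∈ U → ContDiffAt ℝ 2 f (w.re, w.im) := fun w hw =>
    hf.contDiffAt (hU.mem_nhds hw)
  constructor
  · have : ContDiff ℝ 2 fun w : ℂ => (w.re, w.im) :=
      Complex.reCLM.contDiff.prodMk Complex.imCLM.contDiff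
    exact (hc w hw).comp w this.contDiffAt
  · filter_upwards [(isOpen_complex_preimage hU).mem_nhds hw] with v hv
    rw [laplacian_complex_eq (hc v hv), h _ hv]; rfl

theorem IsHarmonicOn.contDiffOn {U : Set (ℝ × ℝ)} {f : ℝ × ℝ → ℝ} (h : IsHarmonicOn f U)
    (n : ℕ∞) : ContDiffOn ℝ n f U := by
  intro z hz
  have h1 := (HarmonicAt.analyticAt (h (Complex.equivRealProdCLM.symm z) (by simpa using hz))).contDiffAt
    (n := n)
  have h2 := h1.comp z (Complex.equivRealProdCLM.symm.contDiff (n := n)).contDiffAt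
  exact ContDiffAt.contDiffWithinAt h2

theorem IsHarmonicOn.planeLaplacian_eq_zero {U : Set (ℝ × ℝ)} {f : ℝ × ℝ → ℝ} (hU : IsOpen U)
    (h : IsHarmonicOn f U) {z : ℝ × ℝ} (hz : z ∈ U) : planeLaplacian f z = 0 := by
  have h1 := (h (⟨z.1, z.2⟩ : ℂ) hz).2.self_of_nhds
  have h2 : ContDiffAt ℝ 2 f z := ((h.contDiffOn 2).contDiffAt (hU.mem_nhds hz))
  rw [← laplacian_complex_eq (z := ⟨z.1, z.2⟩) h2, h1]; rfl

/-! ### Mollification and Weyl's lemma. -/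

open ContinuousLinearMap in
/-- The convolution of a function on the plane with a kernel. -/
noncomputable def mollify (f η : ℝ × ℝ → ℝ) : ℝ × ℝ → ℝ := convolution f η (lsmul ℝ ℝ) volume

theorem mollify_apply (f η : ℝ × ℝ → ℝ) (z : ℝ × ℝ) : mollify f η z = ∫ w, f w * η (z - w) := rfl

theorem contDiff_mollify {f η : ℝ × ℝ → ℝ} (hf : LocallyIntegrable f) (hη : ContDiff ℝ ∞ η)
    (hc : HasCompactSupport η) : ContDiff ℝ ∞ (mollify f η) :=
  hc.contDiff_convolution_right (n := ⊤) _ hf hη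

theorem fderiv_mollify {f η : ℝ × ℝ → ℝ} (hf : LocallyIntegrable f) (hη : ContDiff ℝ ∞ η)
    (hc : HasCompactSupport η) (z v : ℝ × ℝ) :
    fderiv ℝ (mollify f η) z v = mollify f (fun w => fderiv ℝ η w v) z := by
  have h1 : ContDiff ℝ 1 η := hη.of_le (by exact_mod_cast le_top)
  unfold mollify
  rw [(hc.hasFDerivAt_convolution_right (ContinuousLinearMap.lsmul ℝ ℝ) hf h1 z).fderiv]
  exact convolution_precompR_apply (ContinuousLinearMap.lsmul ℝ ℝ) hf (hc.fderiv (𝕜 := ℝ))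
    (h1.continuous_fderiv (by norm_num)) z v

theorem contDiff_fderiv_apply {η : ℝ × ℝ → ℝ} (hη : ContDiff ℝ ∞ η) (v : ℝ × ℝ) :
    ContDiff ℝ ∞ fun w => fderiv ℝ η w v :=
  (hη.fderiv_right (m := ∞) (by exact_mod_cast le_rfl)).clm_apply contDiff_const

theorem fderiv_comp_const_sub_apply {η : ℝ × ℝ → ℝ} (hη : ContDiff ℝ ∞ η) (z w v : ℝ × ℝ) :
    fderiv ℝ (fun w => η (z - w)) w v = - fderiv ℝ η (z - w) v := by
  have h : DifferentiableAt ℝ η (z - w) := hη.differentiable (by simp) _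
  have h1 : HasFDerivAt (fun w => η (z - w)) _ w :=
    h.hasFDerivAt.comp w ((hasFDerivAt_id w).const_sub z)
  rw [h1.fderiv]; simp

/-- All derivatives fall on the kernel, and the two signs from differentiating `η (z - w)` in `w`
instead of `z` cancel. In this form the right-hand side is the weak Laplacian of `f` tested with the
reflected, translated kernel. -/
theorem planeLaplacian_mollify {f η : ℝ × ℝ → ℝ} (hf : LocallyIntegrable f) (hη : ContDiff ℝ ∞ η)
    (hc : HasCompactSupport η) (z : ℝ × ℝ) :
    planeLaplacian (mollify f η) z = ∫ w, f w * planeLaplacian (fun w => η (z - w)) w := by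
  have hx := contDiff_fderiv_apply hη
  have hcx := hasCompactSupport_fderiv_apply hc
  have key : ∀ v : ℝ × ℝ, fderiv ℝ (fun w => fderiv ℝ (mollify f η) w v) z v =
      ∫ w, f w * fderiv ℝ (fun w => fderiv ℝ (fun w => η (z - w)) w v) w v := by
    intro v
    have e : (fun w => fderiv ℝ (mollify f η) w v) = mollify f fun w => fderiv ℝ η w v := by
      ext w; exact fderiv_mollify hf hη hc w v
    rw [e, fderiv_mollify hf (hx v) (hcx v), mollify_apply]
    congr 1; ext w
    have e2 : (fun w => fderiv ℝ (fun w => η (z - w)) w v) = fun w => - fderiv ℝ η (z - w) v := by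
      ext w; exact fderiv_comp_const_sub_apply hη z w v
    rw [e2, fderiv_fun_neg]
    rw [neg_apply, fderiv_comp_const_sub_apply (hx v)]
    simp
  have hi : ∀ v : ℝ × ℝ, Integrable fun w =>
      f w * fderiv ℝ (fun w => fderiv ℝ (fun w => η (z - w)) w v) w v := by
    intro v
    have h1 : ContDiff ℝ ∞ fun w => η (z - w) := hη.comp (contDiff_const.sub contDiff_id)
    have h2 : HasCompactSupport fun w => η (z - w) :=
      hc.comp_homeomorph (Homeomorph.subLeft z)
    exact integrable_mul_test (locallyIntegrableOn_univ.2 hf)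
      (contDiff_fderiv_apply (contDiff_fderiv_apply h1 v) v).continuous
      (hasCompactSupport_fderiv_apply (hasCompactSupport_fderiv_apply h2 v) v) (subset_univ _)
  simp only [planeLaplacian]
  rw [key, key, ← integral_add (hi _) (hi _)]
  congr 1; ext w; ring

/-- The rotation invariant mollifier supported in the Euclidean disc of radius `ρ`. -/
noncomputable def radialBump (ρ : ℝ) (z : ℝ × ℝ) : ℝ :=
  Real.smoothTransition (ρ ^ 2 - z.1 ^ 2 - z.2 ^ 2)

theorem contDiff_radialBump (ρ : ℝ) : ContDiff ℝ ∞ (radialBump ρ) :=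
  Real.smoothTransition.contDiff.comp (by fun_prop)

theorem radialBump_eq_zero {ρ : ℝ} {z : ℝ × ℝ} (h : ρ ^ 2 ≤ z.1 ^ 2 + z.2 ^ 2) :
    radialBump ρ z = 0 := Real.smoothTransition.zero_of_nonpos (by linarith)

theorem tsupport_radialBump_subset {ρ : ℝ} (hρ : 0 ≤ ρ) :
    tsupport (radialBump ρ) ⊆ Metric.closedBall 0 ρ := by
  refine closure_minimal (fun z hz => ?_) Metric.isClosed_closedBall
  have : z.1 ^ 2 + z.2 ^ 2 < ρ ^ 2 := by
    by_contra h
    exact hz (radialBump_eq_zero (not_lt.1 h))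
  rw [mem_closedBall_zero_iff, Prod.norm_def, max_le_iff]
  exact ⟨abs_le_of_sq_le_sq (by nlinarith [sq_nonneg z.2]) hρ,
    abs_le_of_sq_le_sq (by nlinarith [sq_nonneg z.1]) hρ⟩

theorem hasCompactSupport_radialBump {ρ : ℝ} (hρ : 0 ≤ ρ) : HasCompactSupport (radialBump ρ) :=
  (isCompact_closedBall (0 : ℝ × ℝ) ρ).of_isClosed_subset (isClosed_tsupport _)
    (tsupport_radialBump_subset hρ)

theorem integral_radialBump_pos {ρ : ℝ} (hρ : 0 < ρ) : 0 < ∫ z, radialBump ρ z := by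
  refine (contDiff_radialBump ρ).continuous.integral_pos_of_hasCompactSupport_nonneg_nonzero
    (hasCompactSupport_radialBump hρ.le) (fun z => Real.smoothTransition.nonneg _) (x := 0) ?_
  exact (Real.smoothTransition.pos_of_pos (by simp; positivity)).ne'

theorem polar_radialBump {ρ : ℝ} (hρ : 0 < ρ) {h : ℝ × ℝ → ℝ} (hh : Continuous h) :
    ∫ w, h w * radialBump ρ w = ∫ r in Ioi (0 : ℝ), r * Real.smoothTransition (ρ ^ 2 - r ^ 2) *
      ∫ θ in Ioo (-Real.pi) Real.pi, h (r * Real.cos θ, r * Real.sin θ) := by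
  rw [← integral_comp_polarCoord_symm]
  have e : ∀ p : ℝ × ℝ, p.1 • (h (polarCoord.symm p) * radialBump ρ (polarCoord.symm p)) =
      p.1 * Real.smoothTransition (ρ ^ 2 - p.1 ^ 2) *
        h (p.1 * Real.cos p.2, p.1 * Real.sin p.2) := by
    intro p
    have : radialBump ρ (polarCoord.symm p) = Real.smoothTransition (ρ ^ 2 - p.1 ^ 2) := by
      simp only [radialBump, polarCoord_symm_apply]
      congr 1
      nlinarith [Real.sin_sq_add_cos_sq p.2]
    rw [this, polarCoord_symm_apply, smul_eq_mul]; ring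
  simp_rw [e]
  rw [polarCoord_target, Measure.volume_eq_prod, setIntegral_prod]
  · simp_rw [integral_const_mul]
  · have hc : Continuous fun p : ℝ × ℝ => p.1 * Real.smoothTransition (ρ ^ 2 - p.1 ^ 2) *
        h (p.1 * Real.cos p.2, p.1 * Real.sin p.2) := by
      have := Real.smoothTransition.continuous
      fun_prop
    have h1 : IntegrableOn (fun p : ℝ × ℝ => p.1 * Real.smoothTransition (ρ ^ 2 - p.1 ^ 2) *
        h (p.1 * Real.cos p.2, p.1 * Real.sin p.2)) (Icc 0 ρ ×ˢ Icc (-Real.pi) Real.pi) :=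
      hc.continuousOn.integrableOn_compact (isCompact_Icc.prod isCompact_Icc)
    refine h1.of_forall_sdiff_eq_zero (measurableSet_Ioi.prod measurableSet_Ioo) fun p hp => ?_
    have h2 : ρ < p.1 := by
      by_contra h3
      exact hp.2 ⟨⟨le_of_lt hp.1.1, not_lt.1 h3⟩, ⟨hp.1.2.1.le, hp.1.2.2.le⟩⟩
    rw [Real.smoothTransition.zero_of_nonpos (by nlinarith)]; simp

/-- In polar coordinates the weight depends on the radius alone, so the mean value property applies
on each circle. The ball in the hypothesis is a square for the sup norm of the product and contains
the Euclidean disc that is needed. -/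
theorem mollify_radialBump_of_harmonic {ρ : ℝ} (hρ : 0 < ρ) {h : ℝ × ℝ → ℝ} (hh : Continuous h)
    {z : ℝ × ℝ} {U : Set (ℝ × ℝ)} (hU : IsHarmonicOn h U) (hz : Metric.closedBall z ρ ⊆ U) :
    mollify h (radialBump ρ) z = h z * ∫ w, radialBump ρ w := by
  have e1 : mollify h (radialBump ρ) z = ∫ w, h (z - w) * radialBump ρ w := by
    rw [mollify_apply, ← integral_sub_left_eq_self _ _ z]
    simp
  have e2 : ∫ w, radialBump ρ w = ∫ w, (fun _ => (1 : ℝ)) w * radialBump ρ w := by simp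
  rw [e1, e2, polar_radialBump hρ (by fun_prop), polar_radialBump hρ continuous_const,
    ← integral_const_mul]
  refine setIntegral_congr_fun measurableSet_Ioi fun r hr => ?_
  have hr0 : (0 : ℝ) < r := hr
  rcases le_or_gt ρ r with h1 | h1
  · rw [Real.smoothTransition.zero_of_nonpos (by nlinarith)]; simp
  have e3 : ∫ θ in Ioo (-Real.pi) Real.pi, h (z - (r * Real.cos θ, r * Real.sin θ)) =
      h z * (2 * Real.pi) := by
    -- The convolution evaluates at `z - r e^{iθ}`, which is the circle of radius `-r` in its
    -- standard parametrization.
    have hav := InnerProductSpace.HarmonicOnNhd.circleAverage_eq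
      (f := fun w : ℂ => h (w.re, w.im)) (c := (⟨z.1, z.2⟩ : ℂ)) (R := -r) ?_
    · rw [Real.circleAverage_def] at hav
      rw [← integral_Ioc_eq_integral_Ioo, ← intervalIntegral.integral_of_le (by linarith [Real.pi_pos])]
      -- Polar coordinates use angles in `(-π, π)`, circle averages those in `(0, 2π)`.
      have hper : Function.Periodic
          (fun θ : ℝ => h (z - (r * Real.cos θ, r * Real.sin θ))) (2 * Real.pi) := by
        intro θ; simp
      have h4 := hper.intervalIntegral_add_eq (-Real.pi) 0
      rw [show -Real.pi + 2 * Real.pi = Real.pi by ring, zero_add] at h4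
      rw [h4]
      have h5 : ∀ θ : ℝ, ((circleMap (⟨z.1, z.2⟩ : ℂ) (-r) θ).re, (circleMap (⟨z.1, z.2⟩ : ℂ) (-r) θ).im)
          = z - (r * Real.cos θ, r * Real.sin θ) := by
        intro θ
        simp [circleMap, Complex.exp_re, Complex.exp_im, Prod.ext_iff]
        constructor <;> ring
      simp only [h5, smul_eq_mul] at hav
      have hpi : (2 * Real.pi) ≠ 0 := by positivity
      field_simp at hav
      rw [hav]; ring
    · intro w hw
      apply hU
      apply hz
      rw [Metric.mem_closedBall, abs_neg, abs_of_pos hr0] at hw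
      rw [Metric.mem_closedBall, Prod.dist_eq, max_le_iff]
      have h6 : |w.re - z.1| ≤ ‖w - ⟨z.1, z.2⟩‖ := by
        simpa using Complex.abs_re_le_norm (w - ⟨z.1, z.2⟩)
      have h7 : |w.im - z.2| ≤ ‖w - ⟨z.1, z.2⟩‖ := by
        simpa using Complex.abs_im_le_norm (w - ⟨z.1, z.2⟩)
      rw [dist_eq_norm] at hw
      exact ⟨by rw [Real.dist_eq]; linarith, by rw [Real.dist_eq]; linarith⟩
  rw [e3]
  simp [Real.pi_pos.le]
  ring

theorem two_le_infty : (2 : WithTop ℕ∞) ≤ ((⊤ : ℕ∞) : WithTop ℕ∞) := by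
  exact WithTop.coe_le_coe.2 (le_top : (2 : ℕ∞) ≤ ⊤)

theorem locallyIntegrable_norm {f : ℝ × ℝ → ℝ} (hf : LocallyIntegrable f) :
    LocallyIntegrable fun z => ‖f z‖ := fun x =>
  let ⟨s, hs, hi⟩ := hf x
  ⟨s, hs, hi.norm⟩

open ContinuousLinearMap in
theorem convolution_eq_mollify (f η : ℝ × ℝ → ℝ) :
    convolution η f (lsmul ℝ ℝ) volume = mollify f η := by
  unfold mollify
  rw [← convolution_flip]
  congr 1
  ext; simp

theorem mollify_mollify {f φ η : ℝ × ℝ → ℝ} (hf : LocallyIntegrable f) (hφ : Continuous φ)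
    (hφc : HasCompactSupport φ) (hη : Continuous η) (hηc : HasCompactSupport η) (z : ℝ × ℝ) :
    mollify (mollify f φ) η z = mollify (mollify f η) φ z := by
  rw [← convolution_eq_mollify f φ, ← convolution_eq_mollify (mollify f η) φ]
  unfold mollify
  refine convolution_assoc (ContinuousLinearMap.lsmul ℝ ℝ) (ContinuousLinearMap.lsmul ℝ ℝ)
    (ContinuousLinearMap.lsmul ℝ ℝ) (ContinuousLinearMap.lsmul ℝ ℝ) (fun x y z => by simp [mul_assoc])
    hφ.aestronglyMeasurable hf.aestronglyMeasurable hη.aestronglyMeasurable ?_ ?_ ?_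
  · exact Eventually.of_forall fun y => hφc.convolutionExists_left _ hφ hf y
  · exact Eventually.of_forall fun y =>
      hηc.norm.convolutionExists_right _ (locallyIntegrable_norm hf) hη.norm y
  · refine hφc.norm.convolutionExists_left _ hφ.norm ?_ z
    exact (hηc.norm.continuous_convolution_right _ (locallyIntegrable_norm hf) hη.norm).locallyIntegrable

/-- Weyl's lemma in the plane. -/
theorem exists_harmonic_ae_eq {Ω : Set (ℝ × ℝ)} (hΩ : IsOpen Ω) {f : ℝ × ℝ → ℝ}
    (hf : LocallyIntegrable f)
    (hw : ∀ φ : ℝ × ℝ → ℝ, ContDiff ℝ ∞ φ → HasCompactSupport φ → tsupport φ ⊆ Ω →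
      ∫ z, f z * planeLaplacian φ z = 0) :
    ∃ u : ℝ × ℝ → ℝ, f =ᵐ[volume.restrict Ω] u ∧ IsHarmonicOn u Ω := by
  -- The ratio of the radii is kept equal to `2`, as the almost everywhere convergence of
  -- mollifications requires a bound on it. The balls are those of the sup norm, so these kernels
  -- are not assumed radial; a separate rotation invariant kernel supplies the mean value argument.
  let φ : ℕ → ContDiffBump (0 : ℝ × ℝ) := fun n =>
    ⟨1 / (2 * ((n : ℝ) + 1)), 1 / ((n : ℝ) + 1), by positivity, by
      apply one_div_lt_one_div_of_lt <;> linarith [(Nat.cast_nonneg n : (0 : ℝ) ≤ n)]⟩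
  have hφ0 : Tendsto (fun n => (φ n).rOut) atTop (𝓝 0) := tendsto_one_div_add_atTop_nhds_zero_nat
  let k : ℕ → ℝ × ℝ → ℝ := fun n => (φ n).normed volume
  have hk : ∀ n, ContDiff ℝ ∞ (k n) := fun n => (φ n).contDiff_normed
  have hkc : ∀ n, HasCompactSupport (k n) := fun n => (φ n).hasCompactSupport_normed
  have hlap : ∀ (η : ℝ × ℝ → ℝ), ContDiff ℝ ∞ η → HasCompactSupport η → ∀ r, 
      tsupport η ⊆ Metric.closedBall 0 r → ∀ z, Metric.closedBall z r ⊆ Ω →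
      planeLaplacian (mollify f η) z = 0 := by
    intro η hη hηc r hr z hz
    rw [planeLaplacian_mollify hf hη hηc]
    refine hw _ (hη.comp (contDiff_const.sub contDiff_id))
      (hηc.comp_homeomorph (Homeomorph.subLeft z)) ?_
    refine Subset.trans (closure_minimal ?_ Metric.isClosed_closedBall) hz
    intro w hw'
    have := hr (subset_tsupport η hw')
    rw [mem_closedBall_zero_iff] at this
    rwa [Metric.mem_closedBall, dist_comm, dist_eq_norm]
  have hae : ∀ᵐ z, Tendsto (fun n => mollify f (k n) z) atTop (𝓝 (f z)) := by
    have := ContDiffBump.ae_convolution_tendsto_right_of_locallyIntegrable (μ := volume) (φ := φ)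
      (K := 2) hφ0 (Eventually.of_forall fun n => le_of_eq ?_) hf
    · simpa only [convolution_eq_mollify] using this
    · show 1 / ((n : ℝ) + 1) = 2 * (1 / (2 * ((n : ℝ) + 1)))
      field_simp
  -- Taking the pointwise limit as the definition gives one global function, so no local
  -- representatives have to be glued.
  let u : ℝ × ℝ → ℝ := fun z => limUnder atTop fun n => mollify f (k n) z
  have hloc : ∀ z ∈ Ω, ∃ r > 0, ∃ G : ℝ × ℝ → ℝ, ContDiff ℝ ∞ G ∧
      (∀ w ∈ Metric.ball z r, planeLaplacian G w = 0) ∧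
      ∀ w ∈ Metric.ball z r, u w = G w := by
    intro z hz
    obtain ⟨R, hR, hRΩ⟩ := Metric.isOpen_iff.1 hΩ z hz
    -- A quarter leaves room for three things: `w` within `ρ` of `z`, a square of radius `ρ` around
    -- `w`, and mollifiers of radius below `ρ`.
    set ρ := R / 4 with hρ
    have hρ0 : 0 < ρ := by positivity
    set c := ∫ w, radialBump ρ w
    have hc : 0 < c := integral_radialBump_pos hρ0
    have hη := contDiff_radialBump ρ
    have hηc := hasCompactSupport_radialBump hρ0.le
    have hG := contDiff_mollify hf hη hηc
    have hsub : ∀ w s, dist w z + s < R → Metric.closedBall w s ⊆ Ω := by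
      intro w s hws v hv
      apply hRΩ
      rw [Metric.mem_ball]
      rw [Metric.mem_closedBall] at hv
      linarith [dist_triangle v w z]
    refine ⟨ρ, hρ0, fun w => c⁻¹ * mollify f (radialBump ρ) w, contDiff_const.mul hG, ?_, ?_⟩
    · intro w hw'
      rw [Metric.mem_ball] at hw'
      have h0 := hlap _ hη hηc ρ (tsupport_radialBump_subset hρ0.le) w (hsub w ρ (by linarith))
      have hd : ∀ v : ℝ × ℝ, (fun y => fderiv ℝ (fun w => c⁻¹ * mollify f (radialBump ρ) w) y v) =
          fun y => c⁻¹ * fderiv ℝ (mollify f (radialBump ρ)) y v := by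
        intro v; ext y
        rw [fderiv_const_mul (hG.differentiable (by simp) y)]; rfl
      have hd2 : ∀ v : ℝ × ℝ, fderiv ℝ
          (fun y => c⁻¹ * fderiv ℝ (mollify f (radialBump ρ)) y v) w v =
          c⁻¹ * fderiv ℝ (fun y => fderiv ℝ (mollify f (radialBump ρ)) y v) w v := by
        intro v
        rw [fderiv_const_mul ((contDiff_fderiv_apply hG v).differentiable (by simp) w)]; rfl
      unfold planeLaplacian at h0 ⊢
      rw [hd, hd, hd2, hd2, ← mul_add, h0, mul_zero]
    · intro w hw'
      rw [Metric.mem_ball] at hw'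
      -- Near `w` the function `f * k n` is harmonic, so convolving it with the radial kernel only
      -- multiplies it by `c`. Commuting the two convolutions expresses `f * k n` through the smooth
      -- function `f * radialBump ρ`, mollified once more, and that converges at every point.
      have hev : ∀ᶠ n in atTop, mollify f (k n) w =
          c⁻¹ * mollify (mollify f (radialBump ρ)) (k n) w := by
        filter_upwards [hφ0.eventually (gt_mem_nhds hρ0)] with n hn
        rw [← mollify_mollify hf (hk n).continuous (hkc n) hη.continuous hηc,
          mollify_radialBump_of_harmonic hρ0 (contDiff_mollify hf (hk n) (hkc n)).continuous
            (U := Metric.ball z (3 * ρ))]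
        · field_simp
          rfl
        · refine isHarmonicOn_of_planeLaplacian Metric.isOpen_ball
            ((contDiff_mollify hf (hk n) (hkc n)).of_le two_le_infty).contDiffOn ?_
          intro v hv
          rw [Metric.mem_ball] at hv
          refine hlap _ (hk n) (hkc n) (φ n).rOut ?_ v (hsub v _ (by linarith))
          rw [(φ n).tsupport_normed_eq]
        · intro v hv
          rw [Metric.mem_closedBall] at hv
          rw [Metric.mem_ball]
          linarith [dist_triangle v w z]
      have hlim : Tendsto (fun n => mollify (mollify f (radialBump ρ)) (k n) w) atTop
          (𝓝 (mollify f (radialBump ρ) w)) := by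
        have := ContDiffBump.convolution_tendsto_right_of_continuous (μ := volume) (φ := φ)
          hφ0 hG.continuous w
        simpa only [convolution_eq_mollify] using this
      exact ((hlim.const_mul c⁻¹).congr' (hev.mono fun n hn => hn.symm)).limUnder_eq
  refine ⟨u, ?_, ?_⟩
  · refine ae_restrict_of_ae ?_
    filter_upwards [hae] with z hz using hz.limUnder_eq.symm
  · intro w hw'
    obtain ⟨r, hr, G, hG, hG0, huG⟩ := hloc _ hw'
    have h1 : IsHarmonicOn G (Metric.ball (w.re, w.im) r) :=
      isHarmonicOn_of_planeLaplacian Metric.isOpen_ball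
        (hG.of_le two_le_infty).contDiffOn hG0
    have h2 : (fun w : ℂ => u (w.re, w.im)) =ᶠ[𝓝 w] fun w : ℂ => G (w.re, w.im) := by
      filter_upwards [(isOpen_complex_preimage (Metric.isOpen_ball)).mem_nhds
        (show w ∈ {w' : ℂ | (w'.re, w'.im) ∈ Metric.ball (w.re, w.im) r} from
          Metric.mem_ball_self hr)] with v hv using huG _ hv
    exact (InnerProductSpace.harmonicAt_congr_nhds h2).2 (h1 w (Metric.mem_ball_self hr))

/-! ### Stretching vertical lines: change of variables and weak derivatives. -/

/-- The map that shrinks vertical lines by the factors `J(x)`. -/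
noncomputable def shrink (J : ℝ → ℝ) (z : ℝ × ℝ) : ℝ × ℝ := (z.1, z.2 / J z.1)

/-- The map that stretches vertical lines by the factors `J(x)`. -/
def stretch (J : ℝ → ℝ) (z : ℝ × ℝ) : ℝ × ℝ := (z.1, J z.1 * z.2)

section Shrink

variable {J : ℝ → ℝ}

theorem stretch_shrink (hJ : ∀ x, 0 < J x) (z : ℝ × ℝ) : stretch J (shrink J z) = z := by
  ext
  · rfl
  · exact mul_div_cancel₀ _ (hJ z.1).ne'

theorem shrink_stretch (hJ : ∀ x, 0 < J x) (z : ℝ × ℝ) : shrink J (stretch J z) = z := by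
  ext
  · rfl
  · exact mul_div_cancel_left₀ _ (hJ z.1).ne'

theorem continuous_stretch (hc : Continuous J) : Continuous (stretch J) := by
  unfold stretch; fun_prop

theorem continuous_shrink (hc : Continuous J) (hJ : ∀ x, 0 < J x) : Continuous (shrink J) := by
  unfold shrink
  exact continuous_fst.prodMk (continuous_snd.div₀ (by fun_prop) fun z => (hJ z.1).ne')

/-- The shrinking of vertical lines as a homeomorphism. -/
noncomputable def shrinkHomeomorph (hc : Continuous J) (hJ : ∀ x, 0 < J x) : ℝ × ℝ ≃ₜ ℝ × ℝ where
  toFun := shrink J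
  invFun := stretch J
  left_inv := stretch_shrink hJ
  right_inv := shrink_stretch hJ
  continuous_toFun := continuous_shrink hc hJ
  continuous_invFun := continuous_stretch hc

theorem measurableEmbedding_shrink (hc : Continuous J) (hJ : ∀ x, 0 < J x) :
    MeasurableEmbedding (shrink J) := (shrinkHomeomorph hc hJ).measurableEmbedding

/-- By Tonelli this is the scaling of Lebesgue measure on each vertical line, so only continuity of
`J` matters and no Jacobian of a planar map is involved. -/
theorem map_shrink_volume (hc : Continuous J) (hJ : ∀ x, 0 < J x) :
    Measure.map (shrink J) volume =
      (volume : Measure (ℝ × ℝ)).withDensity fun z => ENNReal.ofReal (J z.1) := by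
  have hS := (continuous_shrink hc hJ).measurable
  ext s hs
  rw [Measure.map_apply hS hs, withDensity_apply _ hs, ← lintegral_indicator_one (hS hs),
    ← lintegral_indicator hs, Measure.volume_eq_prod,
    lintegral_prod _ ((measurable_one.indicator (hS hs)).aemeasurable),
    lintegral_prod _ ((Measurable.indicator (by fun_prop) hs).aemeasurable)]
  refine lintegral_congr fun x => ?_
  have h1 : ∀ y, (shrink J ⁻¹' s).indicator (1 : ℝ × ℝ → ℝ≥0∞) (x, y) =
      (fun y => s.indicator (1 : ℝ × ℝ → ℝ≥0∞) (x, y)) ((J x)⁻¹ * y) := by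
    intro y
    have : shrink J (x, y) = (x, (J x)⁻¹ * y) := by simp [shrink, div_eq_inv_mul]
    by_cases h : (x, (J x)⁻¹ * y) ∈ s
    · simp [h, this]
    · simp [h, this]
  have h2 : ∀ y, s.indicator (fun z : ℝ × ℝ => ENNReal.ofReal (J z.1)) (x, y) =
      ENNReal.ofReal (J x) * (fun y => s.indicator (1 : ℝ × ℝ → ℝ≥0∞) (x, y)) y := by
    intro y
    by_cases h : (x, y) ∈ s
    · simp [h]
    · simp [h]
  have hm : Measurable fun y => s.indicator (1 : ℝ × ℝ → ℝ≥0∞) (x, y) :=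
    (measurable_one.indicator hs).comp (by fun_prop)
  simp_rw [h1, h2]
  rw [lintegral_const_mul _ hm, ← lintegral_map hm (measurable_const_mul _),
    Real.map_volume_mul_left (inv_ne_zero (hJ x).ne'), lintegral_smul_measure, inv_inv,
    abs_of_pos (hJ x)]
  rfl

theorem integral_comp_shrink (hc : Continuous J) (hJ : ∀ x, 0 < J x) (f : ℝ × ℝ → ℝ) :
    ∫ z, f (shrink J z) = ∫ z, J z.1 * f z := by
  rw [← (measurableEmbedding_shrink hc hJ).integral_map, map_shrink_volume hc hJ,
    integral_withDensity_eq_integral_toReal_smul (by fun_prop) (by simp)]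
  congr 1; ext z
  rw [ENNReal.toReal_ofReal (hJ z.1).le, smul_eq_mul]

theorem integrable_comp_shrink_iff (hc : Continuous J) (hJ : ∀ x, 0 < J x) (f : ℝ × ℝ → ℝ) :
    Integrable (fun z => f (shrink J z)) ↔ Integrable fun z => J z.1 * f z := by
  have := (measurableEmbedding_shrink hc hJ).integrable_map_iff (μ := volume) (g := f)
  rw [map_shrink_volume hc hJ, integrable_withDensity_iff_integrable_smul' (by fun_prop) (by simp)]
    at this
  rw [show (fun z => f (shrink J z)) = f ∘ shrink J from rfl, ← this]
  refine integrable_congr (Eventually.of_forall fun z => ?_)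
  simp only
  rw [ENNReal.toReal_ofReal (hJ z.1).le, smul_eq_mul]

/-- The image measure has density `J ≤ 2`. The sharp constant would be `√2`; the cruder `2` is
enough. -/
theorem eLpNorm_comp_shrink_le (hc : Continuous J) (hJ : ∀ x, 0 < J x) (hJ2 : ∀ x, J x ≤ 2)
    (f : ℝ × ℝ → ℝ) : eLpNorm (fun z => f (shrink J z)) 2 volume ≤ 2 * eLpNorm f 2 volume := by
  have h1 : eLpNorm (fun z => f (shrink J z)) 2 volume =
      eLpNorm f 2 (Measure.map (shrink J) volume) :=
    ((measurableEmbedding_shrink hc hJ).eLpNorm_map_measure).symm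
  have h2 : Measure.map (shrink J) volume ≤ (2 : ℝ≥0∞) • (volume : Measure (ℝ × ℝ)) := by
    rw [map_shrink_volume hc hJ, ← withDensity_const]
    refine withDensity_mono (Eventually.of_forall fun z => ?_)
    exact (ENNReal.ofReal_le_ofReal (hJ2 z.1)).trans (by simp)
  rw [h1]
  refine (eLpNorm_le_of_measure_le_smul h2).trans ?_
  rw [smul_eq_mul]
  gcongr
  calc (2 : ℝ≥0∞) ^ (1 / (2 : ℝ≥0∞)).toReal ≤ 2 ^ (1 : ℝ) :=
        ENNReal.rpow_le_rpow_of_exponent_le (by norm_num) (by norm_num)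
    _ = 2 := by simp

theorem locallyIntegrable_comp_shrink (hc : Continuous J) (hJ : ∀ x, 0 < J x) {f : ℝ × ℝ → ℝ}
    (hf : LocallyIntegrable f) : LocallyIntegrable fun z => f (shrink J z) := by
  rw [locallyIntegrable_iff]
  intro K hK
  have hSK : IsCompact (shrink J '' K) := hK.image (continuous_shrink hc hJ)
  have h1 : IntegrableOn (fun z => J z.1 * f z) (shrink J '' K) :=
    (hf.integrableOn_isCompact hSK).continuousOn_mul (by fun_prop) hSK
  rw [← integrable_indicator_iff hSK.measurableSet] at h1
  rw [← integrable_indicator_iff hK.measurableSet]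
  have h2 : K.indicator (fun z => f (shrink J z)) =
      fun z => (shrink J '' K).indicator f (shrink J z) := by
    ext z
    have : shrink J z ∈ shrink J '' K ↔ z ∈ K :=
      (shrinkHomeomorph hc hJ).injective.mem_set_image
    by_cases h : z ∈ K
    · rw [indicator_of_mem h, indicator_of_mem (this.2 h)]
    · rw [indicator_of_notMem h, indicator_of_notMem (fun h' => h (this.1 h'))]
  rw [h2, integrable_comp_shrink_iff hc hJ]
  refine h1.congr (Eventually.of_forall fun z => ?_)
  by_cases h : z ∈ shrink J '' K
  · simp only [indicator_of_mem h]
  · simp only [indicator_of_notMem h, mul_zero]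

/-- The vertical weak derivative after a stretching of vertical lines. -/
theorem HasWeakDeriv.comp_shrink_snd (hs : ContDiff ℝ ∞ J) (hJ : ∀ x, 0 < J x) {f g : ℝ × ℝ → ℝ}
    (h : HasWeakDeriv univ (0, 1) f g) :
    HasWeakDeriv univ (0, 1) (fun z => f (shrink J z))
      (fun z => (fun w : ℝ × ℝ => g w / J w.1) (shrink J z)) := by
  have hc := hs.continuous
  have hf := locallyIntegrableOn_univ.1 h.1
  have hg := locallyIntegrableOn_univ.1 h.2
  have hg' : LocallyIntegrable fun w : ℝ × ℝ => g w / J w.1 := by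
    rw [locallyIntegrable_iff]
    intro K hK
    simp_rw [div_eq_mul_inv]
    exact (hg.integrableOn_isCompact hK).mul_continuousOn
      (Continuous.inv₀ (f := fun w : ℝ × ℝ => J w.1) (by fun_prop) fun z => (hJ z.1).ne').continuousOn hK
  refine ⟨locallyIntegrableOn_univ.2 (locallyIntegrable_comp_shrink hc hJ hf),
    locallyIntegrableOn_univ.2 (locallyIntegrable_comp_shrink hc hJ hg'), ?_⟩
  intro φ hφ hφc _
  have hT : ContDiff ℝ ∞ (stretch J) :=
    contDiff_fst.prodMk ((hs.comp contDiff_fst).mul contDiff_snd)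
  have hφT : ContDiff ℝ ∞ fun z => φ (stretch J z) := hφ.comp hT
  have hφTc : HasCompactSupport fun z => φ (stretch J z) :=
    hφc.comp_homeomorph (shrinkHomeomorph hc hJ).symm
  have hd : ∀ z, fderiv ℝ (fun z => φ (stretch J z)) z (0, 1) =
      J z.1 * fderiv ℝ φ (stretch J z) (0, 1) := by
    intro z
    have hJz : HasFDerivAt (fun z : ℝ × ℝ => J z.1) _ z :=
      ((hs.differentiable (by simp)) z.1).hasDerivAt.hasFDerivAt.comp z hasFDerivAt_fst
    have h1 : HasFDerivAt (stretch J) _ z :=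
      hasFDerivAt_fst.prodMk (hJz.mul hasFDerivAt_snd)
    have h2 : HasFDerivAt (fun z => φ (stretch J z)) _ z :=
      (hφ.differentiable (by simp) (stretch J z)).hasFDerivAt.comp z h1
    rw [h2.fderiv]
    have e1 : fderiv ℝ φ (stretch J z) ((0 : ℝ), J z.1) =
        J z.1 * fderiv ℝ φ (stretch J z) (0, 1) := by
      rw [show ((0 : ℝ), J z.1) = J z.1 • ((0 : ℝ), (1 : ℝ)) by simp, map_smul, smul_eq_mul]
    simp [e1]
  have key := h.3 _ hφT hφTc (subset_univ _)
  have e1 : ∫ z, f (shrink J z) * fderiv ℝ φ z (0, 1) =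
      ∫ z, J z.1 * (f z * fderiv ℝ φ (stretch J z) (0, 1)) := by
    rw [← integral_comp_shrink hc hJ]
    simp_rw [stretch_shrink hJ]
  have e2 : ∫ z, g (shrink J z) / J (shrink J z).1 * φ z =
      ∫ z, J z.1 * (g z / J z.1 * φ (stretch J z)) := by
    rw [← integral_comp_shrink hc hJ (fun z => g z / J z.1 * φ (stretch J z))]
    simp_rw [stretch_shrink hJ]
  rw [e1, e2]
  simp_rw [hd] at key
  convert key using 2
  · ext z; ring
  · congr 1; ext z
    have := (hJ z.1).ne'
    field_simp

/-- The horizontal weak derivative after a stretching of vertical lines. -/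
theorem HasWeakDeriv.comp_shrink_fst (hs : ContDiff ℝ ∞ J) (hJ : ∀ x, 0 < J x)
    {f gx gy : ℝ × ℝ → ℝ} (hx : HasWeakDeriv univ (1, 0) f gx) (hy : HasWeakDeriv univ (0, 1) f gy) :
    HasWeakDeriv univ (1, 0) (fun z => f (shrink J z))
      (fun z => (fun w : ℝ × ℝ => gx w - deriv J w.1 * w.2 * gy w / J w.1) (shrink J z)) := by
  have hc := hs.continuous
  have hs1 : ContDiff ℝ ∞ (deriv J) := ((contDiff_infty_iff_deriv (𝕜 := ℝ)).1 hs).2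
  have hs1c := hs1.continuous
  have hf := locallyIntegrableOn_univ.1 hx.1
  have hgx := locallyIntegrableOn_univ.1 hx.2
  have hgy := locallyIntegrableOn_univ.1 hy.2
  have hg' : LocallyIntegrable fun w : ℝ × ℝ => gx w - deriv J w.1 * w.2 * gy w / J w.1 := by
    refine hgx.sub ?_
    rw [locallyIntegrable_iff]
    intro K hK
    have : Continuous fun w : ℝ × ℝ => deriv J w.1 * w.2 * (J w.1)⁻¹ :=
      Continuous.mul (by fun_prop) (Continuous.inv₀ (by fun_prop) fun z => (hJ z.1).ne')
    refine ((hgy.integrableOn_isCompact hK).mul_continuousOn this.continuousOn hK).congr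
      (Eventually.of_forall fun z => ?_)
    simp only [div_eq_mul_inv]; ring
  refine ⟨locallyIntegrableOn_univ.2 (locallyIntegrable_comp_shrink hc hJ hf),
    locallyIntegrableOn_univ.2 (locallyIntegrable_comp_shrink hc hJ hg'), ?_⟩
  intro φ hφ hφc _
  have hT : ContDiff ℝ ∞ (stretch J) :=
    contDiff_fst.prodMk ((hs.comp contDiff_fst).mul contDiff_snd)
  have hφT : ContDiff ℝ ∞ fun z => φ (stretch J z) := hφ.comp hT
  have hφTc : HasCompactSupport fun z => φ (stretch J z) :=
    hφc.comp_homeomorph (shrinkHomeomorph hc hJ).symm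
  have hA : ContDiff ℝ ∞ fun z : ℝ × ℝ => J z.1 * φ (stretch J z) :=
    (hs.comp contDiff_fst).mul hφT
  have hB : ContDiff ℝ ∞ fun z : ℝ × ℝ => deriv J z.1 * z.2 * φ (stretch J z) :=
    ((hs1.comp contDiff_fst).mul contDiff_snd).mul hφT
  have hAc : HasCompactSupport fun z : ℝ × ℝ => J z.1 * φ (stretch J z) := hφTc.mul_left
  have hBc : HasCompactSupport fun z : ℝ × ℝ => deriv J z.1 * z.2 * φ (stretch J z) :=
    hφTc.mul_left
  -- After the change of variables the test function carries the factor `J`. Writing the result as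
  -- an `x`-derivative minus a `y`-derivative of test functions lets the two weak derivatives of `f`
  -- be used as they are.
  have hd : ∀ z, J z.1 * fderiv ℝ φ (stretch J z) (1, 0) =
      fderiv ℝ (fun z : ℝ × ℝ => J z.1 * φ (stretch J z)) z (1, 0) -
        fderiv ℝ (fun z : ℝ × ℝ => deriv J z.1 * z.2 * φ (stretch J z)) z (0, 1) := by
    intro z
    have hJz : HasFDerivAt (fun z : ℝ × ℝ => J z.1) _ z :=
      ((hs.differentiable (by simp)) z.1).hasDerivAt.hasFDerivAt.comp z hasFDerivAt_fst
    have hJz' : HasFDerivAt (fun z : ℝ × ℝ => deriv J z.1) _ z :=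
      ((hs1.differentiable (by simp)) z.1).hasDerivAt.hasFDerivAt.comp z hasFDerivAt_fst
    have h1 : HasFDerivAt (stretch J) _ z :=
      hasFDerivAt_fst.prodMk (hJz.mul hasFDerivAt_snd)
    have h2 : HasFDerivAt (fun z => φ (stretch J z)) _ z :=
      (hφ.differentiable (by simp) (stretch J z)).hasFDerivAt.comp z h1
    have h3 : HasFDerivAt (fun z : ℝ × ℝ => J z.1 * φ (stretch J z)) _ z := hJz.mul h2
    have h4 : HasFDerivAt (fun z : ℝ × ℝ => deriv J z.1 * z.2 * φ (stretch J z)) _ z :=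
      (hJz'.mul hasFDerivAt_snd).mul h2
    rw [h3.fderiv, h4.fderiv]
    have e1 : fderiv ℝ φ (stretch J z) ((0 : ℝ), J z.1) =
        J z.1 * fderiv ℝ φ (stretch J z) (0, 1) := by
      rw [show ((0 : ℝ), J z.1) = J z.1 • ((0 : ℝ), (1 : ℝ)) by simp, map_smul, smul_eq_mul]
    have e2 : fderiv ℝ φ (stretch J z) ((1 : ℝ), z.2 * deriv J z.1) =
        fderiv ℝ φ (stretch J z) (1, 0) +
          z.2 * deriv J z.1 * fderiv ℝ φ (stretch J z) (0, 1) := by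
      rw [show ((1 : ℝ), z.2 * deriv J z.1) =
        ((1 : ℝ), (0 : ℝ)) + (z.2 * deriv J z.1) • ((0 : ℝ), (1 : ℝ)) by simp, map_add, map_smul,
        smul_eq_mul]
    simp [e1, e2]
    ring
  have i1 : Integrable fun z : ℝ × ℝ =>
      f z * fderiv ℝ (fun z : ℝ × ℝ => J z.1 * φ (stretch J z)) z (1, 0) :=
    integrable_mul_test hx.1 (contDiff_fderiv_apply hA _).continuous
      (hasCompactSupport_fderiv_apply hAc _) (subset_univ _)
  have i2 : Integrable fun z : ℝ × ℝ =>
      f z * fderiv ℝ (fun z : ℝ × ℝ => deriv J z.1 * z.2 * φ (stretch J z)) z (0, 1) :=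
    integrable_mul_test hx.1 (contDiff_fderiv_apply hB _).continuous
      (hasCompactSupport_fderiv_apply hBc _) (subset_univ _)
  have i3 := integrable_mul_test hx.2 hA.continuous hAc (subset_univ _)
  have i4 := integrable_mul_test hy.2 hB.continuous hBc (subset_univ _)
  have kx := hx.3 _ hA hAc (subset_univ _)
  have ky := hy.3 _ hB hBc (subset_univ _)
  have e1 : ∫ z, f (shrink J z) * fderiv ℝ φ z (1, 0) =
      ∫ z, J z.1 * (f z * fderiv ℝ φ (stretch J z) (1, 0)) := by
    rw [← integral_comp_shrink hc hJ]
    simp_rw [stretch_shrink hJ]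
  have e2 : ∫ z, (gx (shrink J z) -
        deriv J (shrink J z).1 * (shrink J z).2 * gy (shrink J z) / J (shrink J z).1) * φ z =
      ∫ z, J z.1 * ((gx z - deriv J z.1 * z.2 * gy z / J z.1) * φ (stretch J z)) := by
    rw [← integral_comp_shrink hc hJ
      (fun z => (gx z - deriv J z.1 * z.2 * gy z / J z.1) * φ (stretch J z))]
    simp_rw [stretch_shrink hJ]
  rw [e1, e2]
  have e3 : ∀ z, J z.1 * (f z * fderiv ℝ φ (stretch J z) (1, 0)) =
      f z * fderiv ℝ (fun z : ℝ × ℝ => J z.1 * φ (stretch J z)) z (1, 0) -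
      f z * fderiv ℝ (fun z : ℝ × ℝ => deriv J z.1 * z.2 * φ (stretch J z)) z (0, 1) := by
    intro z
    rw [← mul_sub, ← hd]; ring
  have e4 : ∀ z, J z.1 * ((gx z - deriv J z.1 * z.2 * gy z / J z.1) * φ (stretch J z)) =
      gx z * (J z.1 * φ (stretch J z)) - gy z * (deriv J z.1 * z.2 * φ (stretch J z)) := by
    intro z
    have := (hJ z.1).ne'
    field_simp
  simp_rw [e3, e4]
  rw [integral_sub i1 i2, integral_sub i3 i4, kx, ky]
  ring

end Shrink

/-! ### The multiplied-out minimality and the interior variation. -/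

section Variation

variable {m lam : ℝ} {δ : ℝ≥0∞} {ψ : ℝ × ℝ → ℝ} {ζ : ℝ → ℝ}

/-- The Dirichlet energy of `ψ - y` in the fluid domain. -/
noncomputable def excessEnergy (ψ : ℝ × ℝ → ℝ) (ζ : ℝ → ℝ) : ℝ :=
  ∫ z in fluidDomain ζ, (wdx ψ z ^ 2 + (wdy ψ z - 1) ^ 2)

theorem Admissible.integral_sq_pos (h : Admissible m ψ ζ) : 0 < ∫ x, ζ x ^ 2 :=
  lt_of_le_of_ne (integral_nonneg fun _ => sq_nonneg _) (Ne.symm h.surface_sq_ne_zero)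

theorem IsMinimizer.excessEnergy_eq (h : IsMinimizer m δ lam ψ ζ) :
    excessEnergy ψ ζ - 2 * m = lam * ∫ x, ζ x ^ 2 := by
  have h1 := h.attained
  unfold quotient at h1
  rw [h.admissible.renormalizedEnergy_eq, div_eq_iff h.admissible.surface_sq_ne_zero] at h1
  exact h1

/-- Clearing the positive denominator replaces the quotient by a difference that vanishes at the
minimizer, so first variations need no quotient rule. -/
theorem IsMinimizer.le_excessEnergy (h : IsMinimizer m δ lam ψ ζ) {ψ' : ℝ × ℝ → ℝ} {ζ' : ℝ → ℝ}
    (h' : Admissible m ψ' ζ') (hd : pairDist ψ ζ ψ' ζ' ≤ δ) :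
    lam * ∫ x, ζ' x ^ 2 ≤ excessEnergy ψ' ζ' - 2 * m := by
  have h1 : lam ≤ quotient ψ' ζ' := h.isGLB.1 ⟨ψ', ζ', h', hd, rfl⟩
  unfold quotient at h1
  rw [h'.renormalizedEnergy_eq, le_div_iff₀ h'.integral_sq_pos] at h1
  exact h1

/-- A local minimum at `0`, with `t` of both signs. The varied functional need not be
differentiable: an upper bound with a quadratic error suffices. -/
theorem eq_zero_of_eventually_nonneg {L C : ℝ} (h : ∀ᶠ t in 𝓝 (0 : ℝ), 0 ≤ t * L + C * t ^ 2) :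
    L = 0 := by
  have h1 : IsLocalMin (fun t : ℝ => t * L + C * t ^ 2) 0 := by
    filter_upwards [h] with t ht
    simpa using ht
  have h2 : HasDerivAt (fun t : ℝ => t * L + C * t ^ 2) (1 * L + C * (2 * 0 ^ 1 * 1)) 0 :=
    ((hasDerivAt_id 0).mul_const L).add (((hasDerivAt_id (0 : ℝ)).pow 2).const_mul C)
  have := h1.hasDerivAt_eq_zero h2
  simpa using this

theorem integral_mul_eq_of_tsupport_subset {D : Set (ℝ × ℝ)} {f g : ℝ × ℝ → ℝ}
    (hg : tsupport g ⊆ D) : ∫ z in D, f z * g z = ∫ z, f z * g z := by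
  refine setIntegral_eq_integral_of_forall_compl_eq_zero fun z hz => ?_
  rw [image_eq_zero_of_notMem_tsupport fun h => hz (hg h), mul_zero]

/-- Minimizers are weakly harmonic. -/
theorem IsMinimizer.weakly_harmonic (hδ : 0 < δ) (h : IsMinimizer m δ lam ψ ζ) {φ : ℝ × ℝ → ℝ}
    (hφ : ContDiff ℝ ∞ φ) (hc : HasCompactSupport φ) (hs : tsupport φ ⊆ fluidDomain ζ) :
    ∫ z, ψ z * planeLaplacian φ z = 0 := by
  have hA := h.admissible
  set D := fluidDomain ζ
  have hφd := contDiff_fderiv_apply hφ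
  have hφc := hasCompactSupport_fderiv_apply hc
  have hφs := fun v => (tsupport_fderiv_apply_subset' φ v).trans hs
  set px := fun z => fderiv ℝ φ z (1, 0)
  set py := fun z => fderiv ℝ φ z (0, 1)
  have mx : MemLp px 2 volume := (hφd _).continuous.memLp_of_hasCompactSupport (hφc _)
  have my : MemLp py 2 volume := (hφd _).continuous.memLp_of_hasCompactSupport (hφc _)
  have hz : ∀ z ∉ D, φ z = 0 := fun z hz => image_eq_zero_of_notMem_tsupport fun h => hz (hs h)
  have hw : ∀ t : ℝ, ∀ v, HasWeakDeriv univ v (fun z => t * φ z) fun z => t * fderiv ℝ φ z v := by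
    intro t v
    have := hasWeakDeriv_of_contDiffOn (f := fun z => t * φ z) isOpen_univ
      ((contDiff_const.mul hφ).of_le (by exact_mod_cast le_top)).contDiffOn v
    convert this using 2 with z
    rw [fderiv_const_mul (hφ.differentiable (by simp) z)]; rfl
  let ψt : ℝ → ℝ × ℝ → ℝ := fun t z => ψ z + t * φ z
  have wx : ∀ t, HasWeakDeriv univ (1, 0) (ψt t) fun z => wdx ψ z + t * px z :=
    fun t => hA.hasWeakDeriv_wdx.add (hw t _)
  have wy : ∀ t, HasWeakDeriv univ (0, 1) (ψt t) fun z => wdy ψ z + t * py z :=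
    fun t => hA.hasWeakDeriv_wdy.add (hw t _)
  have ex : ∀ t, wdx (ψt t) =ᵐ[volume] fun z => wdx ψ z + t * px z := fun t =>
    (wx t).weakDeriv_ae_eq
  have ey : ∀ t, wdy (ψt t) =ᵐ[volume] fun z => wdy ψ z + t * py z := fun t =>
    (wy t).weakDeriv_ae_eq
  have i1 : IntegrableOn (fun z => wdx ψ z * px z) D := hA.memLp_wdx.integrable_mul (mx.restrict D)
  have i2 : IntegrableOn (fun z => (wdy ψ z - 1) * py z) D :=
    hA.memLp_wdy_sub_one.integrable_mul (my.restrict D)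
  have i3 : IntegrableOn (fun z => px z ^ 2) D := (mx.restrict D).integrable_sq
  have i4 : IntegrableOn (fun z => py z ^ 2) D := (my.restrict D).integrable_sq
  have ee : ∀ t, (fun z => wdx (ψt t) z ^ 2 + (wdy (ψt t) z - 1) ^ 2) =ᵐ[volume.restrict D]
      fun z => ((wdx ψ z ^ 2 + (wdy ψ z - 1) ^ 2) +
        2 * t * (wdx ψ z * px z + (wdy ψ z - 1) * py z)) + t ^ 2 * (px z ^ 2 + py z ^ 2) := by
    intro t
    filter_upwards [ae_restrict_of_ae (ex t), ae_restrict_of_ae (ey t)] with z h1 h2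
    rw [h1, h2]; ring
  have j1 : ∀ t : ℝ, IntegrableOn (fun z => 2 * t * (wdx ψ z * px z + (wdy ψ z - 1) * py z)) D :=
    fun t => (i1.add i2).const_mul _
  have j2 : ∀ t : ℝ, IntegrableOn (fun z => t ^ 2 * (px z ^ 2 + py z ^ 2)) D :=
    fun t => (i3.add i4).const_mul _
  have hadm : ∀ t, Admissible m (ψt t) ζ := by
    intro t
    refine ⟨hA.1, hA.2, hA.3, hA.4, hA.5, hA.6, ?_, ?_, ⟨_, wx t⟩, ⟨_, wy t⟩, ?_⟩
    · intro x y hy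
      have : φ (x, y) = 0 := hz _ fun h => absurd h.1 (not_lt.2 hy)
      simp only [ψt, this, hA.bottom x y hy]; simp
    · intro x y hy
      have : φ (x, y) = 0 := hz _ fun h => absurd h.2 (not_lt.2 hy)
      simp only [ψt, this, hA.surface x y hy]; simp
    · exact ((hA.finite_energy.add (j1 t)).add (j2 t)).congr (ee t).symm
  set L := ∫ z in D, (wdx ψ z * px z + (wdy ψ z - 1) * py z) with hL
  set C := ∫ z in D, (px z ^ 2 + py z ^ 2)
  have hE : ∀ t, excessEnergy (ψt t) ζ = excessEnergy ψ ζ + 2 * t * L + t ^ 2 * C := by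
    intro t
    unfold excessEnergy
    have fe : IntegrableOn (fun z => wdx ψ z ^ 2 + (wdy ψ z - 1) ^ 2) D := hA.finite_energy
    have j0 : IntegrableOn (fun z => (wdx ψ z ^ 2 + (wdy ψ z - 1) ^ 2) +
        2 * t * (wdx ψ z * px z + (wdy ψ z - 1) * py z)) D := fe.add (j1 t)
    rw [integral_congr_ae (ee t), integral_add j0 (j2 t), integral_add fe (j1 t),
      integral_const_mul, integral_const_mul]
  -- The surface is unchanged and the gradient moves by `t ∇φ`, so for small `t` the competitors are
  -- within `δ`.
  have hdist : Tendsto (fun t => pairDist ψ ζ (ψt t) ζ) (𝓝 0) (𝓝 0) := by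
    have e : ∀ t, pairDist ψ ζ (ψt t) ζ = ‖t‖ₑ * eLpNorm px 2 volume + ‖t‖ₑ * eLpNorm py 2 volume := by
      intro t
      unfold pairDist
      have a1 : eLpNorm (fun z => wdx (ψt t) z - wdx ψ z) 2 volume = ‖t‖ₑ * eLpNorm px 2 volume := by
        rw [← eLpNorm_const_smul]
        refine eLpNorm_congr_ae ?_
        filter_upwards [ex t] with z hz
        rw [hz]; simp
      have a2 : eLpNorm (fun z => wdy (ψt t) z - wdy ψ z) 2 volume = ‖t‖ₑ * eLpNorm py 2 volume := by
        rw [← eLpNorm_const_smul]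
        refine eLpNorm_congr_ae ?_
        filter_upwards [ey t] with z hz
        rw [hz]; simp
      rw [a1, a2]; simp
    simp_rw [e]
    have h0 : Tendsto (fun t : ℝ => ‖t‖ₑ) (𝓝 0) (𝓝 0) := by
      simpa using (continuous_enorm (E := ℝ)).tendsto 0
    have h1 := ENNReal.Tendsto.mul_const (b := eLpNorm px 2 volume) h0 (Or.inr mx.eLpNorm_ne_top)
    have h2 := ENNReal.Tendsto.mul_const (b := eLpNorm py 2 volume) h0 (Or.inr my.eLpNorm_ne_top)
    simpa using h1.add h2
  have hL0 : 2 * L = 0 := by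
    refine eq_zero_of_eventually_nonneg (C := C) ?_
    filter_upwards [hdist.eventually (gt_mem_nhds hδ)] with t ht
    have h1 := h.le_excessEnergy (hadm t) ht.le
    rw [hE, ← h.excessEnergy_eq] at h1
    linarith
  have hL1 : L = 0 := by linarith
  have i5 : Integrable fun z => wdx ψ z * px z :=
    integrable_mul_test hA.hasWeakDeriv_wdx.2 (hφd _).continuous (hφc _) (subset_univ _)
  have i6 : Integrable fun z => wdy ψ z * py z :=
    integrable_mul_test hA.hasWeakDeriv_wdy.2 (hφd _).continuous (hφc _) (subset_univ _)
  have i7 : Integrable py := (hφd _).continuous.integrable_of_hasCompactSupport (hφc _)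
  -- This removes the `-1` in `ψ_y - 1` from the first variation.
  have hpy : ∫ z, py z = 0 := by
    have h1 := (hasWeakDeriv_of_contDiffOn (f := fun _ => (1 : ℝ)) isOpen_univ contDiffOn_const
      ((0 : ℝ), (1 : ℝ))).3 φ hφ hc (subset_univ _)
    simpa using h1
  have hL2 : (∫ z, wdx ψ z * px z) + ∫ z, wdy ψ z * py z = 0 := by
    rw [hL, integral_add i1 i2, integral_mul_eq_of_tsupport_subset (hφs _),
      integral_mul_eq_of_tsupport_subset (hφs _)] at hL1
    simp_rw [sub_mul, one_mul] at hL1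
    rw [integral_sub i6 i7, hpy] at hL1
    linarith
  -- Using `φ_x` and `φ_y` themselves as test functions moves the remaining derivatives off `ψ`.
  have k1 := hA.hasWeakDeriv_wdx.3 px (hφd _) (hφc _) (subset_univ _)
  have k2 := hA.hasWeakDeriv_wdy.3 py (hφd _) (hφc _) (subset_univ _)
  have i8 : Integrable fun z => ψ z * fderiv ℝ px z (1, 0) :=
    integrable_mul_test hA.hasWeakDeriv_wdx.1 (contDiff_fderiv_apply (hφd _) _).continuous
      (hasCompactSupport_fderiv_apply (hφc _) _) (subset_univ _)
  have i9 : Integrable fun z => ψ z * fderiv ℝ py z (0, 1) :=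
    integrable_mul_test hA.hasWeakDeriv_wdx.1 (contDiff_fderiv_apply (hφd _) _).continuous
      (hasCompactSupport_fderiv_apply (hφc _) _) (subset_univ _)
  unfold planeLaplacian
  simp_rw [mul_add]
  rw [integral_add i8 i9, k1, k2]
  linarith

end Variation

/-! ### Continuity of vertical stretching in `L²`. -/

theorem half_le_one_add {t W s : ℝ} (hs : |s| ≤ W) (ht : |t| * W ≤ 1 / 2) :
    1 / 2 ≤ 1 + t * s ∧ 1 + t * s ≤ 3 / 2 := by
  have h1 : |t * s| ≤ 1 / 2 := by
    rw [abs_mul]; exact (mul_le_mul_of_nonneg_left hs (abs_nonneg t)).trans ht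
  have := abs_le.1 h1
  constructor <;> linarith

theorem eventually_abs_mul_le (W : ℝ) {ε : ℝ} (hε : 0 < ε) : ∀ᶠ t in 𝓝 (0 : ℝ), |t| * W ≤ ε := by
  have : Tendsto (fun t : ℝ => |t| * W) (𝓝 0) (𝓝 (|0| * W)) :=
    (continuous_abs.mul continuous_const).tendsto 0
  simp only [abs_zero, zero_mul] at this
  exact (this.eventually (gt_mem_nhds hε)).mono fun t ht => ht.le

theorem tendsto_eLpNorm_comp_shrink_sub_of_continuous {w : ℝ → ℝ} {W : ℝ}
    (hW : ∀ x, |w x| ≤ W) {k : ℝ × ℝ → ℝ} (hk : Continuous k) (hkc : HasCompactSupport k) :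
    Tendsto (fun t : ℝ => eLpNorm (fun z => k (shrink (fun x => 1 + t * w x) z) - k z) 2 volume)
      (𝓝 0) (𝓝 0) := by
  have hW0 : 0 ≤ W := (abs_nonneg _).trans (hW 0)
  obtain ⟨R, hR0, hR⟩ : ∃ R : ℝ, 0 < R ∧ tsupport k ⊆ Metric.closedBall 0 R := by
    obtain ⟨R, hR⟩ := hkc.isCompact.isBounded.subset_closedBall 0
    exact ⟨max R 1, by positivity, hR.trans (Metric.closedBall_subset_closedBall (le_max_left _ _))⟩
  -- The stretching factors are at most `3/2`, so a point outside radius `2R` stays outside radius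
  -- `R` when shrunk, and the difference vanishes off `B`.
  set B : Set (ℝ × ℝ) := Metric.closedBall 0 (2 * R)
  set V : ℝ≥0∞ := volume B ^ (2 : ℝ≥0∞).toReal⁻¹
  have hV : V ≠ ⊤ := ENNReal.rpow_ne_top_of_nonneg (by simp)
    (isCompact_closedBall _ _).measure_lt_top.ne
  rw [ENNReal.tendsto_nhds_zero]
  intro ε hε
  obtain ⟨η, hη0, hη⟩ : ∃ η : ℝ, 0 < η ∧ V * ENNReal.ofReal η ≤ ε := by
    have h1 : Tendsto (fun η : ℝ => V * ENNReal.ofReal η) (𝓝 0) (𝓝 (V * ENNReal.ofReal 0)) :=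
      ENNReal.Tendsto.const_mul (ENNReal.continuous_ofReal.tendsto 0) (Or.inr hV)
    simp only [ENNReal.ofReal_zero, mul_zero] at h1
    have h2 := (h1.mono_left (nhdsWithin_le_nhds (s := Ioi 0))).eventually (gt_mem_nhds hε)
    obtain ⟨η, h3, h4⟩ := (h2.and self_mem_nhdsWithin).exists
    exact ⟨η, h4, h3.le⟩
  obtain ⟨r, hr0, hr⟩ := Metric.uniformContinuous_iff.1
    (hkc.uniformContinuous_of_continuous hk) η hη0
  -- On `B` a point moves by at most `2R |t| W / (1/2) = 4R W |t|`, which the second condition keeps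
  -- below the modulus `r` of uniform continuity.
  filter_upwards [eventually_abs_mul_le W (show (0 : ℝ) < 1 / 2 by norm_num),
    eventually_abs_mul_le (4 * R * W) (half_pos hr0)] with t ht1 ht2
  set J : ℝ → ℝ := fun x => 1 + t * w x
  have hJ := fun x => half_le_one_add (hW x) ht1
  have hz : ∀ z ∉ Metric.closedBall (0 : ℝ × ℝ) R, k z = 0 := fun z hz =>
    image_eq_zero_of_notMem_tsupport fun h => hz (hR h)
  have hsupp : Function.support (fun z => k (shrink J z) - k z) ⊆ B := by
    intro z hzB
    by_contra hB
    apply hzB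
    have hB' : 2 * R < max |z.1| |z.2| := by
      by_contra h
      exact hB (by rw [mem_closedBall_zero_iff, Prod.norm_def]; exact not_lt.1 h)
    have h1 : z ∉ Metric.closedBall (0 : ℝ × ℝ) R := by
      rw [mem_closedBall_zero_iff, Prod.norm_def, not_le]
      simp only [Real.norm_eq_abs]; linarith
    have h2 : shrink J z ∉ Metric.closedBall (0 : ℝ × ℝ) R := by
      rw [mem_closedBall_zero_iff, Prod.norm_def, not_le]
      simp only [Real.norm_eq_abs, shrink]
      have hJ1 := hJ z.1
      rw [abs_div, abs_of_pos (show 0 < J z.1 by show 0 < 1 + t * w z.1; linarith)]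
      rcases lt_max_iff.1 hB' with h | h
      · exact lt_max_of_lt_left (by linarith)
      · refine lt_max_of_lt_right ?_
        rw [lt_div_iff₀ (by show 0 < 1 + t * w z.1; linarith)]
        show R * (1 + t * w z.1) < |z.2|
        nlinarith
    simp only [hz _ h1, hz _ h2, sub_zero]
  rw [← eLpNorm_restrict_eq_of_support_subset hsupp]
  refine (eLpNorm_le_of_ae_bound (C := η) ?_).trans ?_
  · refine (ae_restrict_iff' Metric.isClosed_closedBall.measurableSet).2
      (Eventually.of_forall fun z hzB => ?_)
    refine (hr ?_).le
    have hz2 : |z.2| ≤ 2 * R := by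
      have : ‖z‖ ≤ 2 * R := by simpa [B] using hzB
      exact (le_max_right |z.1| |z.2|).trans this
    have hJ1 := hJ z.1
    have hJp : 0 < 1 + t * w z.1 := by linarith
    rw [Prod.dist_eq, max_lt_iff]
    constructor
    · simpa [shrink] using hr0
    · simp only [shrink, Real.dist_eq, J]
      have e : z.2 / (1 + t * w z.1) - z.2 = - (z.2 * (t * w z.1)) / (1 + t * w z.1) := by
        field_simp; ring
      rw [e, abs_div, abs_neg, abs_mul, abs_mul, abs_of_pos hJp, div_lt_iff₀ hJp]
      have h3 : |t| * |w z.1| ≤ |t| * W := mul_le_mul_of_nonneg_left (hW _) (abs_nonneg _)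
      have h4 : |z.2| * (|t| * |w z.1|) ≤ 2 * R * (|t| * W) :=
        mul_le_mul hz2 h3 (by positivity) (by positivity)
      nlinarith
  · rw [Measure.restrict_apply_univ]; exact hη

/-- Stretching vertical lines by factors close to `1` is continuous in `L²`. -/
theorem tendsto_eLpNorm_comp_shrink_sub {w : ℝ → ℝ} (hw : Continuous w) {W : ℝ}
    (hW : ∀ x, |w x| ≤ W) {f : ℝ × ℝ → ℝ} (hf : MemLp f 2 volume) :
    Tendsto (fun t : ℝ => eLpNorm (fun z => f (shrink (fun x => 1 + t * w x) z) - f z) 2 volume)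
      (𝓝 0) (𝓝 0) := by
  rw [ENNReal.tendsto_nhds_zero]
  intro ε hε
  have hε4 : ε / 4 ≠ 0 := (ENNReal.div_pos hε.ne' (by norm_num)).ne'
  -- Four quarters of `ε` are spent: two on the composed error, because composition can double the
  -- norm, one on the error itself and one on `k`.
  obtain ⟨k, hkc, hk, hkcont, hkL⟩ := hf.exists_hasCompactSupport_eLpNorm_sub_le
    (by norm_num) hε4
  have h1 := ENNReal.tendsto_nhds_zero.1
    (tendsto_eLpNorm_comp_shrink_sub_of_continuous hW hkcont hkc) (ε / 4) (pos_iff_ne_zero.2 hε4)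
  filter_upwards [h1, eventually_abs_mul_le W (show (0 : ℝ) < 1 / 2 by norm_num)] with t ht1 ht2
  set J : ℝ → ℝ := fun x => 1 + t * w x
  have hJ := fun x => half_le_one_add (hW x) ht2
  have hJ0 : ∀ x, 0 < J x := fun x => by have := (hJ x).1; show 0 < 1 + t * w x; linarith
  have hJ2 : ∀ x, J x ≤ 2 := fun x => by have := (hJ x).2; show 1 + t * w x ≤ 2; linarith
  have hJc : Continuous J := by fun_prop
  have e : (fun z => f (shrink J z) - f z) = (fun z => (f - k) (shrink J z)) +
      ((fun z => k (shrink J z) - k z) + fun z => - (f - k) z) := by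
    ext z; simp
  have hq : Measure.QuasiMeasurePreserving (shrink J) volume volume := by
    refine ⟨(continuous_shrink hJc hJ0).measurable, ?_⟩
    rw [map_shrink_volume hJc hJ0]
    exact withDensity_absolutelyContinuous _ _
  have m1 : AEStronglyMeasurable (f - k) volume :=
    hf.aestronglyMeasurable.sub hkcont.aestronglyMeasurable
  have m2 : AEStronglyMeasurable (fun z => (f - k) (shrink J z)) volume :=
    m1.comp_quasiMeasurePreserving hq
  have m3 : AEStronglyMeasurable (fun z => k (shrink J z) - k z) volume :=
    ((hkcont.comp (continuous_shrink hJc hJ0)).sub hkcont).aestronglyMeasurable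
  rw [e]
  refine (eLpNorm_add_le m2 (m3.add m1.neg) (by norm_num)).trans ?_
  refine (add_le_add_right (eLpNorm_add_le m3 m1.neg (by norm_num)) _).trans ?_
  have n1 := (eLpNorm_comp_shrink_le hJc hJ0 hJ2 (f - k)).trans (mul_le_mul_right hk 2)
  have n2 : eLpNorm (-(f - k)) 2 volume ≤ ε / 4 := by rw [eLpNorm_neg]; exact hk
  refine (add_le_add n1 (add_le_add ht1 n2)).trans (le_of_eq ?_)
  rw [show 2 * (ε / 4) + (ε / 4 + ε / 4) = 4 * (ε / 4) by ring]
  exact ENNReal.mul_div_cancel (by norm_num) (by norm_num)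

/-! ### Stretched competitors: energy, admissibility, distance, first variation. -/

section Stretching

variable {m lam : ℝ} {δ : ℝ≥0∞} {ψ : ℝ × ℝ → ℝ} {ζ : ℝ → ℝ}

theorem memLp_of_restrict {D : Set (ℝ × ℝ)} (hD : MeasurableSet D) {g : ℝ × ℝ → ℝ}
    (hg : MemLp g 2 (volume.restrict D)) (h0 : ∀ᵐ z, z ∉ D → g z = 0) : MemLp g 2 volume := by
  refine ((memLp_indicator_iff_restrict hD).2 hg).ae_eq ?_
  filter_upwards [h0] with z hz
  by_cases h : z ∈ D
  · rw [indicator_of_mem h]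
  · rw [indicator_of_notMem h, hz h]

theorem memLp_bounded_mul {μ : Measure (ℝ × ℝ)} {b g : ℝ × ℝ → ℝ} {C : ℝ} (hg : MemLp g 2 μ)
    (hb : AEStronglyMeasurable b μ) (hC : ∀ᵐ z ∂μ, |b z| ≤ C) : MemLp (fun z => b z * g z) 2 μ := by
  refine hg.of_le_mul (c := C) (hb.mul hg.1) ?_
  filter_upwards [hC] with z hz
  rw [norm_mul]
  exact mul_le_mul_of_nonneg_right hz (norm_nonneg _)

theorem measurableSet_cylinder {K : Set ℝ} (hK : IsCompact K) :
    MeasurableSet (Prod.fst ⁻¹' K : Set (ℝ × ℝ)) := measurable_fst hK.measurableSet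

theorem exists_depth_bound (hζ : Continuous ζ) {K : Set ℝ} (hK : IsCompact K) :
    ∃ M : ℝ, 0 ≤ M ∧ ∀ x ∈ K, 1 + ζ x ≤ M := by
  obtain ⟨M, hM⟩ := (hK.image (f := fun x => 1 + ζ x) (by fun_prop)).bddAbove
  exact ⟨max M 0, le_max_right _ _, fun x hx => (hM (mem_image_of_mem _ hx)).trans (le_max_left _ _)⟩

theorem memLp_cylinder_one (hζ : Continuous ζ) {K : Set ℝ} (hK : IsCompact K) :
    MemLp ((Prod.fst ⁻¹' K).indicator fun _ : ℝ × ℝ => (1 : ℝ)) 2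
      (volume.restrict (fluidDomain ζ)) := by
  refine memLp_indicator_const 2 (measurableSet_cylinder hK) 1 (Or.inr ?_)
  obtain ⟨M, -, hM⟩ := exists_depth_bound hζ hK
  rw [Measure.restrict_apply (measurableSet_cylinder hK)]
  have : (Prod.fst ⁻¹' K) ∩ fluidDomain ζ ⊆ K ×ˢ Icc 0 M := fun z hz =>
    ⟨hz.1, hz.2.1.le, hz.2.2.le.trans (hM _ hz.1)⟩
  exact ((measure_mono this).trans_lt (hK.prod isCompact_Icc).measure_lt_top).ne

/-- Only `ψ_y - 1` is known to be square integrable over the whole fluid domain. Over a compact set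
of abscissae the domain has finite area and the constant `1` can be added back; this is where
compact support of `w` pays. -/
theorem Admissible.memLp_cylinder_wdy (h : Admissible m ψ ζ) {K : Set ℝ} (hK : IsCompact K) :
    MemLp ((Prod.fst ⁻¹' K).indicator (wdy ψ)) 2 volume := by
  refine memLp_of_restrict (isOpen_fluidDomain h.continuous_surface).measurableSet ?_ ?_
  · have := (h.memLp_wdy_sub_one.indicator (measurableSet_cylinder hK)).add
      (memLp_cylinder_one h.continuous_surface hK)
    refine this.ae_eq (Eventually.of_forall fun z => ?_)
    by_cases hz : z ∈ (Prod.fst ⁻¹' K : Set (ℝ × ℝ))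
    · simp only [Pi.add_apply, indicator_of_mem hz]; ring
    · simp only [Pi.add_apply, indicator_of_notMem hz]; ring
  · filter_upwards [h.wdy_off] with z hz hzD
    by_cases hz' : z ∈ (Prod.fst ⁻¹' K : Set (ℝ × ℝ))
    · rw [indicator_of_mem hz', hz hzD]
    · rw [indicator_of_notMem hz']

theorem Admissible.memLp_cylinder_wdx (h : Admissible m ψ ζ) {K : Set ℝ} (hK : IsCompact K) :
    MemLp ((Prod.fst ⁻¹' K).indicator (wdx ψ)) 2 volume :=
  (memLp_of_restrict (isOpen_fluidDomain h.continuous_surface).measurableSet h.memLp_wdx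
    h.wdx_off).indicator (measurableSet_cylinder hK)

/-- The stream function after stretching vertical lines by the factors `1 + t w(x)`. -/
noncomputable def stretchedStream (ψ : ℝ × ℝ → ℝ) (w : ℝ → ℝ) (t : ℝ) (z : ℝ × ℝ) : ℝ :=
  ψ (shrink (fun x => 1 + t * w x) z)

/-- The surface after stretching vertical lines by the factors `1 + t w(x)`. -/
def stretchedSurface (ζ : ℝ → ℝ) (w : ℝ → ℝ) (t x : ℝ) : ℝ := ζ x + t * (w x * (1 + ζ x))

/-- The first variation of the Dirichlet energy under stretching of vertical lines. -/
noncomputable def stretchingVariation (ψ : ℝ × ℝ → ℝ) (w : ℝ → ℝ) (z : ℝ × ℝ) : ℝ :=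
  w z.1 * wdx ψ z ^ 2 - 2 * (deriv w z.1 * z.2) * wdx ψ z * wdy ψ z - w z.1 * wdy ψ z ^ 2

/-- A common majorant of the second order terms of the energy under stretching. -/
noncomputable def stretchingRemainder (ψ : ℝ × ℝ → ℝ) (w : ℝ → ℝ) (z : ℝ × ℝ) : ℝ :=
  (deriv w z.1 * z.2 * wdy ψ z) ^ 2 + (w z.1 * wdy ψ z) ^ 2

section

variable {w : ℝ → ℝ}

theorem shrink_mem_fluidDomain_iff {t : ℝ} (hJ : ∀ x, 0 < 1 + t * w x) (z : ℝ × ℝ) :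
    shrink (fun x => 1 + t * w x) z ∈ fluidDomain ζ ↔ z ∈ fluidDomain (stretchedSurface ζ w t) := by
  simp only [fluidDomain, shrink, mem_ofPred_eq, stretchedSurface]
  rw [div_lt_iff₀ (hJ z.1), lt_div_iff₀ (hJ z.1), zero_mul]
  have : (1 + ζ z.1) * (1 + t * w z.1) = 1 + (ζ z.1 + t * (w z.1 * (1 + ζ z.1))) := by ring
  rw [this]

theorem contDiff_one_add_mul (hw : ContDiff ℝ ∞ w) (t : ℝ) :
    ContDiff ℝ ∞ fun x => 1 + t * w x := by fun_prop

theorem deriv_one_add_mul (hw : ContDiff ℝ ∞ w) (t x : ℝ) :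
    deriv (fun x => 1 + t * w x) x = t * deriv w x := by
  have : DifferentiableAt ℝ w x := hw.differentiable (by simp) x
  simp [deriv_const_mul _ this]

theorem Admissible.wdy_stretchedStream (h : Admissible m ψ ζ) (hw : ContDiff ℝ ∞ w) {t : ℝ}
    (hJ : ∀ x, 0 < 1 + t * w x) :
    HasWeakDeriv univ (0, 1) (stretchedStream ψ w t)
      fun z => (fun v : ℝ × ℝ => wdy ψ v / (1 + t * w v.1)) (shrink (fun x => 1 + t * w x) z) :=
  h.hasWeakDeriv_wdy.comp_shrink_snd (contDiff_one_add_mul hw t) hJ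

theorem Admissible.wdx_stretchedStream (h : Admissible m ψ ζ) (hw : ContDiff ℝ ∞ w) {t : ℝ}
    (hJ : ∀ x, 0 < 1 + t * w x) :
    HasWeakDeriv univ (1, 0) (stretchedStream ψ w t)
      fun z => (fun v : ℝ × ℝ => wdx ψ v - t * (deriv w v.1 * v.2 * wdy ψ v) / (1 + t * w v.1))
        (shrink (fun x => 1 + t * w x) z) := by
  have := h.hasWeakDeriv_wdx.comp_shrink_fst (contDiff_one_add_mul hw t) hJ h.hasWeakDeriv_wdy
  refine this.congr isOpen_univ (Eventually.of_forall fun _ _ => rfl)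
    (Eventually.of_forall fun z _ => ?_)
  simp only
  rw [deriv_one_add_mul hw]; ring

theorem Admissible.memLp_mul_wdy (h : Admissible m ψ ζ) {b : ℝ → ℝ} (hb : Continuous b)
    (hc : HasCompactSupport b) : MemLp (fun z => b z.1 * wdy ψ z) 2 volume := by
  obtain ⟨C, hC⟩ := hb.bounded_above_of_compact_support hc
  have h1 := memLp_bounded_mul (b := fun z : ℝ × ℝ => b z.1) (h.memLp_cylinder_wdy hc)
    (by fun_prop) (Eventually.of_forall fun z => hC z.1)
  refine h1.ae_eq (Eventually.of_forall fun z => ?_)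
  by_cases hz : z ∈ (Prod.fst ⁻¹' (tsupport b) : Set (ℝ × ℝ))
  · simp only [indicator_of_mem hz]
  · simp only [indicator_of_notMem hz]
    rw [image_eq_zero_of_notMem_tsupport (f := b) hz]; simp

/-- The unbounded factor `y` matters only where `ψ_y` does not vanish and `b` is supported, and
there it is at most the depth. -/
theorem Admissible.memLp_mul_snd_mul_wdy (h : Admissible m ψ ζ) {b : ℝ → ℝ} (hb : Continuous b)
    (hc : HasCompactSupport b) : MemLp (fun z => b z.1 * z.2 * wdy ψ z) 2 volume := by
  obtain ⟨M, hM0, hM⟩ := exists_depth_bound h.continuous_surface hc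
  refine (h.memLp_mul_wdy hb hc).of_le_mul (c := M)
    (AEStronglyMeasurable.mul (by fun_prop) h.aestronglyMeasurable_wdy) ?_
  filter_upwards [h.wdy_off] with z hz
  by_cases hzD : z ∈ fluidDomain ζ
  · by_cases hzK : z.1 ∈ tsupport b
    · have h1 : |z.2| ≤ M := by
        rw [abs_of_pos hzD.1]; exact hzD.2.le.trans (hM _ hzK)
      simp only [norm_mul, Real.norm_eq_abs]
      have := mul_le_mul_of_nonneg_right h1 (mul_nonneg (abs_nonneg (b z.1)) (abs_nonneg (wdy ψ z)))
      nlinarith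
    · simp [image_eq_zero_of_notMem_tsupport hzK]
  · simp [hz hzD]

theorem Admissible.integrableOn_stretchingVariation (h : Admissible m ψ ζ) (hw : ContDiff ℝ ∞ w)
    (hc : HasCompactSupport w) :
    IntegrableOn (stretchingVariation ψ w) (fluidDomain ζ) := by
  have hw' : Continuous (deriv w) := (hw.of_le (m := 1) (by exact_mod_cast le_top)).continuous_deriv le_rfl
  obtain ⟨C, hC⟩ := hw.continuous.bounded_above_of_compact_support hc
  have m1 := memLp_bounded_mul (b := fun z : ℝ × ℝ => w z.1) h.memLp_wdx
    (hw.continuous.comp continuous_fst).aestronglyMeasurable (Eventually.of_forall fun z => hC z.1)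
  have m2 := (h.memLp_mul_snd_mul_wdy hw' hc.deriv).restrict (fluidDomain ζ)
  have m3 := (h.memLp_mul_wdy hw.continuous hc).restrict (fluidDomain ζ)
  -- The second factor `ψ_y` must be localized as well to be square integrable; the indicator is
  -- harmless since `w` vanishes outside it.
  have m4 := (h.memLp_cylinder_wdy hc).restrict (fluidDomain ζ)
  have i1 : IntegrableOn (fun z => w z.1 * wdx ψ z * wdx ψ z) (fluidDomain ζ) :=
    m1.integrable_mul h.memLp_wdx
  have i2 : IntegrableOn (fun z => deriv w z.1 * z.2 * wdy ψ z * wdx ψ z) (fluidDomain ζ) :=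
    m2.integrable_mul h.memLp_wdx
  have i3 : IntegrableOn (fun z => w z.1 * wdy ψ z * (Prod.fst ⁻¹' tsupport w).indicator (wdy ψ) z)
      (fluidDomain ζ) := m3.integrable_mul m4
  refine ((i1.sub (i2.const_mul 2)).sub i3).congr (Eventually.of_forall fun z => ?_)
  simp only [Pi.sub_apply, stretchingVariation]
  by_cases hz : z ∈ (Prod.fst ⁻¹' (tsupport w) : Set (ℝ × ℝ))
  · rw [indicator_of_mem hz]; ring
  · rw [image_eq_zero_of_notMem_tsupport (f := w) hz]; ring

theorem Admissible.integrableOn_stretchingRemainder (h : Admissible m ψ ζ) (hw : ContDiff ℝ ∞ w)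
    (hc : HasCompactSupport w) :
    IntegrableOn (stretchingRemainder ψ w) (fluidDomain ζ) := by
  have hw' : Continuous (deriv w) := (hw.of_le (m := 1) (by exact_mod_cast le_top)).continuous_deriv le_rfl
  have m2 := (h.memLp_mul_snd_mul_wdy hw' hc.deriv).restrict (fluidDomain ζ)
  have m3 := (h.memLp_mul_wdy hw.continuous hc).restrict (fluidDomain ζ)
  exact m2.integrable_sq.add m3.integrable_sq

theorem integrableOn_comp_fst (hζ : Continuous ζ) {b : ℝ → ℝ} (hb : Continuous b)
    (hc : HasCompactSupport b) : IntegrableOn (fun z : ℝ × ℝ => b z.1) (fluidDomain ζ) := by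
  obtain ⟨C, hC⟩ := hb.bounded_above_of_compact_support hc
  have m1 := memLp_cylinder_one hζ hc
  have m2 := memLp_bounded_mul (b := fun z : ℝ × ℝ => b z.1) m1
    (hb.comp continuous_fst).aestronglyMeasurable (Eventually.of_forall fun z => hC z.1)
  refine (m2.integrable_mul m1).congr (Eventually.of_forall fun z => ?_)
  by_cases hz : z ∈ (Prod.fst ⁻¹' (tsupport b) : Set (ℝ × ℝ))
  · simp [indicator_of_mem hz]
  · simp [image_eq_zero_of_notMem_tsupport (f := b) hz]

theorem Admissible.setIntegral_comp_fst (h : Admissible m ψ ζ) {b : ℝ → ℝ} (hb : Continuous b)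
    (hc : HasCompactSupport b) :
    ∫ z in fluidDomain ζ, b z.1 = ∫ x, b x * (1 + ζ x) := by
  rw [setIntegral_fluidDomain h.continuous_surface
    (integrableOn_comp_fst h.continuous_surface hb hc)]
  congr 1; ext x
  simp [(h.depth_pos x).le]; ring

/-- The energy of a stretched pair. -/
theorem Admissible.stretched_energy (h : Admissible m ψ ζ) (hw : ContDiff ℝ ∞ w)
    (hc : HasCompactSupport w) (h0 : ∫ x, w x * (1 + ζ x) = 0) {t : ℝ}
    (hJ : ∀ x, 1 / 2 ≤ 1 + t * w x) :
    IntegrableOn (fun z => wdx (stretchedStream ψ w t) z ^ 2 +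
        (wdy (stretchedStream ψ w t) z - 1) ^ 2) (fluidDomain (stretchedSurface ζ w t)) ∧
      excessEnergy (stretchedStream ψ w t) (stretchedSurface ζ w t) ≤
        excessEnergy ψ ζ + t * (∫ z in fluidDomain ζ, stretchingVariation ψ w z) +
          2 * (∫ z in fluidDomain ζ, stretchingRemainder ψ w z) * t ^ 2 := by
  have hJ0 : ∀ x, 0 < 1 + t * w x := fun x => by linarith [hJ x]
  set J : ℝ → ℝ := fun x => 1 + t * w x with hJdef
  have hJc : Continuous J := (contDiff_one_add_mul hw t).continuous
  set D := fluidDomain ζ with hD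
  have hDm : MeasurableSet D := (isOpen_fluidDomain h.continuous_surface).measurableSet
  set D' := fluidDomain (stretchedSurface ζ w t) with hD'
  have hD'm : MeasurableSet D' := by
    refine (isOpen_fluidDomain ?_).measurableSet
    have := h.continuous_surface
    have := hw.continuous
    unfold stretchedSurface; fun_prop
  let G : ℝ × ℝ → ℝ := fun z =>
    (wdx ψ z - t * (deriv w z.1 * z.2 * wdy ψ z) / J z.1) ^ 2 + (wdy ψ z / J z.1 - 1) ^ 2
  let r : ℝ × ℝ → ℝ := fun z => (J z.1)⁻¹ * stretchingRemainder ψ w z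
  have hr0 : ∀ z, 0 ≤ stretchingRemainder ψ w z := fun z => by
    unfold stretchingRemainder; positivity
  have iR := h.integrableOn_stretchingRemainder hw hc
  have ir : IntegrableOn r D := by
    refine (iR.const_mul 2).mono' (AEStronglyMeasurable.mul
      (Continuous.aestronglyMeasurable (Continuous.inv₀ (f := fun z : ℝ × ℝ => J z.1) (by fun_prop)
        fun z => (hJ0 z.1).ne')) iR.1) (Eventually.of_forall fun z => ?_)
    rw [Real.norm_of_nonneg (mul_nonneg (inv_nonneg.2 (hJ0 z.1).le) (hr0 z))]
    refine mul_le_mul_of_nonneg_right ?_ (hr0 z)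
    rw [inv_le_comm₀ (hJ0 z.1) (by norm_num)]
    have := hJ z.1
    norm_num at this ⊢; exact this
  have fe : IntegrableOn (fun z => wdx ψ z ^ 2 + (wdy ψ z - 1) ^ 2) D := h.finite_energy
  have iV : IntegrableOn (fun z => t * stretchingVariation ψ w z) D :=
    (h.integrableOn_stretchingVariation hw hc).const_mul t
  have iW : IntegrableOn (fun z : ℝ × ℝ => t * w z.1) D :=
    (integrableOn_comp_fst h.continuous_surface hw.continuous hc).const_mul t
  have iT : IntegrableOn (fun z => t ^ 2 * r z) D := ir.const_mul _
  have i1 : IntegrableOn (fun z => (wdx ψ z ^ 2 + (wdy ψ z - 1) ^ 2) +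
      t * stretchingVariation ψ w z) D := fe.add iV
  have i2 : IntegrableOn (fun z => (wdx ψ z ^ 2 + (wdy ψ z - 1) ^ 2) +
      t * stretchingVariation ψ w z + t * w z.1) D := i1.add iW
  -- An exact expansion in `t`, with `1 / J` left only in the quadratic remainder. The term `t w`
  -- comes from the Jacobian times the square of the constant `1`, and it integrates to `t ∫ w (1 +
  -- ζ) = 0`.
  have eG : ∀ z, J z.1 * G z = (wdx ψ z ^ 2 + (wdy ψ z - 1) ^ 2) +
      t * stretchingVariation ψ w z + t * w z.1 + t ^ 2 * r z := by
    intro z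
    have := (hJ0 z.1).ne'
    simp only [G, r, stretchingVariation, stretchingRemainder, hJdef]
    field_simp
    ring
  have iG : IntegrableOn (fun z => J z.1 * G z) D := by
    simp_rw [eG]; exact i2.add iT
  have eF : (fun z => wdx (stretchedStream ψ w t) z ^ 2 +
        (wdy (stretchedStream ψ w t) z - 1) ^ 2) =ᵐ[volume] fun z => G (shrink J z) := by
    filter_upwards [(h.wdx_stretchedStream hw hJ0).weakDeriv_ae_eq,
      (h.wdy_stretchedStream hw hJ0).weakDeriv_ae_eq] with z h1 h2
    simp only [wdx, wdy] at h1 h2 ⊢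
    rw [h1, h2]; rfl
  have eI : (fun z => D'.indicator (fun z => G (shrink J z)) z) =
      fun z => D.indicator G (shrink J z) := by
    ext z
    have := shrink_mem_fluidDomain_iff (ζ := ζ) hJ0 z
    by_cases hz : z ∈ D'
    · rw [indicator_of_mem hz, indicator_of_mem (this.2 hz)]
    · rw [indicator_of_notMem hz, indicator_of_notMem fun h' => hz (this.1 h')]
  have eJ : (fun z => J z.1 * D.indicator G z) = D.indicator fun z => J z.1 * G z := by
    ext z
    by_cases hz : z ∈ D
    · rw [indicator_of_mem hz, indicator_of_mem hz]
    · rw [indicator_of_notMem hz, indicator_of_notMem hz, mul_zero]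
  refine ⟨?_, ?_⟩
  · refine IntegrableOn.congr_fun_ae ?_ (EventuallyEq.symm (ae_restrict_of_ae eF))
    rw [← integrable_indicator_iff hD'm]
    have : Integrable fun z => D.indicator G (shrink J z) := by
      rw [integrable_comp_shrink_iff hJc hJ0, eJ, integrable_indicator_iff hDm]
      exact iG
    rw [← eI] at this
    exact this
  · have e1 : excessEnergy (stretchedStream ψ w t) (stretchedSurface ζ w t) =
        ∫ z in D, J z.1 * G z := by
      unfold excessEnergy
      rw [integral_congr_ae (ae_restrict_of_ae eF), ← integral_indicator hD'm]
      have := integral_comp_shrink hJc hJ0 (D.indicator G)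
      rw [eJ, integral_indicator hDm] at this
      rw [← this, ← eI]
    rw [e1]
    simp_rw [eG]
    rw [integral_add i2 iT, integral_add i1 iW, integral_add fe iV, integral_const_mul,
      integral_const_mul, integral_const_mul, h.setIntegral_comp_fst hw.continuous hc, h0, mul_zero,
      add_zero]
    have hrle : ∫ z in D, r z ≤ 2 * ∫ z in D, stretchingRemainder ψ w z := by
      rw [← integral_const_mul]
      refine integral_mono ir (iR.const_mul 2) fun z => ?_
      refine mul_le_mul_of_nonneg_right ?_ (hr0 z)
      rw [inv_le_comm₀ (hJ0 z.1) (by norm_num)]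
      have := hJ z.1
      norm_num at this ⊢; exact this
    unfold excessEnergy
    nlinarith [sq_nonneg t]

end

end Stretching

section Stretching

variable {m lam : ℝ} {δ : ℝ≥0∞} {ψ : ℝ × ℝ → ℝ} {ζ : ℝ → ℝ} {w : ℝ → ℝ}

theorem Admissible.integral_stretchedSurface_sq (h : Admissible m ψ ζ) (hw : Continuous w)
    (hc : HasCompactSupport w) (t : ℝ) :
    Integrable (fun x => stretchedSurface ζ w t x ^ 2) ∧
      ∫ x, stretchedSurface ζ w t x ^ 2 = (∫ x, ζ x ^ 2) +
        2 * t * (∫ x, ζ x * (w x * (1 + ζ x))) + t ^ 2 * ∫ x, (w x * (1 + ζ x)) ^ 2 := by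
  have hζ := h.continuous_surface
  have hkc : HasCompactSupport fun x => w x * (1 + ζ x) := hc.mul_right
  have hk : Continuous fun x => w x * (1 + ζ x) := by fun_prop
  have i1 : Integrable fun x => ζ x * (w x * (1 + ζ x)) :=
    (hζ.mul hk).integrable_of_hasCompactSupport hkc.mul_left
  have i2 : Integrable fun x => (w x * (1 + ζ x)) ^ 2 := by
    simp_rw [sq]
    exact (hk.mul hk).integrable_of_hasCompactSupport hkc.mul_left
  have e : ∀ x, stretchedSurface ζ w t x ^ 2 = ζ x ^ 2 + 2 * t * (ζ x * (w x * (1 + ζ x))) +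
      t ^ 2 * (w x * (1 + ζ x)) ^ 2 := fun x => by unfold stretchedSurface; ring
  simp_rw [e]
  have i3 := h.integrable_surface_sq.add (i1.const_mul (2 * t))
  refine ⟨i3.add (i2.const_mul (t ^ 2)), ?_⟩
  have i3' : Integrable fun x => ζ x ^ 2 + 2 * t * (ζ x * (w x * (1 + ζ x))) := i3
  rw [integral_add i3' (i2.const_mul (t ^ 2)), integral_add h.integrable_surface_sq
    (i1.const_mul (2 * t)), integral_const_mul, integral_const_mul]

theorem Admissible.stretched (h : Admissible m ψ ζ) (hw : ContDiff ℝ ∞ w)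
    (hc : HasCompactSupport w) (h0 : ∫ x, w x * (1 + ζ x) = 0) {t : ℝ}
    (hJ : ∀ x, 1 / 2 ≤ 1 + t * w x) (hne : ∫ x, stretchedSurface ζ w t x ^ 2 ≠ 0) :
    Admissible m (stretchedStream ψ w t) (stretchedSurface ζ w t) := by
  have hJ0 : ∀ x, 0 < 1 + t * w x := fun x => by linarith [hJ x]
  have hζ := h.continuous_surface
  have hwc := hw.continuous
  have ik : Integrable fun x => w x * (1 + ζ x) :=
    (show Continuous fun x => w x * (1 + ζ x) by fun_prop).integrable_of_hasCompactSupport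
      hc.mul_right
  have hd : ∀ x, 1 + stretchedSurface ζ w t x = (1 + ζ x) * (1 + t * w x) := fun x => by
    unfold stretchedSurface; ring
  refine ⟨by unfold stretchedSurface; fun_prop, fun x => ?_, h.integrable_surface.add (ik.const_mul t),
    ?_, (h.integral_stretchedSurface_sq hwc hc t).1, hne, fun x y hy => ?_, fun x y hy => ?_,
    ⟨_, h.wdx_stretchedStream hw hJ0⟩, ⟨_, h.wdy_stretchedStream hw hJ0⟩,
    (h.stretched_energy hw hc h0 hJ).1⟩
  · rw [hd]; exact mul_pos (h.depth_pos x) (hJ0 x)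
  · unfold stretchedSurface
    rw [integral_add h.integrable_surface (ik.const_mul t), integral_const_mul, h0, mul_zero,
      add_zero, h.mass_eq]
  · exact h.bottom _ _ (div_nonpos_of_nonpos_of_nonneg hy (hJ0 x).le)
  · refine h.surface _ _ ?_
    rw [le_div_iff₀ (hJ0 x), ← hd]; exact hy

/-- Nothing moves outside the cylinder over the support of `w`, so the gradients may be cut off
there and become square integrable. Each difference is then `f ∘ S - f`, small by `L²` continuity of
stretching, plus a term of order `t`. -/
theorem Admissible.tendsto_pairDist_stretched (h : Admissible m ψ ζ) (hw : ContDiff ℝ ∞ w)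
    (hc : HasCompactSupport w) :
    Tendsto (fun t => pairDist ψ ζ (stretchedStream ψ w t) (stretchedSurface ζ w t))
      (𝓝 0) (𝓝 0) := by
  have hζ := h.continuous_surface
  have hwc := hw.continuous
  have hw' : Continuous (deriv w) := (hw.of_le (m := 1) (by exact_mod_cast le_top)).continuous_deriv le_rfl
  obtain ⟨W, hW⟩ := hwc.bounded_above_of_compact_support hc
  have hW : ∀ x, |w x| ≤ W := hW
  have hW0 : 0 ≤ W := (abs_nonneg _).trans (hW 0)
  obtain ⟨C, hC⟩ := (show Continuous fun x => w x * (1 + ζ x) by fun_prop).bounded_above_of_compact_support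
    hc.mul_right
  set cyl : Set (ℝ × ℝ) := Prod.fst ⁻¹' (tsupport w)
  set f₁ := cyl.indicator (wdx ψ)
  set f₂ := cyl.indicator (wdy ψ)
  set q : ℝ × ℝ → ℝ := fun z => deriv w z.1 * z.2 * wdy ψ z
  have m1 : MemLp f₁ 2 volume := h.memLp_cylinder_wdx hc
  have m2 : MemLp f₂ 2 volume := h.memLp_cylinder_wdy hc
  have mq : MemLp q 2 volume := h.memLp_mul_snd_mul_wdy hw' hc.deriv
  set S : ℝ → ℝ × ℝ → ℝ × ℝ := fun t => shrink fun x => 1 + t * w x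
  set N₁ : ℝ → ℝ≥0∞ := fun t => eLpNorm (fun z => f₁ (S t z) - f₁ z) 2 volume
  set N₂ : ℝ → ℝ≥0∞ := fun t => eLpNorm (fun z => f₂ (S t z) - f₂ z) 2 volume
  have hN₁ : Tendsto N₁ (𝓝 0) (𝓝 0) := tendsto_eLpNorm_comp_shrink_sub hwc hW m1
  have hN₂ : Tendsto N₂ (𝓝 0) (𝓝 0) := tendsto_eLpNorm_comp_shrink_sub hwc hW m2
  have hen : ∀ c : ℝ, Tendsto (fun t : ℝ => ‖t * c‖ₑ) (𝓝 0) (𝓝 0) := by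
    intro c
    have : Tendsto (fun t : ℝ => ‖t * c‖ₑ) (𝓝 0) (𝓝 ‖0 * c‖ₑ) :=
      (show Continuous fun t : ℝ => ‖t * c‖ₑ by fun_prop).tendsto 0
    simpa using this
  have hbound : Tendsto (fun t : ℝ => ENNReal.ofReal (|t| * C) +
      (N₁ t + ‖t * 2‖ₑ * (2 * eLpNorm q 2 volume)) +
      (N₂ t + ‖t * (2 * W)‖ₑ * (2 * eLpNorm f₂ 2 volume))) (𝓝 0) (𝓝 0) := by
    have a1 : Tendsto (fun t : ℝ => ENNReal.ofReal (|t| * C)) (𝓝 0) (𝓝 0) := by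
      have : Tendsto (fun t : ℝ => ENNReal.ofReal (|t| * C)) (𝓝 0) (𝓝 (ENNReal.ofReal (|0| * C))) :=
        (ENNReal.continuous_ofReal.comp (continuous_abs.mul continuous_const)).tendsto 0
      simpa using this
    have a2 := ENNReal.Tendsto.mul_const (b := 2 * eLpNorm q 2 volume) (hen 2)
      (Or.inr (ENNReal.mul_ne_top (by norm_num) mq.eLpNorm_ne_top))
    have a3 := ENNReal.Tendsto.mul_const (b := 2 * eLpNorm f₂ 2 volume) (hen (2 * W))
      (Or.inr (ENNReal.mul_ne_top (by norm_num) m2.eLpNorm_ne_top))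
    simpa using (a1.add (hN₁.add a2)).add (hN₂.add a3)
  refine tendsto_of_tendsto_of_tendsto_of_le_of_le' tendsto_const_nhds hbound
    (Eventually.of_forall fun _ => zero_le) ?_
  filter_upwards [eventually_abs_mul_le W (show (0 : ℝ) < 1 / 2 by norm_num)] with t ht
  have hJ := fun x => half_le_one_add (hW x) ht
  have hJ0 : ∀ x, 0 < 1 + t * w x := fun x => by linarith [(hJ x).1]
  have hJ2 : ∀ x, 1 + t * w x ≤ 2 := fun x => by linarith [(hJ x).2]
  have hJc : Continuous fun x => 1 + t * w x := by fun_prop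
  have hq : Measure.QuasiMeasurePreserving (S t) volume volume := by
    refine ⟨(continuous_shrink hJc hJ0).measurable, ?_⟩
    rw [map_shrink_volume hJc hJ0]
    exact withDensity_absolutelyContinuous _ _
  have mS : ∀ {f : ℝ × ℝ → ℝ}, AEStronglyMeasurable f volume →
      AEStronglyMeasurable (fun z => f (S t z)) volume := fun hf => hf.comp_quasiMeasurePreserving hq
  have hcyl : ∀ z, z ∉ cyl → S t z = z := by
    intro z hz
    have : w z.1 = 0 := image_eq_zero_of_notMem_tsupport hz
    simp [S, shrink, this]
  have hcyl2 : ∀ z, S t z ∈ cyl ↔ z ∈ cyl := fun z => Iff.rfl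
  have hinv : ∀ x, (1 + t * w x)⁻¹ ≤ 2 := by
    intro x
    rw [inv_le_comm₀ (hJ0 x) (by norm_num)]
    have := (hJ x).1
    norm_num at this ⊢; exact this
  unfold pairDist
  refine add_le_add (add_le_add ?_ ?_) ?_
  · refine iSup_le fun x => ENNReal.ofReal_le_ofReal ?_
    have : stretchedSurface ζ w t x - ζ x = t * (w x * (1 + ζ x)) := by
      unfold stretchedSurface; ring
    rw [this, abs_mul]
    exact mul_le_mul_of_nonneg_left (hC x) (abs_nonneg _)
  · have e : (fun z => wdx (stretchedStream ψ w t) z - wdx ψ z) =ᵐ[volume]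
        (fun z => f₁ (S t z) - f₁ z) + fun z => -t * (1 + t * w z.1)⁻¹ * q (S t z) := by
      filter_upwards [(h.wdx_stretchedStream hw hJ0).weakDeriv_ae_eq] with z hz
      have hz' : wdx (stretchedStream ψ w t) z = wdx ψ (S t z) - t * q (S t z) / (1 + t * w z.1) := hz
      rw [hz']
      simp only [Pi.add_apply]
      have e1 : f₁ (S t z) - f₁ z = wdx ψ (S t z) - wdx ψ z := by
        by_cases hzc : z ∈ cyl
        · simp only [f₁, indicator_of_mem hzc, indicator_of_mem ((hcyl2 z).2 hzc)]
        · rw [hcyl z hzc]; ring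
      rw [e1]; ring
    rw [eLpNorm_congr_ae e]
    have a1 : AEStronglyMeasurable (fun z => f₁ (S t z) - f₁ z) volume := (mS m1.1).sub m1.1
    have a2 : AEStronglyMeasurable (fun z : ℝ × ℝ => -t * (1 + t * w z.1)⁻¹ * q (S t z)) volume :=
      AEStronglyMeasurable.mul (Continuous.aestronglyMeasurable (continuous_const.mul
        (Continuous.inv₀ (by fun_prop) fun z => (hJ0 z.1).ne'))) (mS mq.1)
    refine (eLpNorm_add_le a1 a2 (by norm_num)).trans (add_le_add le_rfl ?_)
    calc eLpNorm (fun z : ℝ × ℝ => -t * (1 + t * w z.1)⁻¹ * q (S t z)) 2 volume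
        ≤ eLpNorm ((t * 2) • fun z => q (S t z)) 2 volume := by
          refine eLpNorm_mono fun z => ?_
          simp only [Pi.smul_apply, smul_eq_mul, norm_mul, norm_neg, Real.norm_eq_abs]
          rw [abs_of_pos (inv_pos.2 (hJ0 z.1)), abs_of_pos (show (0 : ℝ) < 2 by norm_num)]
          have := hinv z.1
          gcongr
      _ = ‖t * 2‖ₑ * eLpNorm (fun z => q (S t z)) 2 volume := eLpNorm_const_smul _ _ _ _
      _ ≤ _ := by
          gcongr
          exact eLpNorm_comp_shrink_le hJc hJ0 hJ2 q
  · have e : (fun z => wdy (stretchedStream ψ w t) z - wdy ψ z) =ᵐ[volume]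
        (fun z => f₂ (S t z) - f₂ z) + fun z => -t * w z.1 * (1 + t * w z.1)⁻¹ * f₂ (S t z) := by
      filter_upwards [(h.wdy_stretchedStream hw hJ0).weakDeriv_ae_eq] with z hz
      have hz' : wdy (stretchedStream ψ w t) z = wdy ψ (S t z) / (1 + t * w z.1) := hz
      rw [hz']
      simp only [Pi.add_apply]
      have := (hJ0 z.1).ne'
      by_cases hzc : z ∈ cyl
      · simp only [f₂, indicator_of_mem hzc, indicator_of_mem ((hcyl2 z).2 hzc)]
        field_simp; ring
      · rw [hcyl z hzc]
        have : w z.1 = 0 := image_eq_zero_of_notMem_tsupport hzc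
        simp [this]
    rw [eLpNorm_congr_ae e]
    have a1 : AEStronglyMeasurable (fun z => f₂ (S t z) - f₂ z) volume := (mS m2.1).sub m2.1
    have a2 : AEStronglyMeasurable (fun z : ℝ × ℝ => -t * w z.1 * (1 + t * w z.1)⁻¹ * f₂ (S t z))
        volume :=
      AEStronglyMeasurable.mul (Continuous.aestronglyMeasurable (Continuous.mul (by fun_prop)
        (Continuous.inv₀ (by fun_prop) fun z => (hJ0 z.1).ne'))) (mS m2.1)
    refine (eLpNorm_add_le a1 a2 (by norm_num)).trans (add_le_add le_rfl ?_)
    calc eLpNorm (fun z : ℝ × ℝ => -t * w z.1 * (1 + t * w z.1)⁻¹ * f₂ (S t z)) 2 volume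
        ≤ eLpNorm ((t * (2 * W)) • fun z => f₂ (S t z)) 2 volume := by
          refine eLpNorm_mono fun z => ?_
          simp only [Pi.smul_apply, smul_eq_mul, norm_mul, norm_neg, Real.norm_eq_abs]
          rw [abs_of_pos (inv_pos.2 (hJ0 z.1)), abs_of_pos (show (0 : ℝ) < 2 by norm_num),
            abs_of_nonneg hW0, mul_comm 2 W, ← mul_assoc]
          have := hinv z.1
          have := hW z.1
          have := (inv_pos.2 (hJ0 z.1)).le
          gcongr
      _ = ‖t * (2 * W)‖ₑ * eLpNorm (fun z => f₂ (S t z)) 2 volume := eLpNorm_const_smul _ _ _ _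
      _ ≤ _ := by
          gcongr
          exact eLpNorm_comp_shrink_le hJc hJ0 hJ2 f₂

/-- The first variation of the quotient under stretching of vertical lines vanishes. -/
theorem IsMinimizer.integral_stretchingVariation (hδ : 0 < δ) (h : IsMinimizer m δ lam ψ ζ)
    (hw : ContDiff ℝ ∞ w) (hc : HasCompactSupport w) (h0 : ∫ x, w x * (1 + ζ x) = 0) :
    ∫ z in fluidDomain ζ, stretchingVariation ψ w z =
      2 * lam * ∫ x, ζ x * (w x * (1 + ζ x)) := by
  have hA := h.admissible
  have hwc := hw.continuous
  obtain ⟨W, hW⟩ := hwc.bounded_above_of_compact_support hc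
  have hsq := fun t => (hA.integral_stretchedSurface_sq hwc hc t).2
  set A := ∫ x, ζ x ^ 2
  set B := ∫ x, ζ x * (w x * (1 + ζ x))
  set C := ∫ x, (w x * (1 + ζ x)) ^ 2
  set L := ∫ z in fluidDomain ζ, stretchingVariation ψ w z
  set Q := ∫ z in fluidDomain ζ, stretchingRemainder ψ w z
  have hne : ∀ᶠ t in 𝓝 (0 : ℝ), A + 2 * t * B + t ^ 2 * C ≠ 0 := by
    have hcont : Continuous fun t : ℝ => A + 2 * t * B + t ^ 2 * C := by fun_prop
    refine hcont.continuousAt.eventually_ne ?_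
    simpa using hA.surface_sq_ne_zero
  have key : L - 2 * lam * B = 0 := by
    -- The remainder bound of the energy gives `2 Q`; the exactly quadratic `∫ ζ²` of the stretched
    -- surface gives `-lam * C`.
    refine eq_zero_of_eventually_nonneg (C := 2 * Q - lam * C) ?_
    filter_upwards [eventually_abs_mul_le W (show (0 : ℝ) < 1 / 2 by norm_num), hne,
      (hA.tendsto_pairDist_stretched hw hc).eventually (gt_mem_nhds hδ)] with t ht h1 h2
    have hJ := fun x => (half_le_one_add (hW x) ht).1
    have hadm := hA.stretched hw hc h0 hJ (by rw [hsq]; exact h1)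
    have h3 := h.le_excessEnergy hadm h2.le
    have h4 := (hA.stretched_energy hw hc h0 hJ).2
    have h5 := h.excessEnergy_eq
    rw [hsq] at h3
    simp only [A, B, C, L, Q] at *
    nlinarith
  linarith

end Stretching

/-! ### Functions of one variable with integrable derivative. -/

section OneDim

variable {v v' : ℝ → ℝ} {a b : ℝ}

theorem integrableOn_of_sq {f : ℝ → ℝ} (hf : AEStronglyMeasurable f (volume.restrict (Ioo a b)))
    (h : IntegrableOn (fun y => f y ^ 2) (Ioo a b)) : IntegrableOn f (Ioo a b) :=
  ((memLp_two_iff_integrable_sq hf).2 h).integrable (by norm_num)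

theorem sub_eq_integral_of_mem_Ioo (hv : ∀ y ∈ Ioo a b, HasDerivAt v (v' y) y)
    (hi : IntegrableOn v' (Ioo a b)) {y z : ℝ} (hy : y ∈ Ioo a b) (hz : z ∈ Ioo a b) :
    v z - v y = ∫ t in y..z, v' t := by
  have hsub : uIcc y z ⊆ Ioo a b := (ordConnected_Ioo).uIcc_subset hy hz
  refine (intervalIntegral.integral_eq_sub_of_hasDerivAt (fun t ht => hv t (hsub ht)) ?_).symm
  exact (hi.mono_set hsub).intervalIntegrable

/-- Up to a constant `v` is a primitive of an integrable function, and such a primitive is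
continuous up to the endpoint. -/
theorem exists_tendsto_left (hab : a < b) (hv : ∀ y ∈ Ioo a b, HasDerivAt v (v' y) y)
    (hi : IntegrableOn v' (Ioo a b)) : ∃ l, Tendsto v (𝓝[<] b) (𝓝 l) := by
  obtain ⟨c, hc⟩ := exists_between hab
  have hic : IntegrableOn v' (uIcc c b) := by
    rw [uIcc_of_le hc.2.le, integrableOn_Icc_iff_integrableOn_Ioo]
    exact hi.mono_set (Ioo_subset_Ioo_left hc.1.le)
  have h1 := (intervalIntegral.continuousOn_primitive_interval hic) b right_mem_uIcc
  have h2 : Tendsto (fun y => v c + ∫ t in c..y, v' t) (𝓝[<] b) (𝓝 (v c + ∫ t in c..b, v' t)) := by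
    refine tendsto_const_nhds.add (Tendsto.mono_left h1 ?_)
    rw [uIcc_of_le hc.2.le]
    exact nhdsWithin_le_of_mem (Icc_mem_nhdsLT hc.2)
  refine ⟨_, h2.congr' ?_⟩
  filter_upwards [Ioo_mem_nhdsLT hc.2] with y hy
  rw [← sub_eq_integral_of_mem_Ioo hv hi hc ⟨hc.1.trans hy.1, hy.2⟩]; ring

theorem exists_tendsto_right (hab : a < b) (hv : ∀ y ∈ Ioo a b, HasDerivAt v (v' y) y)
    (hi : IntegrableOn v' (Ioo a b)) : ∃ l, Tendsto v (𝓝[>] a) (𝓝 l) := by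
  obtain ⟨c, hc⟩ := exists_between hab
  have hic : IntegrableOn v' (uIcc a c) := by
    rw [uIcc_of_le hc.1.le, integrableOn_Icc_iff_integrableOn_Ioo]
    exact hi.mono_set (Ioo_subset_Ioo_right hc.2.le)
  have h1 := (intervalIntegral.continuousOn_primitive_interval_left hic) a left_mem_uIcc
  have h2 : Tendsto (fun y => v c - ∫ t in y..c, v' t) (𝓝[>] a) (𝓝 (v c - ∫ t in a..c, v' t)) := by
    refine tendsto_const_nhds.sub (Tendsto.mono_left h1 ?_)
    rw [uIcc_of_le hc.1.le]
    exact nhdsWithin_le_of_mem (Icc_mem_nhdsGT hc.1)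
  refine ⟨_, h2.congr' ?_⟩
  filter_upwards [Ioo_mem_nhdsGT hc.1] with y hy
  rw [← sub_eq_integral_of_mem_Ioo hv hi ⟨hy.1, hy.2.trans hc.2⟩ hc]; ring

/-- The Sobolev inequality in one variable. -/
theorem sq_le_of_hasDerivAt (hab : a < b) (hv : ∀ y ∈ Ioo a b, HasDerivAt v (v' y) y)
    (hi : IntegrableOn v' (Ioo a b)) (hv2 : IntegrableOn (fun y => v y ^ 2) (Ioo a b))
    (hi2 : IntegrableOn (fun y => v' y ^ 2) (Ioo a b)) {y : ℝ} (hy : y ∈ Ioo a b) :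
    v y ^ 2 ≤ 2 / (b - a) * (∫ t in Ioo a b, v t ^ 2) +
      2 * (b - a) * ∫ t in Ioo a b, v' t ^ 2 := by
  have hl : 0 < b - a := sub_pos.2 hab
  set A := ∫ t in Ioo a b, |v' t| with hA
  have hia : IntegrableOn (fun t => |v' t|) (Ioo a b) := hi.abs
  have hA0 : 0 ≤ A := integral_nonneg fun _ => abs_nonneg _
  have hvol : (volume.real (Ioo a b)) = b - a := by simp [hab.le]
  have hone : IntegrableOn (fun _ : ℝ => (1 : ℝ)) (Ioo a b) := by simp [integrableOn_const_iff]
  -- Cauchy–Schwarz against the constant `1`, by expanding the square of `|v'|` minus its mean.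
  have hCS : A ^ 2 ≤ (b - a) * ∫ t in Ioo a b, v' t ^ 2 := by
    have h0 : 0 ≤ ∫ t in Ioo a b, (|v' t| - A / (b - a)) ^ 2 := integral_nonneg fun _ => sq_nonneg _
    have e : ∀ t, (|v' t| - A / (b - a)) ^ 2 =
        v' t ^ 2 - 2 * (A / (b - a)) * |v' t| + (A / (b - a)) ^ 2 * 1 := fun t => by
      rw [sub_sq, sq_abs]; ring
    simp_rw [e] at h0
    have i1 : IntegrableOn (fun t => v' t ^ 2 - 2 * (A / (b - a)) * |v' t|) (Ioo a b) :=
      hi2.sub (hia.const_mul _)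
    rw [integral_add i1 (hone.const_mul _), integral_sub hi2 (hia.const_mul _),
      integral_const_mul, integral_const_mul, ← hA, setIntegral_const, hvol] at h0
    have e2 : (∫ t in Ioo a b, v' t ^ 2) - 2 * (A / (b - a)) * A +
        (A / (b - a)) ^ 2 * ((b - a) • (1 : ℝ)) = (∫ t in Ioo a b, v' t ^ 2) - A ^ 2 / (b - a) := by
      rw [smul_eq_mul]; field_simp; ring
    rw [e2, sub_nonneg, div_le_iff₀ hl] at h0
    linarith
  have hpt : ∀ z ∈ Ioo a b, v y ^ 2 ≤ 2 * v z ^ 2 + 2 * A ^ 2 * 1 := by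
    intro z hz
    have h1 := sub_eq_integral_of_mem_Ioo hv hi hz hy
    have h2 : |∫ t in z..y, v' t| ≤ A := by
      refine (intervalIntegral.norm_integral_le_integral_norm_uIoc (f := v') (a := z) (b := y)).trans ?_
      refine setIntegral_mono_set hia (Eventually.of_forall fun _ => abs_nonneg _) ?_
      refine LE.le.eventuallyLE ?_
      exact uIoc_subset_uIcc.trans ((ordConnected_Ioo).uIcc_subset hz hy)
    rw [← h1] at h2
    have h3 := abs_le.1 h2
    nlinarith [sq_nonneg (v z - (v y - v z)), sq_nonneg (v y - v z), sq_abs (v y - v z), abs_nonneg (v y - v z)]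
  -- Averaging over the comparison point `z` replaces an unknown value of `v` by its `L²` norm.
  have hint : ∫ z in Ioo a b, v y ^ 2 * 1 ≤ ∫ z in Ioo a b, (2 * v z ^ 2 + 2 * A ^ 2 * 1) := by
    refine setIntegral_mono_on (hone.const_mul _) ((hv2.const_mul 2).add (hone.const_mul _))
      measurableSet_Ioo fun z hz => ?_
    simpa using hpt z hz
  rw [integral_add (hv2.const_mul 2) (hone.const_mul _), integral_const_mul, integral_const_mul,
    integral_const_mul, setIntegral_const, hvol] at hint
  simp only [smul_eq_mul, mul_one] at hint
  have h5 : v y ^ 2 ≤ (2 * (∫ t in Ioo a b, v t ^ 2) + 2 * A ^ 2 * (b - a)) / (b - a) := by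
    rw [le_div_iff₀ hl]; exact hint
  refine h5.trans ?_
  have e3 : (2 * (∫ t in Ioo a b, v t ^ 2) + 2 * A ^ 2 * (b - a)) / (b - a) =
      2 / (b - a) * (∫ t in Ioo a b, v t ^ 2) + 2 * A ^ 2 := by
    field_simp
  rw [e3]
  nlinarith

end OneDim

/-! ### Boundary values on vertical lines. -/

section Traces

variable {ζ : ℝ → ℝ} {v : ℝ × ℝ → ℝ}

theorem hasDerivAt_vertical {x y : ℝ} (h : DifferentiableAt ℝ v (x, y)) :
    HasDerivAt (fun y => v (x, y)) (dy v (x, y)) y := by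
  have h1 : HasDerivAt (fun y : ℝ => (x, y)) ((0 : ℝ), (1 : ℝ)) y :=
    (hasDerivAt_const y x).prodMk (hasDerivAt_id y)
  exact h.hasFDerivAt.comp_hasDerivAt y h1

/-- The majorant of the squares of the values of `v` on vertical lines. -/
noncomputable def lineMajorant (ζ : ℝ → ℝ) (v : ℝ × ℝ → ℝ) (x : ℝ) : ℝ :=
  2 / (1 + ζ x) * (∫ y in Ioo 0 (1 + ζ x), v (x, y) ^ 2) +
    2 * (1 + ζ x) * ∫ y in Ioo 0 (1 + ζ x), dy v (x, y) ^ 2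

variable (hζ : Continuous ζ) (hd : ∀ x, 0 < 1 + ζ x) (hv : ContDiffOn ℝ 1 v (fluidDomain ζ))
  (h2 : MemLp v 2 (volume.restrict (fluidDomain ζ)))
  (h2' : MemLp (dy v) 2 (volume.restrict (fluidDomain ζ)))

include hζ hv in
theorem hasDerivAt_section (x : ℝ) :
    ∀ y ∈ Ioo 0 (1 + ζ x), HasDerivAt (fun y => v (x, y)) (dy v (x, y)) y := fun y hy =>
  hasDerivAt_vertical ((hv.differentiableOn (by norm_num)).differentiableAt
    ((isOpen_fluidDomain hζ).mem_nhds (show (x, y) ∈ fluidDomain ζ from hy)))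

include hζ hv h2' in
theorem ae_integrableOn_dy_section :
    ∀ᵐ x, IntegrableOn (fun y => dy v (x, y)) (Ioo 0 (1 + ζ x)) := by
  filter_upwards [ae_integrableOn_section hζ h2'.integrable_sq] with x hx
  refine integrableOn_of_sq (ContinuousOn.aestronglyMeasurable ?_ measurableSet_Ioo) hx
  have : ContinuousOn (dy v) (fluidDomain ζ) :=
    (hv.continuousOn_fderiv_of_isOpen (isOpen_fluidDomain hζ) le_rfl).clm_apply continuousOn_const
  exact this.comp (f := fun y => (x, y)) (by fun_prop) fun y hy => hy

include hζ hd hv h2' in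
theorem exists_surfaceValues : ∃ a, HasSurfaceValues ζ v a := by
  refine ⟨fun x => limUnder (𝓝[<] (1 + ζ x)) fun y => v (x, y), ?_⟩
  filter_upwards [ae_integrableOn_dy_section hζ hv h2'] with x hx
  exact tendsto_nhds_limUnder (exists_tendsto_left (hd x) (hasDerivAt_section hζ hv x) hx)

include hζ hd hv h2' in
theorem exists_bottomValues : ∃ a, HasBottomValues v a := by
  refine ⟨fun x => limUnder (𝓝[>] 0) fun y => v (x, y), ?_⟩
  filter_upwards [ae_integrableOn_dy_section hζ hv h2'] with x hx
  exact tendsto_nhds_limUnder (exists_tendsto_right (hd x) (hasDerivAt_section hζ hv x) hx)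

include hζ hd hv h2 h2' in
theorem ae_sq_le_lineMajorant :
    ∀ᵐ x, ∀ y ∈ Ioo 0 (1 + ζ x), v (x, y) ^ 2 ≤ lineMajorant ζ v x := by
  filter_upwards [ae_integrableOn_dy_section hζ hv h2', ae_integrableOn_section hζ h2.integrable_sq,
    ae_integrableOn_section hζ h2'.integrable_sq] with x h1 h3 h4 y hy
  have := sq_le_of_hasDerivAt (hd x) (hasDerivAt_section hζ hv x) h1 h3 h4 hy
  simpa only [sub_zero, lineMajorant] using this

include hζ hd h2 h2' in
theorem locallyIntegrable_lineMajorant : LocallyIntegrable (lineMajorant ζ v) := by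
  have i1 := (integrable_section_integral hζ h2.integrable_sq).locallyIntegrable
  have i2 := (integrable_section_integral hζ h2'.integrable_sq).locallyIntegrable
  rw [locallyIntegrable_iff]
  intro K hK
  have c1 : Continuous fun x => 2 / (1 + ζ x) :=
    continuous_const.div₀ (by fun_prop) fun x => (hd x).ne'
  exact ((i1.integrableOn_isCompact hK).continuousOn_mul c1.continuousOn hK).add
    ((i2.integrableOn_isCompact hK).continuousOn_mul (by fun_prop) hK)

include hζ hv h2 h2' in
-- The Sobolev inequality is used on the top segment of fixed length `1/2`, whose constants `4` and
-- `1` do not depend on the depth. The bound is therefore integrable over the whole line, whereas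
-- `lineMajorant` is only shown to be locally integrable; this identifies the Bernoulli constant.
theorem exists_integrable_surface_bound {a : ℝ → ℝ} (ha : HasSurfaceValues ζ v a) :
    ∃ H : ℝ → ℝ, Integrable H ∧ ∀ᵐ x, 1 / 2 ≤ 1 + ζ x → a x ^ 2 ≤ H x := by
  have i1 := integrable_section_integral hζ h2.integrable_sq
  have i2 := integrable_section_integral hζ h2'.integrable_sq
  refine ⟨_, (i1.const_mul 4).add i2, ?_⟩
  filter_upwards [ae_integrableOn_dy_section hζ hv h2', ae_integrableOn_section hζ h2.integrable_sq,
    ae_integrableOn_section hζ h2'.integrable_sq, ha] with x h1 h3 h4 hax hx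
  have hsub : Ioo (1 + ζ x - 1 / 2) (1 + ζ x) ⊆ Ioo 0 (1 + ζ x) := Ioo_subset_Ioo_left (by linarith)
  have hlim : Tendsto (fun y => v (x, y) ^ 2) (𝓝[<] (1 + ζ x)) (𝓝 (a x ^ 2)) := hax.pow 2
  refine le_of_tendsto hlim ?_
  filter_upwards [Ioo_mem_nhdsLT (show 1 + ζ x - 1 / 2 < 1 + ζ x by linarith)] with y hy
  have := sq_le_of_hasDerivAt (by linarith) (fun y hy => hasDerivAt_section hζ hv x y (hsub hy))
    (h1.mono_set hsub) (h3.mono_set hsub) (h4.mono_set hsub) hy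
  refine this.trans ?_
  have e : 1 + ζ x - (1 + ζ x - 1 / 2) = 1 / 2 := by ring
  rw [e]
  have m1 : ∫ y in Ioo (1 + ζ x - 1 / 2) (1 + ζ x), v (x, y) ^ 2 ≤
      ∫ y in Ioo 0 (1 + ζ x), v (x, y) ^ 2 :=
    setIntegral_mono_set h3 (Eventually.of_forall fun _ => sq_nonneg _) hsub.eventuallyLE
  have m2 : ∫ y in Ioo (1 + ζ x - 1 / 2) (1 + ζ x), dy v (x, y) ^ 2 ≤
      ∫ y in Ioo 0 (1 + ζ x), dy v (x, y) ^ 2 :=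
    setIntegral_mono_set h4 (Eventually.of_forall fun _ => sq_nonneg _) hsub.eventuallyLE
  simp only [Pi.add_apply]
  linarith

end Traces

/-! ### The divergence theorem below a continuously differentiable surface. -/

section Divergence

variable {ζ : ℝ → ℝ} {F F₁ F₂ : ℝ × ℝ → ℝ} {K : Set ℝ}

theorem mul_depth_mem (hd : ∀ x, 0 < 1 + ζ x) {x s : ℝ} (hs : s ∈ Ioo (0 : ℝ) 1) :
    (x, s * (1 + ζ x)) ∈ fluidDomain ζ :=
  ⟨mul_pos hs.1 (hd x), by have := mul_lt_mul_of_pos_right hs.2 (hd x); simpa using this⟩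

theorem continuousOn_dx (hζ : Continuous ζ) (hF : ContDiffOn ℝ 1 F (fluidDomain ζ)) :
    ContinuousOn (dx F) (fluidDomain ζ) :=
  (hF.continuousOn_fderiv_of_isOpen (isOpen_fluidDomain hζ) le_rfl).clm_apply continuousOn_const

theorem continuousOn_dy (hζ : Continuous ζ) (hF : ContDiffOn ℝ 1 F (fluidDomain ζ)) :
    ContinuousOn (dy F) (fluidDomain ζ) :=
  (hF.continuousOn_fderiv_of_isOpen (isOpen_fluidDomain hζ) le_rfl).clm_apply continuousOn_const

theorem eventually_eq_zero (hζ : Continuous ζ) (hK : IsCompact K)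
    (h0 : ∀ z ∈ fluidDomain ζ, z.1 ∉ K → F z = 0) {z : ℝ × ℝ} (hz : z ∈ fluidDomain ζ)
    (hzK : z.1 ∉ K) : F =ᶠ[𝓝 z] fun _ => 0 := by
  filter_upwards [(isOpen_fluidDomain hζ).mem_nhds hz,
    (hK.isClosed.isOpen_compl.preimage continuous_fst).mem_nhds hzK] with w hw hwK
  exact h0 w hw hwK

theorem dx_eq_zero_of_notMem (hζ : Continuous ζ) (hK : IsCompact K)
    (h0 : ∀ z ∈ fluidDomain ζ, z.1 ∉ K → F z = 0) {z : ℝ × ℝ} (hz : z ∈ fluidDomain ζ)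
    (hzK : z.1 ∉ K) : dx F z = 0 := by
  rw [dx, (eventually_eq_zero hζ hK h0 hz hzK).fderiv_eq]; simp

theorem dy_eq_zero_of_notMem (hζ : Continuous ζ) (hK : IsCompact K)
    (h0 : ∀ z ∈ fluidDomain ζ, z.1 ∉ K → F z = 0) {z : ℝ × ℝ} (hz : z ∈ fluidDomain ζ)
    (hzK : z.1 ∉ K) : dy F z = 0 := by
  rw [dy, (eventually_eq_zero hζ hK h0 hz hzK).fderiv_eq]; simp

theorem hasDerivAt_graph {F : ℝ × ℝ → ℝ} {c : ℝ → ℝ} {c' x : ℝ} (hc : HasDerivAt c c' x)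
    (hF : DifferentiableAt ℝ F (x, c x)) :
    HasDerivAt (fun x => F (x, c x)) (dx F (x, c x) + c' * dy F (x, c x)) x := by
  have h1 : HasDerivAt (fun x : ℝ => (x, c x)) ((1 : ℝ), c') x := (hasDerivAt_id x).prodMk hc
  have h2 := hF.hasFDerivAt.comp_hasDerivAt x h1
  have e : ((1 : ℝ), c') = (1, 0) + c' • ((0 : ℝ), (1 : ℝ)) := by simp
  rw [e, map_add, map_smul, smul_eq_mul] at h2
  exact h2

variable (hζ : ContDiff ℝ 1 ζ) (hd : ∀ x, 0 < 1 + ζ x) (hK : IsCompact K)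
  (h₁ : ContDiffOn ℝ 1 F₁ (fluidDomain ζ)) (h₂ : ContDiffOn ℝ 1 F₂ (fluidDomain ζ))
  (z₁ : ∀ z ∈ fluidDomain ζ, z.1 ∉ K → F₁ z = 0) (z₂ : ∀ z ∈ fluidDomain ζ, z.1 ∉ K → F₂ z = 0)

/-- The flux density of `(F₁, F₂)` through the curve `y = s (1 + ζ x)`. -/
noncomputable def levelFlux (ζ : ℝ → ℝ) (F₁ F₂ : ℝ × ℝ → ℝ) (s x : ℝ) : ℝ :=
  F₂ (x, s * (1 + ζ x)) - s * deriv ζ x * F₁ (x, s * (1 + ζ x))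

/-- The derivative in `x` of `(1 + ζ x) * F (x, s * (1 + ζ x))`. -/
noncomputable def levelDeriv (ζ : ℝ → ℝ) (F : ℝ × ℝ → ℝ) (p : ℝ × ℝ) : ℝ :=
  deriv ζ p.1 * F (p.1, p.2 * (1 + ζ p.1)) +
    (1 + ζ p.1) * (dx F (p.1, p.2 * (1 + ζ p.1)) +
      p.2 * deriv ζ p.1 * dy F (p.1, p.2 * (1 + ζ p.1)))

include hζ hd in
theorem continuousOn_comp_level {G : ℝ × ℝ → ℝ} (hG : ContinuousOn G (fluidDomain ζ)) :
    ContinuousOn (fun p : ℝ × ℝ => G (p.1, p.2 * (1 + ζ p.1))) (univ ×ˢ Ioo 0 1) := by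
  have := hζ.continuous
  exact hG.comp (f := fun p : ℝ × ℝ => (p.1, p.2 * (1 + ζ p.1))) (by fun_prop)
    fun p hp => mul_depth_mem hd hp.2

include hζ hd h₁ in
theorem continuousOn_levelDeriv : ContinuousOn (levelDeriv ζ F₁) (univ ×ˢ Ioo 0 1) := by
  have c0 := hζ.continuous
  have c1 : Continuous (deriv ζ) := hζ.continuous_deriv le_rfl
  have a1 := continuousOn_comp_level hζ hd h₁.continuousOn
  have a2 := continuousOn_comp_level hζ hd (continuousOn_dx c0 h₁)
  have a3 := continuousOn_comp_level hζ hd (continuousOn_dy c0 h₁)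
  have c2 : Continuous fun p : ℝ × ℝ => deriv ζ p.1 := c1.comp continuous_fst
  unfold levelDeriv
  exact (c2.continuousOn.mul a1).add (ContinuousOn.mul (by fun_prop)
    (a2.add ((continuousOn_snd.mul c2.continuousOn).mul a3)))

include hζ hd hK h₁ z₁ in
-- A total derivative in `x` of a function with compact support.
theorem integral_levelDeriv {s : ℝ} (hs : s ∈ Ioo (0 : ℝ) 1) :
    ∫ x, levelDeriv ζ F₁ (x, s) = 0 := by
  have c0 := hζ.continuous
  have hmk : ∀ G : ℝ × ℝ → ℝ, ContinuousOn G (univ ×ˢ Ioo 0 1) → Continuous fun x => G (x, s) :=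
    fun G hG => continuousOn_univ.1 (hG.comp (f := fun x : ℝ => (x, s)) (by fun_prop)
      fun x _ => ⟨mem_univ _, hs⟩)
  refine integral_eq_zero_of_hasDerivAt_of_integrable
    (f := fun x => (1 + ζ x) * F₁ (x, s * (1 + ζ x))) (fun x => ?_) ?_ ?_
  · have hz := (hζ.differentiable (by norm_num) x).hasDerivAt
    have h1 : HasDerivAt (fun x => 1 + ζ x) (deriv ζ x) x := hz.const_add 1
    have h2 := hasDerivAt_graph (F := F₁) (h1.const_mul s)
      ((h₁.differentiableOn (by norm_num)).differentiableAt
        ((isOpen_fluidDomain c0).mem_nhds (mul_depth_mem hd hs)))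
    exact h1.mul h2
  · refine (hmk _ (continuousOn_levelDeriv hζ hd h₁)).integrable_of_hasCompactSupport
      (HasCompactSupport.intro hK fun x hx => ?_)
    have hm := mul_depth_mem (x := x) hd hs
    simp [levelDeriv, z₁ _ hm hx, dx_eq_zero_of_notMem c0 hK z₁ hm hx,
      dy_eq_zero_of_notMem c0 hK z₁ hm hx]
  · have := hmk _ (continuousOn_comp_level hζ hd h₁.continuousOn)
    refine Continuous.integrable_of_hasCompactSupport ((continuous_const.add c0).mul this)
      (HasCompactSupport.intro hK fun x hx => ?_)
    simp [z₁ _ (mul_depth_mem (x := x) hd hs) hx]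

include hζ hd hK h₁ h₂ z₁ z₂ in
theorem integrable_levelFlux {s : ℝ} (hs : s ∈ Ioo (0 : ℝ) 1) :
    Integrable (levelFlux ζ F₁ F₂ s) := by
  have c1 : Continuous (deriv ζ) := hζ.continuous_deriv le_rfl
  have hmk : ∀ G : ℝ × ℝ → ℝ, ContinuousOn G (fluidDomain ζ) →
      Continuous fun x => G (x, s * (1 + ζ x)) :=
    fun G hG => continuousOn_univ.1 ((continuousOn_comp_level hζ hd hG).comp
      (f := fun x : ℝ => (x, s)) (by fun_prop) fun x _ => ⟨mem_univ _, hs⟩)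
  have a1 := hmk _ h₁.continuousOn
  have a2 := hmk _ h₂.continuousOn
  refine Continuous.integrable_of_hasCompactSupport (a2.sub ((continuous_const.mul c1).mul a1))
    (HasCompactSupport.intro hK fun x hx => ?_)
  have hm := mul_depth_mem (x := x) hd hs
  simp [levelFlux, z₁ _ hm hx, z₂ _ hm hx]

include hζ hd hK h₁ h₂ z₁ z₂ in
-- For fixed `x`, the `s`-derivative of the flux density is the divergence times the Jacobian `1 +
-- ζ`, minus `levelDeriv`, which integrates to zero in `x`. Differentiating in `s` leaves `ζ'`
-- alone, so no second derivative of the surface appears.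
theorem integral_levelFlux_sub {s₀ s₁ : ℝ} (h0 : 0 < s₀) (h01 : s₀ ≤ s₁) (h1 : s₁ < 1) :
    (∫ x, levelFlux ζ F₁ F₂ s₁ x) - ∫ x, levelFlux ζ F₁ F₂ s₀ x =
      ∫ x, ∫ y in (s₀ * (1 + ζ x))..(s₁ * (1 + ζ x)), (dx F₁ (x, y) + dy F₂ (x, y)) := by
  have c0 := hζ.continuous
  have c1 : Continuous (deriv ζ) := hζ.continuous_deriv le_rfl
  have hI : Icc s₀ s₁ ⊆ Ioo 0 1 := fun s hs => ⟨h0.trans_le hs.1, hs.2.trans_lt h1⟩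
  have hIu : uIcc s₀ s₁ ⊆ Ioo 0 1 := by rwa [uIcc_of_le h01]
  have hsec : ∀ (G : ℝ × ℝ → ℝ) (x : ℝ), ContinuousOn G (univ ×ˢ Ioo 0 1) →
      ContinuousOn (fun s => G (x, s)) (uIcc s₀ s₁) := fun G x hG =>
    hG.comp (f := fun s : ℝ => (x, s)) (by fun_prop) fun s hs => ⟨mem_univ _, hIu hs⟩
  let q : ℝ × ℝ → ℝ := fun p => (1 + ζ p.1) *
    (dx F₁ (p.1, p.2 * (1 + ζ p.1)) + dy F₂ (p.1, p.2 * (1 + ζ p.1)))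
  have hq : ContinuousOn q (univ ×ˢ Ioo 0 1) := by
    have a2 := continuousOn_comp_level hζ hd (continuousOn_dx c0 h₁)
    have a3 := continuousOn_comp_level hζ hd (continuousOn_dy c0 h₂)
    fun_prop
  have hk := continuousOn_levelDeriv hζ hd h₁
  have hq0 : ∀ p : ℝ × ℝ, p.2 ∈ Ioo (0 : ℝ) 1 → p.1 ∉ K → q p = 0 := fun p hp hpK => by
    have hm := mul_depth_mem (x := p.1) hd hp
    simp [q, dx_eq_zero_of_notMem c0 hK z₁ hm hpK, dy_eq_zero_of_notMem c0 hK z₂ hm hpK]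
  have hk0 : ∀ p : ℝ × ℝ, p.2 ∈ Ioo (0 : ℝ) 1 → p.1 ∉ K → levelDeriv ζ F₁ p = 0 :=
    fun p hp hpK => by
    have hm := mul_depth_mem (x := p.1) hd hp
    simp [levelDeriv, z₁ _ hm hpK, dx_eq_zero_of_notMem c0 hK z₁ hm hpK,
      dy_eq_zero_of_notMem c0 hK z₁ hm hpK]
  have hint : ∀ G : ℝ × ℝ → ℝ, ContinuousOn G (univ ×ˢ Ioo 0 1) →
      (∀ p : ℝ × ℝ, p.2 ∈ Ioo (0 : ℝ) 1 → p.1 ∉ K → G p = 0) →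
      Integrable G (volume.prod (volume.restrict (Ioc s₀ s₁))) := by
    intro G hG hG0
    have hc : IntegrableOn G (K ×ˢ Icc s₀ s₁) :=
      (hG.mono (prod_mono (subset_univ _) hI)).integrableOn_compact (hK.prod isCompact_Icc)
    have h3 : IntegrableOn G (univ ×ˢ Ioc s₀ s₁) := by
      refine (hc.mono_set (prod_mono_right Ioc_subset_Icc_self)).of_forall_sdiff_eq_zero
        (MeasurableSet.univ.prod measurableSet_Ioc) fun p hp => ?_
      exact hG0 p (hI (Ioc_subset_Icc_self hp.1.2)) fun hpK => hp.2 ⟨hpK, hp.1.2⟩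
    rwa [IntegrableOn, Measure.volume_eq_prod, ← Measure.prod_restrict, Measure.restrict_univ] at h3
  have iq := hint q hq hq0
  have ik := hint _ hk hk0
  have hx : ∀ x, levelFlux ζ F₁ F₂ s₁ x - levelFlux ζ F₁ F₂ s₀ x =
      (∫ s in s₀..s₁, q (x, s)) - ∫ s in s₀..s₁, levelDeriv ζ F₁ (x, s) := by
    intro x
    rw [← intervalIntegral.integral_sub (hsec q x hq).intervalIntegrable
      (hsec _ x hk).intervalIntegrable]
    refine (intervalIntegral.integral_eq_sub_of_hasDerivAt
      (f := fun s => levelFlux ζ F₁ F₂ s x)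
      (f' := fun s => q (x, s) - levelDeriv ζ F₁ (x, s)) (fun s hs => ?_)
      ((hsec q x hq).sub (hsec _ x hk)).intervalIntegrable).symm
    have hl : HasDerivAt (fun s : ℝ => s * (1 + ζ x)) (1 + ζ x) s := by
      simpa using (hasDerivAt_id s).mul_const (1 + ζ x)
    have hm := mul_depth_mem (x := x) hd (hIu hs)
    have d1 := (hasDerivAt_section c0 h₁ x _ hm).comp s hl
    have d2 := (hasDerivAt_section c0 h₂ x _ hm).comp s hl
    have d3 : HasDerivAt (fun s : ℝ => s * deriv ζ x) (deriv ζ x) s := by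
      simpa using (hasDerivAt_id s).mul_const (deriv ζ x)
    refine (d2.sub (d3.mul d1)).congr_deriv ?_
    simp only [q, levelDeriv, Function.comp]
    ring
  have hz : ∫ x, ∫ s in s₀..s₁, levelDeriv ζ F₁ (x, s) = 0 := by
    simp_rw [intervalIntegral.integral_of_le h01]
    rw [integral_integral_swap (f := fun x s => levelDeriv ζ F₁ (x, s)) ik]
    refine setIntegral_eq_zero_of_forall_eq_zero fun s hs => ?_
    exact integral_levelDeriv hζ hd hK h₁ z₁ (hI (Ioc_subset_Icc_self hs))
  have ik' : Integrable fun x => ∫ s in s₀..s₁, levelDeriv ζ F₁ (x, s) := by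
    simp_rw [intervalIntegral.integral_of_le h01]; exact ik.integral_prod_left
  have iq' : Integrable fun x => ∫ s in s₀..s₁, q (x, s) := by
    simp_rw [intervalIntegral.integral_of_le h01]; exact iq.integral_prod_left
  rw [← integral_sub (integrable_levelFlux hζ hd hK h₁ h₂ z₁ z₂ (hIu right_mem_uIcc))
    (integrable_levelFlux hζ hd hK h₁ h₂ z₁ z₂ (hIu left_mem_uIcc))]
  simp_rw [hx]
  rw [integral_sub iq' ik', hz, sub_zero]
  congr 1; ext x
  have := intervalIntegral.mul_integral_comp_mul_right (a := s₀) (b := s₁)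
    (f := fun y => dx F₁ (x, y) + dy F₂ (x, y)) (1 + ζ x)
  rw [← this, ← intervalIntegral.integral_const_mul]

include hζ hd hK h₁ h₂ z₁ z₂ in
/-- The divergence theorem in the fluid domain, with boundary values as vertical limits. -/
theorem setIntegral_divergence {B a₁ a₂ b₁ b₂ : ℝ → ℝ} (hB : Integrable B)
    (hb : ∀ᵐ x, ∀ y ∈ Ioo 0 (1 + ζ x), |F₁ (x, y)| ≤ B x ∧ |F₂ (x, y)| ≤ B x)
    (hi : IntegrableOn (fun z => dx F₁ z + dy F₂ z) (fluidDomain ζ))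
    (ha₁ : HasSurfaceValues ζ F₁ a₁) (ha₂ : HasSurfaceValues ζ F₂ a₂)
    (hb₁ : HasBottomValues F₁ b₁) (hb₂ : HasBottomValues F₂ b₂) :
    ∫ z in fluidDomain ζ, (dx F₁ z + dy F₂ z) =
      (∫ x, (a₂ x - deriv ζ x * a₁ x)) - ∫ x, b₂ x := by
  have c0 := hζ.continuous
  have c1 : Continuous (deriv ζ) := hζ.continuous_deriv le_rfl
  -- The shift by `2` gives `t n ≤ 1/2`, so the levels `t n` and `1 - t n` lie in `(0, 1)` in the
  -- right order.
  let t : ℕ → ℝ := fun n => 1 / ((n : ℝ) + 2)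
  have ht0 : ∀ n, 0 < t n := fun n => by positivity
  have ht2 : ∀ n, t n ≤ 1 / 2 := fun n => by
    apply one_div_le_one_div_of_le <;> norm_num
  have htm : Antitone t := fun m n hmn => by
    apply one_div_le_one_div_of_le; positivity
    have : (m : ℝ) ≤ n := by exact_mod_cast hmn
    linarith
  have htl : Tendsto t atTop (𝓝 0) := by
    have := (tendsto_one_div_add_atTop_nhds_zero_nat (𝕜 := ℝ)).comp (tendsto_add_atTop_nat 1)
    refine this.congr fun n => ?_
    simp only [Function.comp, t]; push_cast; ring
  obtain ⟨C, hC⟩ := hK.exists_bound_of_continuousOn c1.continuousOn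
  have hC0 : ∀ x, |B x| ≤ (1 + |C|) * |B x| := fun x => by nlinarith [abs_nonneg C, abs_nonneg (B x)]
  -- One majorant for all levels, by boundedness of `ζ'` on `K`; the limits towards surface and
  -- bottom then follow from dominated convergence.
  have hdom : ∀ s ∈ Ioo (0 : ℝ) 1, ∀ᵐ x, ‖levelFlux ζ F₁ F₂ s x‖ ≤ (1 + |C|) * |B x| := by
    intro s hs
    filter_upwards [hb] with x hx
    have hm := mul_depth_mem (x := x) hd hs
    by_cases hxK : x ∈ K
    · obtain ⟨u1, u2⟩ := hx _ hm
      have u3 : |deriv ζ x| ≤ |C| := (hC x hxK).trans (le_abs_self _)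
      have u4 : |B x| = B x := abs_of_nonneg ((abs_nonneg _).trans u1)
      rw [Real.norm_eq_abs, levelFlux, u4]
      refine (abs_sub _ _).trans ?_
      rw [abs_mul, abs_mul, abs_of_pos hs.1]
      have u5 : s * |deriv ζ x| ≤ |C| := by nlinarith [hs.2, abs_nonneg (deriv ζ x)]
      have := mul_le_mul u5 u1 (abs_nonneg _) (abs_nonneg _)
      linarith
    · have : levelFlux ζ F₁ F₂ s x = 0 := by simp [levelFlux, z₁ _ hm hxK, z₂ _ hm hxK]
      rw [this, norm_zero]; positivity
  have hs1 : ∀ n, 1 - t n ∈ Ioo (0 : ℝ) 1 := fun n =>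
    ⟨by linarith [ht2 n], by linarith [ht0 n]⟩
  have hs0 : ∀ n, t n ∈ Ioo (0 : ℝ) 1 := fun n => ⟨ht0 n, by linarith [ht2 n]⟩
  have hBi : Integrable fun x => (1 + |C|) * |B x| := hB.abs.const_mul _
  have L1 : Tendsto (fun n => ∫ x, levelFlux ζ F₁ F₂ (1 - t n) x) atTop
      (𝓝 (∫ x, (a₂ x - deriv ζ x * a₁ x))) := by
    refine tendsto_integral_of_dominated_convergence _
      (fun n => (integrable_levelFlux hζ hd hK h₁ h₂ z₁ z₂ (hs1 n)).aestronglyMeasurable) hBi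
      (fun n => hdom _ (hs1 n)) ?_
    filter_upwards [ha₁, ha₂] with x e1 e2
    have hl : Tendsto (fun n => 1 - t n) atTop (𝓝 1) := by simpa using tendsto_const_nhds.sub htl
    have hl' : Tendsto (fun n => (1 - t n) * (1 + ζ x)) atTop (𝓝[<] (1 + ζ x)) := by
      refine tendsto_nhdsWithin_iff.2 ⟨by simpa using hl.mul_const (1 + ζ x), ?_⟩
      exact Eventually.of_forall fun n => (mul_depth_mem (x := x) hd (hs1 n)).2
    have := (e2.comp hl').sub ((hl.mul_const (deriv ζ x)).mul (e1.comp hl'))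
    simpa [levelFlux, Function.comp_def] using this
  have L0 : Tendsto (fun n => ∫ x, levelFlux ζ F₁ F₂ (t n) x) atTop (𝓝 (∫ x, b₂ x)) := by
    refine tendsto_integral_of_dominated_convergence _
      (fun n => (integrable_levelFlux hζ hd hK h₁ h₂ z₁ z₂ (hs0 n)).aestronglyMeasurable) hBi
      (fun n => hdom _ (hs0 n)) ?_
    filter_upwards [hb₁, hb₂] with x e1 e2
    have hl' : Tendsto (fun n => t n * (1 + ζ x)) atTop (𝓝[>] 0) := by
      refine tendsto_nhdsWithin_iff.2 ⟨by simpa using htl.mul_const (1 + ζ x), ?_⟩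
      exact Eventually.of_forall fun n => (mul_depth_mem (x := x) hd (hs0 n)).1
    have := (e2.comp hl').sub ((htl.mul_const (deriv ζ x)).mul (e1.comp hl'))
    simpa [levelFlux, Function.comp_def] using this
  -- The regions between two levels increase to the fluid domain.
  let A : ℕ → Set (ℝ × ℝ) := fun n => {z | t n * (1 + ζ z.1) < z.2 ∧ z.2 ≤ (1 - t n) * (1 + ζ z.1)}
  have hAm : ∀ n, MeasurableSet (A n) := fun n =>
    MeasurableSet.inter
      (measurableSet_lt (f := fun z : ℝ × ℝ => t n * (1 + ζ z.1)) (by fun_prop) measurable_snd)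
      (measurableSet_le (g := fun z : ℝ × ℝ => (1 - t n) * (1 + ζ z.1)) measurable_snd (by fun_prop))
  have hAsub : ∀ n, A n ⊆ fluidDomain ζ := fun n z hz =>
    ⟨(mul_pos (ht0 n) (hd _)).trans hz.1, hz.2.trans_lt (mul_depth_mem hd (hs1 n)).2⟩
  have hAmono : Monotone A := fun m n hmn z hz => by
    have := mul_le_mul_of_nonneg_right (htm hmn) (hd z.1).le
    exact ⟨this.trans_lt hz.1, hz.2.trans (by nlinarith)⟩
  have hAU : ⋃ n, A n = fluidDomain ζ := by
    refine subset_antisymm (iUnion_subset hAsub) fun z hz => ?_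
    have l1 : Tendsto (fun n => t n * (1 + ζ z.1)) atTop (𝓝 0) := by
      simpa using htl.mul_const (1 + ζ z.1)
    have l2 : Tendsto (fun n => (1 - t n) * (1 + ζ z.1)) atTop (𝓝 (1 + ζ z.1)) := by
      simpa using ((tendsto_const_nhds (x := (1 : ℝ))).sub htl).mul_const (1 + ζ z.1)
    obtain ⟨n, e1, e2⟩ := ((l1.eventually_lt_const hz.1).and (l2.eventually_const_lt hz.2)).exists
    exact mem_iUnion.2 ⟨n, e1, e2.le⟩
  have LR : Tendsto (fun n => ∫ z in A n, (dx F₁ z + dy F₂ z)) atTop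
      (𝓝 (∫ z in fluidDomain ζ, (dx F₁ z + dy F₂ z))) := by
    have := tendsto_setIntegral_of_monotone (f := fun z => dx F₁ z + dy F₂ z) (μ := volume) hAm hAmono
      (by rw [hAU]; exact hi)
    rwa [hAU] at this
  refine tendsto_nhds_unique LR ((L1.sub L0).congr fun n => ?_)
  rw [integral_levelFlux_sub hζ hd hK h₁ h₂ z₁ z₂ (ht0 n) (by linarith [ht2 n])
    (by linarith [ht0 n])]
  rw [← inter_eq_self_of_subset_right (hAsub n), ← setIntegral_indicator (hAm n),
    setIntegral_fluidDomain c0 (hi.indicator (hAm n))]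
  congr 1; ext x
  have hle : t n * (1 + ζ x) ≤ (1 - t n) * (1 + ζ x) :=
    mul_le_mul_of_nonneg_right (by linarith [ht2 n]) (hd x).le
  have hsub : Ioc (t n * (1 + ζ x)) ((1 - t n) * (1 + ζ x)) ⊆ Ioo 0 (1 + ζ x) :=
    fun y hy => hAsub n (show (x, y) ∈ A n from hy)
  rw [intervalIntegral.integral_of_le hle, ← inter_eq_self_of_subset_right hsub,
    ← setIntegral_indicator measurableSet_Ioc]
  rfl

end Divergence

/-! ### Divergence-free fields tested up to the boundary. -/

section DivergenceFree

variable {ζ : ℝ → ℝ} {V₁ V₂ φ : ℝ × ℝ → ℝ} {K : Set ℝ}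

theorem integrableOn_fst_of_support (hζ : Continuous ζ) (hK : IsCompact K) {g : ℝ → ℝ}
    (hg : Integrable g) (h0 : ∀ x ∉ K, g x = 0) :
    IntegrableOn (fun z : ℝ × ℝ => g z.1) (fluidDomain ζ) := by
  obtain ⟨M, -, hM⟩ := exists_depth_bound hζ hK
  have h1 : IntegrableOn (fun z : ℝ × ℝ => g z.1) (univ ×ˢ Icc 0 M) := by
    rw [IntegrableOn, Measure.volume_eq_prod, ← Measure.prod_restrict, Measure.restrict_univ]
    exact hg.comp_fst _
  refine IntegrableOn.of_forall_sdiff_eq_zero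
    (h1.mono_set (inter_subset_right (s := fluidDomain ζ)))
    (isOpen_fluidDomain hζ).measurableSet fun z hz => h0 _ fun hzK => hz.2 ⟨hz.1, mem_univ _,
      hz.1.1.le, hz.1.2.le.trans (hM _ hzK)⟩

theorem ae_of_ae_fst {P : ℝ → Prop} (h : ∀ᵐ x, P x) : ∀ᵐ z : ℝ × ℝ, P z.1 :=
  Measure.quasiMeasurePreserving_fst.ae h

/-- The weak form of the divergence theorem for divergence-free fields in the fluid domain. -/
theorem setIntegral_divergenceFree (hζ : ContDiff ℝ 1 ζ) (hd : ∀ x, 0 < 1 + ζ x) (hK : IsCompact K)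
    (h₁ : ContDiffOn ℝ 1 V₁ (fluidDomain ζ)) (h₂ : ContDiffOn ℝ 1 V₂ (fluidDomain ζ))
    (hdiv : ∀ z ∈ fluidDomain ζ, dx V₁ z + dy V₂ z = 0)
    (hφ : ContDiff ℝ 1 φ) (hφK : ∀ z : ℝ × ℝ, z.1 ∉ K → φ z = 0)
    {B a₁ a₂ b₁ b₂ : ℝ → ℝ} (hB : LocallyIntegrable B)
    (hb : ∀ᵐ x, ∀ y ∈ Ioo 0 (1 + ζ x), |V₁ (x, y)| ≤ B x ∧ |V₂ (x, y)| ≤ B x)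
    (ha₁ : HasSurfaceValues ζ V₁ a₁) (ha₂ : HasSurfaceValues ζ V₂ a₂)
    (hb₁ : HasBottomValues V₁ b₁) (hb₂ : HasBottomValues V₂ b₂) :
    ∫ z in fluidDomain ζ, (V₁ z * dx φ z + V₂ z * dy φ z) =
      (∫ x, φ (x, 1 + ζ x) * (a₂ x - deriv ζ x * a₁ x)) - ∫ x, φ (x, 0) * b₂ x := by
  have c0 := hζ.continuous
  have hDo := isOpen_fluidDomain c0
  obtain ⟨M, hM0, hM⟩ := exists_depth_bound c0 hK
  have cdφ : Continuous (fderiv ℝ φ) := hφ.continuous_fderiv (by norm_num)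
  have cdx : Continuous (dx φ) := cdφ.clm_apply continuous_const
  have cdy : Continuous (dy φ) := cdφ.clm_apply continuous_const
  obtain ⟨C₀, hC₀⟩ := (hK.prod (isCompact_Icc (a := (0 : ℝ)) (b := M))).exists_bound_of_continuousOn
    hφ.continuous.continuousOn
  obtain ⟨C₁, hC₁⟩ := (hK.prod (isCompact_Icc (a := (0 : ℝ)) (b := M))).exists_bound_of_continuousOn
    cdx.continuousOn
  obtain ⟨C₂, hC₂⟩ := (hK.prod (isCompact_Icc (a := (0 : ℝ)) (b := M))).exists_bound_of_continuousOn
    cdy.continuousOn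
  have hmemK : ∀ z ∈ fluidDomain ζ, z.1 ∈ K → z ∈ K ×ˢ Icc (0 : ℝ) M := fun z hz hzK =>
    ⟨hzK, hz.1.le, hz.2.le.trans (hM _ hzK)⟩
  have hBK : ∀ C : ℝ, Integrable (K.indicator fun x => C * B x) := fun C =>
    (integrable_indicator_iff hK.measurableSet).2 ((hB.integrableOn_isCompact hK).const_mul C)
  have hφ0 : ∀ z : ℝ × ℝ, z.1 ∉ K → φ =ᶠ[𝓝 z] fun _ => 0 := fun z hz => by
    filter_upwards [(hK.isClosed.isOpen_compl.preimage continuous_fst).mem_nhds hz] with w hw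
    exact hφK w hw
  have hdx0 : ∀ z : ℝ × ℝ, z.1 ∉ K → dx φ z = 0 := fun z hz => by
    rw [dx, (hφ0 z hz).fderiv_eq]; simp
  have hdy0 : ∀ z : ℝ × ℝ, z.1 ∉ K → dy φ z = 0 := fun z hz => by
    rw [dy, (hφ0 z hz).fderiv_eq]; simp
  have f₁ : ContDiffOn ℝ 1 (fun z => φ z * V₁ z) (fluidDomain ζ) := hφ.contDiffOn.mul h₁
  have f₂ : ContDiffOn ℝ 1 (fun z => φ z * V₂ z) (fluidDomain ζ) := hφ.contDiffOn.mul h₂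
  have hfd : ∀ V : ℝ × ℝ → ℝ, ContDiffOn ℝ 1 V (fluidDomain ζ) → ∀ z ∈ fluidDomain ζ, ∀ v,
      fderiv ℝ (fun z => φ z * V z) z v = φ z * fderiv ℝ V z v + V z * fderiv ℝ φ z v := by
    intro V hV z hz v
    rw [fderiv_fun_mul (hφ.differentiable (by norm_num) z)
      ((hV.differentiableOn (by norm_num)).differentiableAt (hDo.mem_nhds hz))]
    simp
  have hdivF : ∀ z ∈ fluidDomain ζ, V₁ z * dx φ z + V₂ z * dy φ z =
      dx (fun z => φ z * V₁ z) z + dy (fun z => φ z * V₂ z) z := by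
    intro z hz
    have e := hdiv z hz
    simp only [dx, dy] at e ⊢
    rw [hfd V₁ h₁ z hz, hfd V₂ h₂ z hz]
    linear_combination (- φ z) * e
  have hi : IntegrableOn (fun z => V₁ z * dx φ z + V₂ z * dy φ z) (fluidDomain ζ) := by
    have g := integrableOn_fst_of_support c0 hK (hBK (C₁ + C₂))
      fun x hx => indicator_of_notMem hx _
    refine Integrable.mono' g (ContinuousOn.aestronglyMeasurable
      ((h₁.continuousOn.mul cdx.continuousOn).add (h₂.continuousOn.mul cdy.continuousOn))
      hDo.measurableSet) ?_
    rw [ae_restrict_iff' hDo.measurableSet]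
    filter_upwards [ae_of_ae_fst hb] with z hz hzD
    by_cases hzK : z.1 ∈ K
    · obtain ⟨u1, u2⟩ := hz z.2 hzD
      have v1 := hC₁ z (hmemK z hzD hzK)
      have v2 := hC₂ z (hmemK z hzD hzK)
      rw [indicator_of_mem hzK]
      refine (norm_add_le _ _).trans ?_
      rw [norm_mul, norm_mul]
      have w1 := mul_le_mul u1 v1 (norm_nonneg _) ((abs_nonneg _).trans u1)
      have w2 := mul_le_mul u2 v2 (norm_nonneg _) ((abs_nonneg _).trans u1)
      simp only [Real.norm_eq_abs] at *
      linarith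
    · rw [indicator_of_notMem hzK, hdx0 z hzK, hdy0 z hzK]; simp
  -- The divergence of `φ V` is `V · ∇φ`, so no integrability of the derivatives of `V` is needed.
  have key := setIntegral_divergence (F₁ := fun z => φ z * V₁ z) (F₂ := fun z => φ z * V₂ z)
    (B := K.indicator fun x => C₀ * B x)
    (a₁ := fun x => φ (x, 1 + ζ x) * a₁ x) (a₂ := fun x => φ (x, 1 + ζ x) * a₂ x)
    (b₁ := fun x => φ (x, 0) * b₁ x) (b₂ := fun x => φ (x, 0) * b₂ x) hζ hd hK f₁ f₂
    (fun z _ hz => by simp only [hφK z hz, zero_mul]) (fun z _ hz => by simp only [hφK z hz, zero_mul])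
    (hBK C₀) ?_ ((integrableOn_congr_fun hdivF hDo.measurableSet).1 hi) ?_ ?_ ?_ ?_
  · rw [setIntegral_congr_fun hDo.measurableSet hdivF, key]
    congr 2; ext x; ring
  · filter_upwards [hb] with x hx y hy
    obtain ⟨u1, u2⟩ := hx y hy
    by_cases hxK : x ∈ K
    · have v := hC₀ (x, y) (hmemK _ hy hxK)
      rw [indicator_of_mem hxK, abs_mul, abs_mul]
      exact ⟨mul_le_mul v u1 (abs_nonneg _) ((norm_nonneg _).trans v),
        mul_le_mul v u2 (abs_nonneg _) ((norm_nonneg _).trans v)⟩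
    · rw [indicator_of_notMem hxK, hφK (x, y) hxK]; simp
  all_goals
    have hcs : ∀ x s, Tendsto (fun y => φ (x, y)) (𝓝 s) (𝓝 (φ (x, s))) := fun x s =>
      (hφ.continuous.comp (by fun_prop : Continuous fun y : ℝ => (x, y))).tendsto s
  · filter_upwards [ha₁] with x hx using (tendsto_nhdsWithin_of_tendsto_nhds (hcs x _)).mul hx
  · filter_upwards [ha₂] with x hx using (tendsto_nhdsWithin_of_tendsto_nhds (hcs x _)).mul hx
  · filter_upwards [hb₁] with x hx using (tendsto_nhdsWithin_of_tendsto_nhds (hcs x _)).mul hx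
  · filter_upwards [hb₂] with x hx using (tendsto_nhdsWithin_of_tendsto_nhds (hcs x _)).mul hx

theorem HasSurfaceValues.aestronglyMeasurable {V : ℝ × ℝ → ℝ} (hζ : Continuous ζ)
    (hd : ∀ x, 0 < 1 + ζ x) (hV : ContinuousOn V (fluidDomain ζ)) {a : ℝ → ℝ}
    (ha : HasSurfaceValues ζ V a) : AEStronglyMeasurable a := by
  have ht : Tendsto (fun n : ℕ => 1 - 1 / ((n : ℝ) + 2)) atTop (𝓝 1) := by
    have := (tendsto_one_div_add_atTop_nhds_zero_nat (𝕜 := ℝ)).comp (tendsto_add_atTop_nat 1)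
    have h2 := (tendsto_const_nhds (x := (1 : ℝ))).sub this
    rw [sub_zero] at h2
    refine h2.congr fun n => ?_
    simp only [Function.comp]; push_cast; ring
  have hs : ∀ n : ℕ, 1 - 1 / ((n : ℝ) + 2) ∈ Ioo (0 : ℝ) 1 := fun n => by
    have h0 : (0 : ℝ) < 1 / ((n : ℝ) + 2) := by positivity
    have h2 : 1 / ((n : ℝ) + 2) ≤ 1 / 2 := by apply one_div_le_one_div_of_le <;> norm_num
    exact ⟨by linarith, by linarith⟩
  refine aestronglyMeasurable_of_tendsto_ae atTop
    (f := fun (n : ℕ) x => V (x, (1 - 1 / ((n : ℝ) + 2)) * (1 + ζ x))) (fun n => ?_) ?_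
  · exact (hV.comp_continuous (by fun_prop) fun x => mul_depth_mem hd (hs n)).aestronglyMeasurable
  · filter_upwards [ha] with x hx
    refine hx.comp (tendsto_nhdsWithin_iff.2 ⟨by simpa using ht.mul_const (1 + ζ x), ?_⟩)
    exact Eventually.of_forall fun n => (mul_depth_mem (x := x) hd (hs n)).2

theorem HasBottomValues.aestronglyMeasurable {V : ℝ × ℝ → ℝ} (hζ : Continuous ζ)
    (hd : ∀ x, 0 < 1 + ζ x) (hV : ContinuousOn V (fluidDomain ζ)) {a : ℝ → ℝ}
    (ha : HasBottomValues V a) : AEStronglyMeasurable a := by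
  have ht : Tendsto (fun n : ℕ => 1 / ((n : ℝ) + 2)) atTop (𝓝 0) := by
    have := (tendsto_one_div_add_atTop_nhds_zero_nat (𝕜 := ℝ)).comp (tendsto_add_atTop_nat 1)
    refine this.congr fun n => ?_
    simp only [Function.comp]; push_cast; ring
  have hs : ∀ n : ℕ, 1 / ((n : ℝ) + 2) ∈ Ioo (0 : ℝ) 1 := fun n => by
    have h0 : (0 : ℝ) < 1 / ((n : ℝ) + 2) := by positivity
    have h2 : 1 / ((n : ℝ) + 2) ≤ 1 / 2 := by apply one_div_le_one_div_of_le <;> norm_num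
    exact ⟨by linarith, by linarith⟩
  refine aestronglyMeasurable_of_tendsto_ae atTop
    (f := fun (n : ℕ) x => V (x, (1 / ((n : ℝ) + 2)) * (1 + ζ x))) (fun n => ?_) ?_
  · exact (hV.comp_continuous (by fun_prop) fun x => mul_depth_mem hd (hs n)).aestronglyMeasurable
  · filter_upwards [ha] with x hx
    refine hx.comp (tendsto_nhdsWithin_iff.2 ⟨by simpa using ht.mul_const (1 + ζ x), ?_⟩)
    exact Eventually.of_forall fun n => (mul_depth_mem (x := x) hd (hs n)).1

theorem HasSurfaceValues.ae_abs_le {V : ℝ × ℝ → ℝ} (hd : ∀ x, 0 < 1 + ζ x) {a B : ℝ → ℝ}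
    (ha : HasSurfaceValues ζ V a) (hb : ∀ᵐ x, ∀ y ∈ Ioo 0 (1 + ζ x), |V (x, y)| ≤ B x) :
    ∀ᵐ x, |a x| ≤ B x := by
  filter_upwards [ha, hb] with x h1 h2
  exact le_of_tendsto h1.abs (by filter_upwards [Ioo_mem_nhdsLT (hd x)] with y hy using h2 y hy)

theorem HasBottomValues.ae_abs_le {V : ℝ × ℝ → ℝ} (hd : ∀ x, 0 < 1 + ζ x) {a B : ℝ → ℝ}
    (ha : HasBottomValues V a) (hb : ∀ᵐ x, ∀ y ∈ Ioo 0 (1 + ζ x), |V (x, y)| ≤ B x) :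
    ∀ᵐ x, |a x| ≤ B x := by
  filter_upwards [ha, hb] with x h1 h2
  exact le_of_tendsto h1.abs (by filter_upwards [Ioo_mem_nhdsGT (hd x)] with y hy using h2 y hy)

end DivergenceFree

/-! ### Boundary identities for the gradient and for the stress of a harmonic flow. -/

/-- A harmonic function on the fluid domain below a continuously differentiable surface, whose
gradient is `(0, 1)` up to a square integrable error with square integrable vertical derivative. -/
structure IsRegularFlow (ζ : ℝ → ℝ) (u : ℝ × ℝ → ℝ) : Prop where
  contDiff_surface : ContDiff ℝ 1 ζ
  depth_pos : ∀ x, 0 < 1 + ζ x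
  harmonic : IsHarmonicOn u (fluidDomain ζ)
  memLp_dx : MemLp (dx u) 2 (volume.restrict (fluidDomain ζ))
  memLp_dy_sub_one : MemLp (fun z => dy u z - 1) 2 (volume.restrict (fluidDomain ζ))
  memLp_dy_dx : MemLp (dy (dx u)) 2 (volume.restrict (fluidDomain ζ))
  memLp_dy_dy : MemLp (dy (dy u)) 2 (volume.restrict (fluidDomain ζ))

namespace IsRegularFlow

variable {ζ : ℝ → ℝ} {u : ℝ × ℝ → ℝ} (h : IsRegularFlow ζ u)

include h

theorem isOpen : IsOpen (fluidDomain ζ) := isOpen_fluidDomain h.contDiff_surface.continuous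

theorem contDiffOn_fderiv (v : ℝ × ℝ) :
    ContDiffOn ℝ 1 (fun z => fderiv ℝ u z v) (fluidDomain ζ) :=
  ((h.harmonic.contDiffOn 2).fderiv_of_isOpen h.isOpen (m := 1) (by norm_num)).clm_apply
    contDiffOn_const

theorem contDiffOn_dx : ContDiffOn ℝ 1 (dx u) (fluidDomain ζ) := h.contDiffOn_fderiv _

theorem contDiffOn_dy : ContDiffOn ℝ 1 (dy u) (fluidDomain ζ) := h.contDiffOn_fderiv _

theorem contDiffAt {z : ℝ × ℝ} (hz : z ∈ fluidDomain ζ) : ContDiffAt ℝ 2 u z :=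
  (h.harmonic.contDiffOn 2).contDiffAt (h.isOpen.mem_nhds hz)

theorem dx_dx_add_dy_dy {z : ℝ × ℝ} (hz : z ∈ fluidDomain ζ) : dx (dx u) z + dy (dy u) z = 0 :=
  h.harmonic.planeLaplacian_eq_zero h.isOpen hz

theorem dx_dy_eq {z : ℝ × ℝ} (hz : z ∈ fluidDomain ζ) : dx (dy u) z = dy (dx u) z := by
  have hc := h.contDiffAt hz
  have e1 : dx (dy u) z = _ := fderiv_fderiv_apply hc (0, 1) (1, 0)
  have e2 : dy (dx u) z = _ := fderiv_fderiv_apply hc (1, 0) (0, 1)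
  rw [e1, e2]
  exact (hc.isSymmSndFDerivAt (by simp)).eq _ _

theorem differentiableAt_dx {z : ℝ × ℝ} (hz : z ∈ fluidDomain ζ) : DifferentiableAt ℝ (dx u) z :=
  (h.contDiffOn_dx.differentiableOn (by norm_num)).differentiableAt (h.isOpen.mem_nhds hz)

theorem differentiableAt_dy {z : ℝ × ℝ} (hz : z ∈ fluidDomain ζ) : DifferentiableAt ℝ (dy u) z :=
  (h.contDiffOn_dy.differentiableOn (by norm_num)).differentiableAt (h.isOpen.mem_nhds hz)

omit h in
theorem dy_sub_one (f : ℝ × ℝ → ℝ) : dy (fun z => f z - 1) = dy f := by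
  ext z; simp only [dy]; rw [fderiv_sub_const]

theorem exists_surface_dx : ∃ a, HasSurfaceValues ζ (dx u) a :=
  exists_surfaceValues h.contDiff_surface.continuous h.depth_pos h.contDiffOn_dx h.memLp_dy_dx

theorem exists_surface_dy : ∃ b, HasSurfaceValues ζ (dy u) b :=
  exists_surfaceValues h.contDiff_surface.continuous h.depth_pos h.contDiffOn_dy h.memLp_dy_dy

theorem exists_bottom_dx : ∃ a, HasBottomValues (dx u) a :=
  exists_bottomValues h.contDiff_surface.continuous h.depth_pos h.contDiffOn_dx h.memLp_dy_dx

theorem exists_bottom_dy : ∃ b, HasBottomValues (dy u) b :=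
  exists_bottomValues h.contDiff_surface.continuous h.depth_pos h.contDiffOn_dy h.memLp_dy_dy

/-- On almost every vertical line, the gradient and its square are bounded by a locally integrable
function of the abscissa. -/
theorem exists_majorant : ∃ B : ℝ → ℝ, LocallyIntegrable B ∧ ∀ᵐ x, ∀ y ∈ Ioo 0 (1 + ζ x),
    |dx u (x, y)| ≤ B x ∧ |dy u (x, y)| ≤ B x ∧ dx u (x, y) ^ 2 + dy u (x, y) ^ 2 ≤ B x := by
  have c0 := h.contDiff_surface.continuous
  have hv := h.contDiffOn_dy.sub (contDiffOn_const (c := (1 : ℝ)))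
  have hm : MemLp (dy fun z => dy u z - 1) 2 (volume.restrict (fluidDomain ζ)) := by
    rw [dy_sub_one]; exact h.memLp_dy_dy
  have l1 := locallyIntegrable_lineMajorant c0 h.depth_pos h.memLp_dx h.memLp_dy_dx
  have l2 := locallyIntegrable_lineMajorant c0 h.depth_pos h.memLp_dy_sub_one hm
  -- The constants come from `q² ≤ 2 + 2 (q - 1)²`; the first powers are then bounded as well
  -- because of the summand `2`.
  refine ⟨fun x => 2 + lineMajorant ζ (dx u) x + 2 * lineMajorant ζ (fun z => dy u z - 1) x,
    ((locallyIntegrable_const 2).add l1).add (l2.smul (2 : ℝ)), ?_⟩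
  filter_upwards [ae_sq_le_lineMajorant c0 h.depth_pos h.contDiffOn_dx h.memLp_dx h.memLp_dy_dx,
    ae_sq_le_lineMajorant c0 h.depth_pos hv h.memLp_dy_sub_one hm] with x h1 h2 y hy
  have e1 := h1 y hy
  have e2 := h2 y hy
  set p := dx u (x, y)
  set q := dy u (x, y)
  refine ⟨abs_le.2 ⟨?_, ?_⟩, abs_le.2 ⟨?_, ?_⟩, ?_⟩ <;>
    nlinarith [sq_nonneg (p - 1), sq_nonneg (p + 1), sq_nonneg (q - 2), sq_nonneg (q - 1),
      sq_nonneg q, sq_nonneg p]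

section Boundary

variable {φ : ℝ × ℝ → ℝ} {K : Set ℝ} {a b a₀ b₀ : ℝ → ℝ} (hK : IsCompact K)
  (hφ : ContDiff ℝ 1 φ) (hφK : ∀ z : ℝ × ℝ, z.1 ∉ K → φ z = 0)
  (ha : HasSurfaceValues ζ (dx u) a) (hb : HasSurfaceValues ζ (dy u) b)
  (ha₀ : HasBottomValues (dx u) a₀)

include hK hφ hφK ha hb ha₀ in
-- The rotated gradient `(-u_y, u_x)` is divergence-free by symmetry of the second derivatives. Its
-- surface flux `a + ζ' b` is the tangential derivative of `u` along the surface.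
theorem setIntegral_curl :
    ∫ z in fluidDomain ζ, (-dy u z * dx φ z + dx u z * dy φ z) =
      (∫ x, φ (x, 1 + ζ x) * (a x + deriv ζ x * b x)) - ∫ x, φ (x, 0) * a₀ x := by
  obtain ⟨B, hB, hBb⟩ := h.exists_majorant
  obtain ⟨b₀, hb₀⟩ := h.exists_bottom_dy
  have := setIntegral_divergenceFree (V₁ := fun z => - dy u z) (V₂ := dx u) (a₁ := fun x => - b x)
    (a₂ := a) (b₁ := fun x => - b₀ x) (b₂ := a₀) (B := B)
    h.contDiff_surface h.depth_pos hK h.contDiffOn_dy.neg h.contDiffOn_dx (fun z hz => ?_) hφ hφK hB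
    ?_ ?_ ha ?_ ha₀
  · rw [this]
    congr 2; ext x; ring
  · have e : dx (fun z => - dy u z) z = - dx (dy u) z := by
      rw [dx, fderiv_fun_neg]; rfl
    rw [e, h.dx_dy_eq hz]; ring
  · filter_upwards [hBb] with x hx y hy
    exact ⟨by rw [abs_neg]; exact (hx y hy).2.1, (hx y hy).1⟩
  · filter_upwards [hb] with x hx using hx.neg
  · filter_upwards [hb₀] with x hx using hx.neg

include ha hb in
-- The integrand is the pairing of the stress field `(-2 u_x u_y, u_x² - u_y²)` with the gradient of
-- `w(x) y`. The divergence of the field is `-2 u_y Δu = 0`, and `w(x) y` vanishes on the bottom and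
-- equals `w (1 + ζ)` on the surface, so only a surface term remains.
theorem setIntegral_stress {w : ℝ → ℝ} (hw : ContDiff ℝ 1 w) (hc : HasCompactSupport w) :
    ∫ z in fluidDomain ζ, (w z.1 * dx u z ^ 2 - 2 * (deriv w z.1 * z.2) * dx u z * dy u z
        - w z.1 * dy u z ^ 2) =
      ∫ x, w x * (1 + ζ x) * (a x ^ 2 - b x ^ 2 + 2 * deriv ζ x * a x * b x) := by
  obtain ⟨B, hB, hBb⟩ := h.exists_majorant
  obtain ⟨a₀, ha₀⟩ := h.exists_bottom_dx
  obtain ⟨b₀, hb₀⟩ := h.exists_bottom_dy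
  have hwd : ∀ z v, fderiv ℝ (fun z : ℝ × ℝ => w z.1 * z.2) z v =
      v.1 * deriv w z.1 * z.2 + v.2 * w z.1 := fun z v => by
    have := fderiv_tensor (χ := fun y => y) (hw.differentiable (by norm_num)) differentiable_id z v.1 v.2
    simpa using this
  have := setIntegral_divergenceFree (φ := fun z => w z.1 * z.2) (K := tsupport w)
    (V₁ := fun z => - 2 * (dx u z * dy u z)) (V₂ := fun z => dx u z ^ 2 - dy u z ^ 2)
    (a₁ := fun x => - 2 * (a x * b x)) (a₂ := fun x => a x ^ 2 - b x ^ 2)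
    (b₁ := fun x => - 2 * (a₀ x * b₀ x)) (b₂ := fun x => a₀ x ^ 2 - b₀ x ^ 2) (B := B)
    h.contDiff_surface h.depth_pos hc (contDiffOn_const.mul (h.contDiffOn_dx.mul h.contDiffOn_dy))
    ((h.contDiffOn_dx.pow 2).sub (h.contDiffOn_dy.pow 2)) (fun z hz => ?_)
    ((hw.comp contDiff_fst).mul contDiff_snd)
    (fun z hz => by simp only [image_eq_zero_of_notMem_tsupport hz, zero_mul]) hB ?_ ?_ ?_ ?_ ?_
  · simp only [mul_zero, zero_mul, integral_zero, sub_zero] at this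
    have e : ∀ z, w z.1 * dx u z ^ 2 - 2 * (deriv w z.1 * z.2) * dx u z * dy u z
        - w z.1 * dy u z ^ 2 = -2 * (dx u z * dy u z) * dx (fun z => w z.1 * z.2) z +
          (dx u z ^ 2 - dy u z ^ 2) * dy (fun z => w z.1 * z.2) z := fun z => by
      have e1 : dx (fun z : ℝ × ℝ => w z.1 * z.2) z = deriv w z.1 * z.2 := by
        simp only [dx]; rw [hwd]; ring
      have e2 : dy (fun z : ℝ × ℝ => w z.1 * z.2) z = w z.1 := by
        simp only [dy]; rw [hwd]; ring
      rw [e1, e2]; ring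
    simp_rw [e]
    rw [this]
    congr 1; ext x; ring
  · have dp := (h.differentiableAt_dx hz).hasFDerivAt
    have dq := (h.differentiableAt_dy hz).hasFDerivAt
    have e1 := ((dp.mul dq).const_mul (-2)).fderiv
    have e2 := ((dp.pow 2).sub (dq.pow 2)).fderiv
    have e1' : dx (fun z => - 2 * (dx u z * dy u z)) z =
        -2 * (dx u z * dx (dy u) z + dy u z * dx (dx u) z) := by
      conv_lhs => unfold dx
      erw [e1]; simp [dx]; ring
    have e2' : dy (fun z => dx u z ^ 2 - dy u z ^ 2) z =
        2 * dx u z * dy (dx u) z - 2 * dy u z * dy (dy u) z := by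
      conv_lhs => unfold dy
      erw [e2]; simp [dy]
    rw [e1', e2', h.dx_dy_eq hz]
    linear_combination (-2 * dy u z) * h.dx_dx_add_dy_dy hz
  · filter_upwards [hBb] with x hx y hy
    have := (hx y hy).2.2
    set p := dx u (x, y)
    set q := dy u (x, y)
    refine ⟨abs_le.2 ⟨?_, ?_⟩, abs_le.2 ⟨?_, ?_⟩⟩ <;>
    nlinarith [sq_nonneg (p - q), sq_nonneg (p + q), sq_nonneg q, sq_nonneg p]
  · filter_upwards [ha, hb] with x h1 h2 using (h1.mul h2).const_mul _
  · filter_upwards [ha, hb] with x h1 h2 using (h1.pow 2).sub (h2.pow 2)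
  · filter_upwards [ha₀, hb₀] with x h1 h2 using (h1.mul h2).const_mul _
  · filter_upwards [ha₀, hb₀] with x h1 h2 using (h1.pow 2).sub (h2.pow 2)

end Boundary

end IsRegularFlow

/-! ### The Lagrange multiplier and its value at infinity. -/

section OneDim

theorem locallyIntegrable_continuous_mul {d f : ℝ → ℝ} (hd : Continuous d)
    (hf : LocallyIntegrable f) : LocallyIntegrable fun x => d x * f x := by
  rw [locallyIntegrable_iff]
  intro K hK
  exact (hf.integrableOn_isCompact hK).continuousOn_mul hd.continuousOn hK

theorem integrable_test_mul {w f : ℝ → ℝ} (hf : LocallyIntegrable f) (hw : Continuous w)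
    (hc : HasCompactSupport w) : Integrable fun x => w x * f x := by
  have := hf.integrable_smul_left_of_hasCompactSupport hw hc
  simpa only [smul_eq_mul] using this

/-- A function annihilated by the test functions that annihilate `d` is a multiple of `d`. -/
theorem exists_ae_eq_const_mul {d f : ℝ → ℝ} (hd : Continuous d) (hd0 : ∀ x, 0 < d x)
    (hf : LocallyIntegrable f)
    (h : ∀ w : ℝ → ℝ, ContDiff ℝ ∞ w → HasCompactSupport w → ∫ x, w x * d x = 0 →
      ∫ x, w x * f x = 0) : ∃ c, ∀ᵐ x, f x = c * d x := by
  -- A reference test function with `∫ w₁ d > 0`: subtracting a multiple of it makes any test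
  -- function annihilate `d`, and the multiplier is the ratio `∫ w₁ f / ∫ w₁ d`.
  let w₁ : ContDiffBump (0 : ℝ) := ⟨1, 2, by norm_num, by norm_num⟩
  have hdl : LocallyIntegrable d := hd.locallyIntegrable
  have hpos : 0 < ∫ x, w₁ x * d x := by
    refine Continuous.integral_pos_of_hasCompactSupport_nonneg_nonzero (w₁.continuous.mul hd)
      w₁.hasCompactSupport.mul_right (fun x => mul_nonneg w₁.nonneg (hd0 x).le) (x := 0) ?_
    rw [w₁.one_of_mem_closedBall (by simp [w₁])]
    simpa using (hd0 0).ne'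
  set I := ∫ x, w₁ x * d x with hI
  set J := ∫ x, w₁ x * f x with hJ
  refine ⟨J / I, ?_⟩
  have hcd := locallyIntegrable_continuous_mul (continuous_const (y := J / I)) hdl
  have := ae_eq_zero_of_integral_contDiff_smul_eq_zero (μ := volume) (hf.sub hcd) ?_
  · filter_upwards [this] with x hx
    simpa [sub_eq_zero] using hx
  · intro w hw hc
    have j1 := integrable_test_mul hf hw.continuous hc
    have j2 := integrable_test_mul hdl hw.continuous hc
    have k1 := integrable_test_mul hf w₁.continuous w₁.hasCompactSupport
    have k2 := integrable_test_mul hdl w₁.continuous w₁.hasCompactSupport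
    set A := ∫ x, w x * d x with hA
    have e := h (fun x => w x - A / I * w₁ x) (hw.sub (contDiff_const.mul w₁.contDiff))
      (hc.sub (w₁.hasCompactSupport.mul_left)) ?_
    · have e1 : ∀ x, (w x - A / I * w₁ x) * f x = w x * f x - A / I * (w₁ x * f x) := fun x => by ring
      simp_rw [e1] at e
      rw [integral_sub j1 (k1.const_mul _), integral_const_mul, ← hJ] at e
      have e2 : ∀ x, w x • (f - fun x => J / I * d x) x = w x * f x - J / I * (w x * d x) :=
        fun x => by simp only [Pi.sub_apply, smul_eq_mul]; ring
      simp_rw [e2]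
      rw [integral_sub j1 (j2.const_mul _), integral_const_mul, ← hA, ← e]
      ring
    · have e1 : ∀ x, (w x - A / I * w₁ x) * d x = w x * d x - A / I * (w₁ x * d x) := fun x => by ring
      simp_rw [e1]
      rw [integral_sub j2 (k2.const_mul _), integral_const_mul, ← hA, ← hI]
      field_simp; ring

/-- By Markov's inequality a nonzero `k` would force `S`, and with it the whole line, to have finite
measure. -/
theorem eq_zero_of_ae_abs_le_integrable {S : Set ℝ} (hS : volume Sᶜ < ⊤) {g : ℝ → ℝ} {k : ℝ}
    (hg : Integrable g) (h : ∀ᵐ x, x ∈ S → |k| ≤ g x) : k = 0 := by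
  by_contra hk
  have hk' : 0 < |k| := abs_pos.2 hk
  have h1 := hg.measure_norm_ge_lt_top hk'
  have h2 : volume S ≤ volume {x | |k| ≤ ‖g x‖} := by
    refine measure_mono_ae ?_
    filter_upwards [h] with x hx hxS
    exact (hx hxS).trans (le_abs_self _)
  have h3 : volume (univ : Set ℝ) < ⊤ := by
    rw [← union_compl_self S]
    exact (measure_union_le _ _).trans_lt (ENNReal.add_lt_top.2 ⟨h2.trans_lt h1, hS⟩)
  simp at h3

end OneDim

/-! ### Kinematic and Bernoulli conditions. -/

section Regularity

variable {m lam : ℝ} {δ : ℝ≥0∞} {ψ u : ℝ × ℝ → ℝ} {ζ : ℝ → ℝ}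

theorem ae_eq_fderiv_of_harmonic (hζ : Continuous ζ) {v : ℝ × ℝ} {g : ℝ × ℝ → ℝ}
    (hg : HasWeakDeriv univ v ψ g) (hψ : ψ =ᵐ[volume.restrict (fluidDomain ζ)] u)
    (hu : IsHarmonicOn u (fluidDomain ζ)) : ∀ᵐ z, z ∈ fluidDomain ζ → g z = fderiv ℝ u z v := by
  have hD := isOpen_fluidDomain hζ
  rw [EventuallyEq, ae_restrict_iff' hD.measurableSet] at hψ
  exact ((hg.mono (subset_univ _)).congr hD hψ (Eventually.of_forall fun _ _ => rfl)).ae_eq hD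
    (hasWeakDeriv_of_contDiffOn hD (hu.contDiffOn 1) v)

theorem Admissible.ae_wdx_eq (h : Admissible m ψ ζ)
    (hψ : ψ =ᵐ[volume.restrict (fluidDomain ζ)] u) (hu : IsHarmonicOn u (fluidDomain ζ)) :
    ∀ᵐ z, z ∈ fluidDomain ζ → wdx ψ z = dx u z :=
  ae_eq_fderiv_of_harmonic h.continuous_surface h.hasWeakDeriv_wdx hψ hu

theorem Admissible.ae_wdy_eq (h : Admissible m ψ ζ)
    (hψ : ψ =ᵐ[volume.restrict (fluidDomain ζ)] u) (hu : IsHarmonicOn u (fluidDomain ζ)) :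
    ∀ᵐ z, z ∈ fluidDomain ζ → wdy ψ z = dy u z :=
  ae_eq_fderiv_of_harmonic h.continuous_surface h.hasWeakDeriv_wdy hψ hu

theorem memLp_dy_of_hasWeakDeriv {D : Set (ℝ × ℝ)} (hD : IsOpen D) {f g k : ℝ × ℝ → ℝ}
    (hk : HasWeakDeriv D (0, 1) f k) (hk2 : MemLp k 2 (volume.restrict D))
    (hf : ∀ᵐ z, z ∈ D → f z = g z) (hg : ContDiffOn ℝ 1 g D) :
    MemLp (dy g) 2 (volume.restrict D) := by
  have := (hk.congr hD hf (Eventually.of_forall fun _ _ => rfl)).ae_eq hD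
    (hasWeakDeriv_of_contDiffOn hD hg (0, 1))
  exact hk2.ae_eq ((ae_restrict_iff' hD.measurableSet).2 this)

theorem Admissible.isRegularFlow (h : Admissible m ψ ζ)
    (hψ : ψ =ᵐ[volume.restrict (fluidDomain ζ)] u) (hu : IsHarmonicOn u (fluidDomain ζ))
    (hζ : ContDiff ℝ 1 ζ) (h2 : IsH2 ψ ζ) : IsRegularFlow ζ u := by
  have hD := isOpen_fluidDomain h.continuous_surface
  have ex := h.ae_wdx_eq hψ hu
  have ey := h.ae_wdy_eq hψ hu
  have hcd : ∀ v : ℝ × ℝ, ContDiffOn ℝ 1 (fun z => fderiv ℝ u z v) (fluidDomain ζ) := fun v =>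
    ((hu.contDiffOn 2).fderiv_of_isOpen hD (m := 1) (by norm_num)).clm_apply contDiffOn_const
  obtain ⟨k₁, hk₁, hm₁⟩ := h2 (wdx ψ) (by simp) (0, 1) (by simp)
  obtain ⟨k₂, hk₂, hm₂⟩ := h2 (wdy ψ) (by simp) (0, 1) (by simp)
  refine ⟨hζ, h.depth_pos, hu, ?_, ?_, memLp_dy_of_hasWeakDeriv hD hk₁ hm₁ ex (hcd _),
    memLp_dy_of_hasWeakDeriv hD hk₂ hm₂ ey (hcd _)⟩
  · exact h.memLp_wdx.ae_eq ((ae_restrict_iff' hD.measurableSet).2 ex)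
  · refine h.memLp_wdy_sub_one.ae_eq ((ae_restrict_iff' hD.measurableSet).2 ?_)
    filter_upwards [ey] with z hz hzD
    rw [hz hzD]

/-- Mixed derivatives of the test function commute. The point is that `φ` may cross the boundary
curves: weak differentiability of the continuation over the whole plane encodes the boundary
conditions. -/
theorem Admissible.integral_curl (h : Admissible m ψ ζ) {φ : ℝ × ℝ → ℝ} (hφ : ContDiff ℝ ∞ φ)
    (hc : HasCompactSupport φ) : ∫ z, (-wdy ψ z * dx φ z + wdx ψ z * dy φ z) = 0 := by
  have c := contDiff_fderiv_apply hφ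
  have s := hasCompactSupport_fderiv_apply hc
  have e1 := h.hasWeakDeriv_wdx.integral_eq _ (c (0, 1)) (s (0, 1)) (subset_univ _)
  have e2 := h.hasWeakDeriv_wdy.integral_eq _ (c (1, 0)) (s (1, 0)) (subset_univ _)
  have hsymm : ∀ z, fderiv ℝ (fun z => fderiv ℝ φ z (0, 1)) z (1, 0) =
      fderiv ℝ (fun z => fderiv ℝ φ z (1, 0)) z (0, 1) := fun z => by
    have hc2 : ContDiffAt ℝ 2 φ z := (hφ.of_le two_le_infty).contDiffAt
    rw [fderiv_fderiv_apply hc2, fderiv_fderiv_apply hc2]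
    exact (hc2.isSymmSndFDerivAt (by simp)).eq _ _
  simp_rw [hsymm] at e1
  have i1 := integrable_mul_test h.hasWeakDeriv_wdx.2 (c (0, 1)).continuous (s (0, 1)) (subset_univ _)
  have i2 := integrable_mul_test h.hasWeakDeriv_wdy.2 (c (1, 0)).continuous (s (1, 0)) (subset_univ _)
  simp only [dx, dy, neg_mul]
  have e : ∀ z, -(wdy ψ z * fderiv ℝ φ z (1, 0)) + wdx ψ z * fderiv ℝ φ z (0, 1) =
      wdx ψ z * fderiv ℝ φ z (0, 1) - wdy ψ z * fderiv ℝ φ z (1, 0) := fun z => by ring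
  simp_rw [e]
  rw [integral_sub i1 i2]
  linarith

theorem Admissible.setIntegral_curl (h : Admissible m ψ ζ)
    (hψ : ψ =ᵐ[volume.restrict (fluidDomain ζ)] u) (hu : IsHarmonicOn u (fluidDomain ζ))
    {φ : ℝ × ℝ → ℝ} (hφ : ContDiff ℝ ∞ φ) (hc : HasCompactSupport φ) :
    ∫ z in fluidDomain ζ, (-dy u z * dx φ z + dx u z * dy φ z) = 0 := by
  have hD := isOpen_fluidDomain h.continuous_surface
  rw [← h.integral_curl hφ hc, ← setIntegral_eq_integral_of_ae_compl_eq_zero (s := fluidDomain ζ)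
    (f := fun z => -wdy ψ z * dx φ z + wdx ψ z * dy φ z)]
  · refine setIntegral_congr_ae hD.measurableSet ?_
    filter_upwards [h.ae_wdx_eq hψ hu, h.ae_wdy_eq hψ hu] with z h1 h2 hz
    rw [h1 hz, h2 hz]
  · filter_upwards [h.wdx_off, h.wdy_off] with z h1 h2 hz
    rw [h1 hz, h2 hz]; simp

variable {a b a₀ : ℝ → ℝ}

/-- The kinematic conditions on the free surface and the bottom. -/
theorem Admissible.ae_kinematic (h : Admissible m ψ ζ)
    (hψ : ψ =ᵐ[volume.restrict (fluidDomain ζ)] u) (hr : IsRegularFlow ζ u)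
    (ha : HasSurfaceValues ζ (dx u) a) (hb : HasSurfaceValues ζ (dy u) b)
    (ha₀ : HasBottomValues (dx u) a₀) :
    ∀ᵐ x, a x + deriv ζ x * b x = 0 ∧ a₀ x = 0 := by
  have c0 := h.continuous_surface
  have c1 : Continuous (deriv ζ) := hr.contDiff_surface.continuous_deriv le_rfl
  obtain ⟨B, hB, hBb⟩ := hr.exists_majorant
  have hbx : ∀ᵐ x, ∀ y ∈ Ioo 0 (1 + ζ x), |dx u (x, y)| ≤ B x := by
    filter_upwards [hBb] with x hx y hy using (hx y hy).1
  have hby : ∀ᵐ x, ∀ y ∈ Ioo 0 (1 + ζ x), |dy u (x, y)| ≤ B x := by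
    filter_upwards [hBb] with x hx y hy using (hx y hy).2.1
  have hloc : ∀ {f : ℝ → ℝ}, AEStronglyMeasurable f → (∀ᵐ x, |f x| ≤ B x) → LocallyIntegrable f :=
    fun hf hfb => hB.mono hf (by
      filter_upwards [hfb] with x hx using hx.trans (le_abs_self _))
  have la := hloc (ha.aestronglyMeasurable c0 h.depth_pos hr.contDiffOn_dx.continuousOn)
    (ha.ae_abs_le h.depth_pos hbx)
  have lb := hloc (hb.aestronglyMeasurable c0 h.depth_pos hr.contDiffOn_dy.continuousOn)
    (hb.ae_abs_le h.depth_pos hby)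
  have la₀ := hloc (ha₀.aestronglyMeasurable c0 h.depth_pos hr.contDiffOn_dx.continuousOn)
    (ha₀.ae_abs_le h.depth_pos hbx)
  have lab : LocallyIntegrable fun x => a x + deriv ζ x * b x :=
    la.add (locallyIntegrable_continuous_mul c1 lb)
  -- Product test functions `ρ(x) χ(y)` localize in `x` and leave one relation between surface and
  -- bottom values for each `χ`.
  have key : ∀ χ : ℝ → ℝ, ContDiff ℝ ∞ χ → HasCompactSupport χ →
      ∀ᵐ x, χ (1 + ζ x) * (a x + deriv ζ x * b x) = χ 0 * a₀ x := by
    intro χ hχ hχc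
    have l1 := locallyIntegrable_continuous_mul (d := fun x => χ (1 + ζ x))
      (hχ.continuous.comp (continuous_const.add c0)) lab
    have l2 := locallyIntegrable_continuous_mul (continuous_const (y := χ 0)) la₀
    have := ae_eq_zero_of_integral_contDiff_smul_eq_zero (μ := volume) (l1.sub l2) ?_
    · filter_upwards [this] with x hx
      simpa [sub_eq_zero] using hx
    · intro ρ hρ hρc
      have hφ : ContDiff ℝ ∞ fun z : ℝ × ℝ => ρ z.1 * χ z.2 :=
        (hρ.comp contDiff_fst).mul (hχ.comp contDiff_snd)
      have e := h.setIntegral_curl hψ hr.harmonic hφ (hasCompactSupport_tensor hρc hχc)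
      rw [hr.setIntegral_curl hρc (hφ.of_le (by exact_mod_cast le_top))
        (fun z hz => by simp only [image_eq_zero_of_notMem_tsupport hz, zero_mul]) ha hb ha₀] at e
      have i1 := integrable_test_mul l1 hρ.continuous hρc
      have i2 := integrable_test_mul l2 hρ.continuous hρc
      refine Eq.trans ?_ e
      rw [← integral_sub]
      · congr 1; ext x
        simp only [Pi.sub_apply, smul_eq_mul]; ring
      · refine i1.congr (Eventually.of_forall fun x => ?_)
        simp only; ring
      · refine i2.congr (Eventually.of_forall fun x => ?_)
        simp only; ring
  let χ : ℕ → ContDiffBump (0 : ℝ) := fun n => ⟨n + 1, n + 2, by positivity, by linarith⟩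
  -- Two choices of vertical factor separate the boundaries: `y χ` vanishes at the bottom and
  -- isolates the surface, after which `χ`, equal to `1` at both, yields the bottom.
  have hk0 := ae_all_iff.2 fun n => key (χ n) (χ n).contDiff (χ n).hasCompactSupport
  have hk1 := ae_all_iff.2 fun n => key (fun y => y * χ n y) (contDiff_id.mul (χ n).contDiff)
    (χ n).hasCompactSupport.mul_left
  filter_upwards [hk0, hk1] with x h0 h1
  obtain ⟨n, hn⟩ := exists_nat_ge (1 + ζ x)
  have hd := h.depth_pos x
  have e1 : χ n (1 + ζ x) = 1 := (χ n).one_of_mem_closedBall (by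
    simp only [χ, Metric.mem_closedBall, Real.dist_eq, sub_zero, abs_of_pos hd]; linarith)
  have e0 : χ n 0 = 1 := (χ n).one_of_mem_closedBall (by simp [χ]; positivity)
  have h0 := h0 n
  have h1 := h1 n
  rw [e1, e0] at h0
  rw [e1] at h1
  have h2 : a x + deriv ζ x * b x = 0 := by
    simpa [hd.ne'] using h1
  exact ⟨h2, by linarith⟩

/-- The Bernoulli condition on the free surface. -/
theorem IsMinimizer.ae_bernoulli (hδ : 0 < δ) (h : IsMinimizer m δ lam ψ ζ)
    (hψ : ψ =ᵐ[volume.restrict (fluidDomain ζ)] u) (hr : IsRegularFlow ζ u)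
    (ha : HasSurfaceValues ζ (dx u) a) (hb : HasSurfaceValues ζ (dy u) b) :
    ∀ᵐ x, a x ^ 2 + b x ^ 2 + 2 * lam * ζ x = 1 := by
  have hA := h.admissible
  have c0 := hA.continuous_surface
  have hD := hr.isOpen
  have cd : Continuous fun x => 1 + ζ x := continuous_const.add c0
  obtain ⟨a₀, ha₀⟩ := hr.exists_bottom_dx
  have hkin := hA.ae_kinematic hψ hr ha hb ha₀
  obtain ⟨B, hB, hBb⟩ := hr.exists_majorant
  have ma := ha.aestronglyMeasurable c0 hA.depth_pos hr.contDiffOn_dx.continuousOn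
  have mb := hb.aestronglyMeasurable c0 hA.depth_pos hr.contDiffOn_dy.continuousOn
  have lab : LocallyIntegrable fun x => a x ^ 2 + b x ^ 2 := by
    refine hB.mono ((ma.pow 2).add (mb.pow 2)) ?_
    have hs : HasSurfaceValues ζ (fun z => dx u z ^ 2 + dy u z ^ 2) fun x => a x ^ 2 + b x ^ 2 := by
      filter_upwards [ha, hb] with x h1 h2 using (h1.pow 2).add (h2.pow 2)
    have := hs.ae_abs_le hA.depth_pos (B := B) (by
      filter_upwards [hBb] with x hx y hy
      rw [abs_of_nonneg (by positivity)]; exact (hx y hy).2.2)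
    filter_upwards [this] with x hx using hx.trans (le_abs_self _)
  have lz : LocallyIntegrable fun x => 2 * lam * ζ x :=
    (continuous_const.mul c0).locallyIntegrable
  have l1 := locallyIntegrable_continuous_mul cd lab
  have l2 := locallyIntegrable_continuous_mul cd lz
  obtain ⟨c, hc⟩ := exists_ae_eq_const_mul cd hA.depth_pos (l1.add l2) fun w hw hwc hw0 => by
    have e1 := h.integral_stretchingVariation hδ hw hwc hw0
    have e2 := hr.setIntegral_stress ha hb (hw.of_le (by exact_mod_cast le_top)) hwc
    have e3 : ∫ z in fluidDomain ζ, stretchingVariation ψ w z =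
        ∫ z in fluidDomain ζ, (w z.1 * dx u z ^ 2 - 2 * (deriv w z.1 * z.2) * dx u z * dy u z
        - w z.1 * dy u z ^ 2) := by
      refine setIntegral_congr_ae hD.measurableSet ?_
      filter_upwards [hA.ae_wdx_eq hψ hr.harmonic, hA.ae_wdy_eq hψ hr.harmonic] with z h1 h2 hz
      rw [stretchingVariation, h1 hz, h2 hz]
    -- By the kinematic condition `ζ' b = -a`, the cross term is `-2 a²`.
    have e4 : ∫ x, w x * (1 + ζ x) * (a x ^ 2 - b x ^ 2 + 2 * deriv ζ x * a x * b x) =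
        ∫ x, -(w x * ((1 + ζ x) * (a x ^ 2 + b x ^ 2))) := by
      refine integral_congr_ae ?_
      filter_upwards [hkin] with x hx
      linear_combination (2 * w x * (1 + ζ x) * a x) * hx.1
    have e5 : ∫ x, w x * ((1 + ζ x) * (2 * lam * ζ x)) =
        2 * lam * ∫ x, ζ x * (w x * (1 + ζ x)) := by
      rw [← integral_const_mul]; congr 1; ext x; ring
    rw [e3, e2, e4, integral_neg, ← e5] at e1
    simp only [Pi.add_apply, mul_add (w _)]
    rw [integral_add (integrable_test_mul l1 hw.continuous hwc)
      (integrable_test_mul l2 hw.continuous hwc), ← e1]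
    ring
  have hc' : ∀ᵐ x, a x ^ 2 + b x ^ 2 + 2 * lam * ζ x = c := by
    filter_upwards [hc] with x hx
    have hd := (hA.depth_pos x).ne'
    refine mul_left_cancel₀ hd ?_
    simp only [Pi.add_apply] at hx
    linear_combination hx
  -- The constant is read off at infinity: `c - 1` is controlled by `a²`, `b - 1` and `ζ`, all small
  -- outside sets of finite measure.
  suffices hk : c - 1 = 0 by
    filter_upwards [hc'] with x hx
    rw [hx]; linarith
  by_contra hk
  have hk' : 0 < |c - 1| := abs_pos.2 hk
  set k := |c - 1| with hkdef
  obtain ⟨H₁, i₁, hH₁⟩ := exists_integrable_surface_bound c0 hr.contDiffOn_dx hr.memLp_dx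
    hr.memLp_dy_dx ha
  have hb1 : HasSurfaceValues ζ (fun z => dy u z - 1) fun x => b x - 1 := by
    filter_upwards [hb] with x hx using hx.sub_const 1
  obtain ⟨H₂, i₂, hH₂⟩ := exists_integrable_surface_bound c0
    (hr.contDiffOn_dy.sub (contDiffOn_const (c := (1 : ℝ)))) hr.memLp_dy_sub_one
    (by rw [IsRegularFlow.dy_sub_one]; exact hr.memLp_dy_dy) hb1
  -- Where the depth is below `1/2` one has `|ζ| > 1/2`, which by integrability happens only on a
  -- set of finite measure.
  have hS : volume {x : ℝ | 1 / 2 ≤ 1 + ζ x}ᶜ < ⊤ := by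
    refine (measure_mono fun x hx => ?_).trans_lt
      (hA.integrable_surface.measure_norm_ge_lt_top (show (0 : ℝ) < 1 / 2 by norm_num))
    have : ¬ (1 / 2 ≤ 1 + ζ x) := hx
    have h2 : 1 / 2 ≤ -ζ x := by linarith
    exact h2.trans (neg_le_abs _)
  have hg : Integrable fun x => H₁ x + (1 + 2 / k) * H₂ x + 2 * |lam| * |ζ x| :=
    (i₁.add (i₂.const_mul _)).add (hA.integrable_surface.abs.const_mul _)
  have := eq_zero_of_ae_abs_le_integrable (k := k / 2) hS hg ?_
  · linarith
  · filter_upwards [hc', hH₁, hH₂] with x e1 e2 e3 hx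
    have e2 := e2 hx
    have e3 := e3 hx
    rw [abs_of_pos (by positivity)]
    -- The linear term `b - 1` is only square integrable. Young's inequality is weighted so that
    -- half of `k` absorbs the constant and half remains.
    have t1 : 2 * |b x - 1| ≤ k / 2 + 2 / k * (b x - 1) ^ 2 := by
      rw [← sub_nonneg]
      have : k / 2 + 2 / k * (b x - 1) ^ 2 - 2 * |b x - 1| = (k - 2 * |b x - 1|) ^ 2 / (2 * k) := by
        rw [← sq_abs (b x - 1)]; field_simp; ring
      rw [this]; positivity
    have t2 : k ≤ a x ^ 2 + (b x - 1) ^ 2 + 2 * |b x - 1| + 2 * |lam| * |ζ x| := by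
      have : c - 1 = a x ^ 2 + (b x - 1) ^ 2 + 2 * (b x - 1) + 2 * lam * ζ x := by rw [← e1]; ring
      rw [hkdef, this]
      refine (abs_add_le _ _).trans (add_le_add ((abs_add_le _ _).trans (add_le_add ?_ ?_)) ?_)
      · rw [abs_of_nonneg (by positivity)]
      · rw [abs_mul, abs_two]
      · rw [abs_mul, abs_mul, abs_two]
    have t3 : 2 / k * (b x - 1) ^ 2 ≤ 2 / k * H₂ x := by gcongr
    linarith

end Regularity

/-! ### The Poincaré lemma and the velocity potential. -/

section Potential

variable {ζ : ℝ → ℝ}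

/-- The fluid domain need not be star-shaped. A box that reaches from a given point to the curve at
half depth is convex, and on it local primitives exist and can be compared with the global formula.
-/
theorem exists_box {x₀ y₀ : ℝ} (hζ : Continuous ζ) (hz : (x₀, y₀) ∈ fluidDomain ζ) :
    ∃ r > 0, ∃ lo hi : ℝ, y₀ ∈ Ioo lo hi ∧ ∀ x ∈ Ioo (x₀ - r) (x₀ + r),
      (1 + ζ x) / 2 ∈ Ioo lo hi ∧ ∀ y ∈ Ioo lo hi, (x, y) ∈ fluidDomain ζ := by
  obtain ⟨h1, h2⟩ : 0 < y₀ ∧ y₀ < 1 + ζ x₀ := hz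
  have hd : 0 < 1 + ζ x₀ := h1.trans h2
  set c₀ := (1 + ζ x₀) / 2 with hc₀
  set lo := min c₀ y₀ / 2 with hlo
  set hi := (max c₀ y₀ + (1 + ζ x₀)) / 2 with hhi
  have m0 : 0 < min c₀ y₀ := lt_min (by positivity) h1
  have m1 : max c₀ y₀ < 1 + ζ x₀ := max_lt (by linarith) h2
  have m2 := min_le_left c₀ y₀
  have m3 := min_le_right c₀ y₀
  have m4 := le_max_left c₀ y₀
  have m5 := le_max_right c₀ y₀
  have cc : Continuous fun x => (1 + ζ x) / 2 := by fun_prop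
  have cd : Continuous fun x => 1 + ζ x := by fun_prop
  have e1 : ∀ᶠ x in 𝓝 x₀, lo < (1 + ζ x) / 2 := cc.continuousAt.eventually_const_lt (by
    change lo < c₀; linarith)
  have e2 : ∀ᶠ x in 𝓝 x₀, (1 + ζ x) / 2 < hi := cc.continuousAt.eventually_lt_const (by
    change c₀ < hi; linarith)
  have e3 : ∀ᶠ x in 𝓝 x₀, hi < 1 + ζ x := cd.continuousAt.eventually_const_lt (by linarith)
  obtain ⟨r, hr, h⟩ := Metric.eventually_nhds_iff_ball.1 (e1.and (e2.and e3))
  refine ⟨r, hr, lo, hi, ⟨by linarith, by linarith⟩, fun x hx => ?_⟩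
  obtain ⟨f1, f2, f3⟩ := h x (by rwa [Real.ball_eq_Ioo])
  exact ⟨⟨f1, f2⟩, fun y hy => ⟨(by linarith : 0 < lo).trans hy.1, hy.2.trans f3⟩⟩

/-- The Poincaré lemma in the fluid domain. -/
theorem exists_potential (hζ : ContDiff ℝ 1 ζ) (hd : ∀ x, 0 < 1 + ζ x)
    {α : ℝ × ℝ → (ℝ × ℝ →L[ℝ] ℝ)} (hα : DifferentiableOn ℝ α (fluidDomain ζ))
    (hsymm : ∀ z ∈ fluidDomain ζ, ∀ v w, fderiv ℝ α z v w = fderiv ℝ α z w v) :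
    ∃ φ : ℝ × ℝ → ℝ, ∀ z ∈ fluidDomain ζ, HasFDerivAt φ (α z) z := by
  have c0 := hζ.continuous
  have c1 : Continuous (deriv ζ) := hζ.continuous_deriv le_rfl
  set c : ℝ → ℝ := fun x => (1 + ζ x) / 2 with hc
  have hcm : ∀ x, (x, c x) ∈ fluidDomain ζ := fun x =>
    ⟨by have := hd x; simp only [hc]; positivity, by have := hd x; simp only [hc]; linarith⟩
  have hcd : ∀ x, HasDerivAt c (deriv ζ x / 2) x := fun x =>
    ((hζ.differentiable (by norm_num) x).hasDerivAt.const_add 1).div_const 2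
  set g : ℝ → ℝ := fun x => α (x, c x) (1, deriv ζ x / 2) with hg
  have hgc : Continuous g := by
    have : Continuous fun x => α (x, c x) := hα.continuousOn.comp_continuous
      (by simp only [hc]; fun_prop) hcm
    exact this.clm_apply (by fun_prop)
  -- The form is integrated along the curve at half depth and then vertically; such paths never
  -- leave the domain. On a box as above this differs from a local primitive by a constant.
  refine ⟨fun z => (∫ s in (0 : ℝ)..z.1, g s) + ∫ s in (c z.1)..z.2, α (z.1, s) (0, 1), ?_⟩
  rintro ⟨x₀, y₀⟩ hz
  obtain ⟨r, hr, lo, hi, hy₀, hbox⟩ := exists_box c0 hz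
  set R : Set (ℝ × ℝ) := Ioo (x₀ - r) (x₀ + r) ×ˢ Ioo lo hi with hR
  have hRD : R ⊆ fluidDomain ζ := fun z hz => (hbox z.1 hz.1).2 z.2 hz.2
  have hRo : IsOpen R := isOpen_Ioo.prod isOpen_Ioo
  have hx₀ : x₀ ∈ Ioo (x₀ - r) (x₀ + r) := ⟨by linarith, by linarith⟩
  have hz₀ : (x₀, y₀) ∈ R := ⟨hx₀, hy₀⟩
  obtain ⟨F, hF⟩ := ((convex_Ioo (x₀ - r) (x₀ + r)).prod
    (convex_Ioo lo hi)).exists_forall_hasFDerivAt_of_fderiv_symmetric hRo (hα.mono hRD)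
    fun a ha v w => hsymm a (hRD ha) v w
  refine ((hF _ hz₀).add_const ((∫ s in (0 : ℝ)..x₀, g s) - F (x₀, c x₀))).congr_of_eventuallyEq ?_
  filter_upwards [hRo.mem_nhds hz₀] with z hzR
  have e1 : ∫ s in x₀..z.1, g s = F (z.1, c z.1) - F (x₀, c x₀) := by
    refine intervalIntegral.integral_eq_sub_of_hasDerivAt (f := fun s => F (s, c s))
      (fun s hs => ?_) (hgc.intervalIntegrable _ _)
    have hs' : s ∈ Ioo (x₀ - r) (x₀ + r) := ordConnected_Ioo.uIcc_subset hx₀ hzR.1 hs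
    exact (hF (s, c s) ⟨hs', (hbox s hs').1⟩).comp_hasDerivAt s
      ((hasDerivAt_id s).prodMk (hcd s))
  have e2 : ∫ s in (c z.1)..z.2, α (z.1, s) (0, 1) = F z - F (z.1, c z.1) := by
    have hsub : uIcc (c z.1) z.2 ⊆ Ioo lo hi :=
      ordConnected_Ioo.uIcc_subset (hbox _ hzR.1).1 hzR.2
    refine intervalIntegral.integral_eq_sub_of_hasDerivAt (f := fun s => F (z.1, s))
      (fun s hs => ?_) ?_
    · exact (hF (z.1, s) ⟨hzR.1, hsub hs⟩).comp_hasDerivAt s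
        ((hasDerivAt_const s z.1).prodMk (hasDerivAt_id s))
    · refine ContinuousOn.intervalIntegrable ?_
      exact (hα.continuousOn.comp (f := fun s => (z.1, s)) (by fun_prop)
        fun s hs => hRD ⟨hzR.1, hsub hs⟩).clm_apply continuousOn_const
  rw [← intervalIntegral.integral_interval_sub_left (hgc.intervalIntegrable 0 z.1)
    (hgc.intervalIntegrable 0 x₀)] at e1
  linarith

end Potential

namespace IsRegularFlow

variable {ζ : ℝ → ℝ} {u : ℝ × ℝ → ℝ}

/-- A stream function has a harmonic conjugate, the velocity potential. -/
theorem exists_conjugate (h : IsRegularFlow ζ u) : ∃ φ : ℝ × ℝ → ℝ,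
    (∀ z ∈ fluidDomain ζ, dx φ z = dy u z ∧ dy φ z = - dx u z) ∧ IsHarmonicOn φ (fluidDomain ζ) := by
  -- The form `u_y dx - u_x dy`, which is closed exactly because `u` is harmonic.
  let α : ℝ × ℝ → (ℝ × ℝ →L[ℝ] ℝ) := fun z =>
    dy u z • ContinuousLinearMap.fst ℝ ℝ ℝ - dx u z • ContinuousLinearMap.snd ℝ ℝ ℝ
  have hα : ContDiffOn ℝ 1 α (fluidDomain ζ) :=
    (h.contDiffOn_dy.smul contDiffOn_const).sub (h.contDiffOn_dx.smul contDiffOn_const)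
  have hd : ∀ (f : ℝ × ℝ → ℝ) z (v : ℝ × ℝ), fderiv ℝ f z v = v.1 * dx f z + v.2 * dy f z := by
    intro f z v
    have : v = v.1 • ((1 : ℝ), (0 : ℝ)) + v.2 • ((0 : ℝ), (1 : ℝ)) := by ext <;> simp
    conv_lhs => rw [this]
    rw [map_add, map_smul, map_smul]; rfl
  obtain ⟨φ, hφ⟩ := exists_potential h.contDiff_surface h.depth_pos
    (hα.differentiableOn (by norm_num)) fun z hz v w => by
      have e : HasFDerivAt α _ z :=
        ((h.differentiableAt_dy hz).hasFDerivAt.smul_const (ContinuousLinearMap.fst ℝ ℝ ℝ)).sub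
          ((h.differentiableAt_dx hz).hasFDerivAt.smul_const (ContinuousLinearMap.snd ℝ ℝ ℝ))
      rw [e.fderiv]
      simp only [sub_apply, ContinuousLinearMap.smulRight_apply,
        smul_apply, ContinuousLinearMap.coe_fst', ContinuousLinearMap.coe_snd',
        smul_eq_mul, hd, h.dx_dy_eq hz]
      linear_combination (v.2 * w.1 - v.1 * w.2) * h.dx_dx_add_dy_dy hz
  have hx : ∀ z ∈ fluidDomain ζ, dx φ z = dy u z := fun z hz => by
    rw [dx, (hφ z hz).fderiv]; simp [α]
  have hy : ∀ z ∈ fluidDomain ζ, dy φ z = - dx u z := fun z hz => by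
    rw [dy, (hφ z hz).fderiv]; simp [α]
  refine ⟨φ, fun z hz => ⟨hx z hz, hy z hz⟩, isHarmonicOn_of_planeLaplacian h.isOpen ?_ ?_⟩
  · have : ContDiffOn ℝ (1 + 1) φ (fluidDomain ζ) :=
      (contDiffOn_succ_iff_fderiv_of_isOpen h.isOpen).2
        ⟨fun z hz => (hφ z hz).differentiableAt.differentiableWithinAt, by simp,
          hα.congr fun z hz => (hφ z hz).fderiv⟩
    exact this.of_le (by norm_num)
  · intro z hz
    have ex : dx φ =ᶠ[𝓝 z] dy u := by filter_upwards [h.isOpen.mem_nhds hz] with w hw using hx w hw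
    have ey : dy φ =ᶠ[𝓝 z] fun w => - dx u w := by
      filter_upwards [h.isOpen.mem_nhds hz] with w hw using hy w hw
    change dx (dx φ) z + dy (dy φ) z = 0
    have e1 : dx (dx φ) z = dx (dy u) z := by
      conv_lhs => rw [dx, ex.fderiv_eq]
      rfl
    have e2 : dy (dy φ) z = - dy (dx u) z := by
      conv_lhs => rw [dy, ey.fderiv_eq, fderiv_fun_neg]
      rfl
    rw [e1, e2, h.dx_dy_eq hz]; ring

end IsRegularFlow

/-! ### From the stream function to the gravity wave. -/

theorem HasSurfaceValues.congr {ζ : ℝ → ℝ} {f g : ℝ × ℝ → ℝ} {a : ℝ → ℝ}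
    (hd : ∀ x, 0 < 1 + ζ x) (hf : HasSurfaceValues ζ f a) (h : ∀ z ∈ fluidDomain ζ, f z = g z) :
    HasSurfaceValues ζ g a := by
  filter_upwards [hf] with x hx
  refine hx.congr' ?_
  filter_upwards [Ioo_mem_nhdsLT (hd x)] with y hy using h (x, y) hy

theorem HasBottomValues.congr {ζ : ℝ → ℝ} {f g : ℝ × ℝ → ℝ} {a : ℝ → ℝ}
    (hd : ∀ x, 0 < 1 + ζ x) (hf : HasBottomValues f a) (h : ∀ z ∈ fluidDomain ζ, f z = g z) :
    HasBottomValues g a := by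
  filter_upwards [hf] with x hx
  refine hx.congr' ?_
  filter_upwards [Ioo_mem_nhdsGT (hd x)] with y hy using h (x, y) hy

/-- By the Cauchy–Riemann relations the surface values of `∇φ` are `(b, -a)`. Constancy of `u` along
the surface thus becomes the kinematic condition, its constancy along the bottom becomes `φ_y = 0`,
and `|∇φ| = |∇u|` carries the Bernoulli condition over. -/
theorem IsMinimizer.isStationaryGravityWave {m lam : ℝ} {δ : ℝ≥0∞} {ψ u φ : ℝ × ℝ → ℝ} {ζ : ℝ → ℝ}
    (hδ : 0 < δ) (h : IsMinimizer m δ lam ψ ζ)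
    (hψ : ψ =ᵐ[volume.restrict (fluidDomain ζ)] u) (hr : IsRegularFlow ζ u)
    (hφ : ∀ z ∈ fluidDomain ζ, dx φ z = dy u z ∧ dy φ z = - dx u z)
    (hh : IsHarmonicOn φ (fluidDomain ζ)) : IsStationaryGravityWave lam φ ζ := by
  obtain ⟨a, ha⟩ := hr.exists_surface_dx
  obtain ⟨b, hb⟩ := hr.exists_surface_dy
  obtain ⟨a₀, ha₀⟩ := hr.exists_bottom_dx
  have hkin := h.admissible.ae_kinematic hψ hr ha hb ha₀
  have hbern := h.ae_bernoulli hδ hψ hr ha hb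
  refine ⟨hh, ⟨b, fun x => - a x, hb.congr hr.depth_pos fun z hz => (hφ z hz).1.symm, ?_, ?_⟩, ?_, ?_⟩
  · refine HasSurfaceValues.congr (f := fun z => - dx u z) hr.depth_pos ?_
      fun z hz => (hφ z hz).2.symm
    filter_upwards [ha] with x hx using hx.neg
  · filter_upwards [hkin, hbern] with x h1 h2
    exact ⟨by linarith [h1.1], by rw [neg_sq]; linarith⟩
  · refine HasBottomValues.congr (f := fun z => - dx u z) hr.depth_pos ?_
      fun z hz => (hφ z hz).2.symm
    filter_upwards [ha₀, hkin] with x h1 h2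
    simpa [h2.2] using h1.neg
  · refine (integrableOn_congr_fun (fun z hz => ?_) hr.isOpen.measurableSet).1
      (hr.memLp_dy_sub_one.integrable_sq.add hr.memLp_dx.integrable_sq)
    simp only [Pi.add_apply, (hφ z hz).1, (hφ z hz).2, neg_sq]

end WaterWave

open WaterWave
theorem theorem2 (m lam : ℝ) (δ : ℝ≥0∞) (hδ : 0 < δ) (ψ : ℝ × ℝ → ℝ) (ζ : ℝ → ℝ)
    (hmin : IsMinimizer m δ lam ψ ζ) :
    ∃ u : ℝ × ℝ → ℝ,
      ψ =ᵐ[volume.restrict (fluidDomain ζ)] u ∧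
      IsHarmonicOn u (fluidDomain ζ) ∧
      (ContDiff ℝ 1 ζ → IsH2 ψ ζ →
        -- the Bernoulli condition on the free surface
        (∃ a b : ℝ → ℝ, HasSurfaceValues ζ (dx u) a ∧ HasSurfaceValues ζ (dy u) b ∧
          ∀ᵐ x, a x ^ 2 + b x ^ 2 + 2 * lam * ζ x = 1) ∧
        -- `ψ` is the stream function of an irrotational gravity wave
        ∃ φ : ℝ × ℝ → ℝ,
          (∀ z ∈ fluidDomain ζ, dx φ z = dy u z ∧ dy φ z = - dx u z) ∧
          IsStationaryGravityWave lam φ ζ) := by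
  have hA := hmin.admissible
  obtain ⟨u, hψ, hu⟩ := exists_harmonic_ae_eq (isOpen_fluidDomain hA.continuous_surface)
    (locallyIntegrableOn_univ.1 hA.hasWeakDeriv_wdx.locallyIntegrableOn)
    fun φ hφ hc hs => hmin.weakly_harmonic hδ hφ hc hs
  refine ⟨u, hψ, hu, fun hζ h2 => ?_⟩
  have hr := hA.isRegularFlow hψ hu hζ h2
  obtain ⟨a, ha⟩ := hr.exists_surface_dx
  obtain ⟨b, hb⟩ := hr.exists_surface_dy
  obtain ⟨φ, hφ, hh⟩ := hr.exists_conjugate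
  exact ⟨⟨a, b, ha, hb, hmin.ae_bernoulli hδ hψ hr ha hb⟩, φ, hφ,
    hmin.isStationaryGravityWave hδ hψ hr hφ hh⟩
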